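/- **Setting.** A finite unlabeled rooted tree is a root-preserving isomorphism class of finite rooted trees; let $\mathbb T$ be the countable discrete space of these, and $\mathbb T_*=\mathbb T\sqcup\{*\}$ (discrete). For $\mathbf t\in\mathbb T$ and a vertex $v$ of $\mathbf t$, let $v=v_0,v_1,\dots,v_h=\text{root}$ be the path from $v$ to the root; let $t_0$ be the subtree rooted at $v_0$ formed by the vertices whose path to the root passes through $v_0$ and, for $1\le k\le h$, let $t_k$ be the subtree rooted at $v_k$ formed by the vertices whose path to the root passes through $v_k$ but not through $v_{k-1}$. Let $\Phi(\mathbf t,\cdot)$ be the law of $(t_0,\dots,t_h,*,*,\dots)\in\mathbb T_*^{\infty}$ when $v$ is a uniformly chosen vertex of $\mathbf t$. Random trees $\mathcal T_n\in\mathbb T$ converge in the *probability fringe sense* to a $\mathbb T^\infty$-valued random variable $\mathcal T=(\mathcal T^0,\mathcal T^1,\dots)$ if the random probability measures $\Phi(\mathcal T_n,\cdot)$ converge in distribution to the (deterministic) law of $\mathcal T$, in the topology of weak convergence of probability measures on $\mathbb T_*^\infty$ (product topology). The *spectral distribution* of a tree is the empirical distribution of the eigenvalues of its adjacency matrix, counted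 with multiplicity. The set of probability measures on $\mathbb R$ carries the topology of weak convergence. **Theorem.** Let $(\mathcal T_n)$ be random finite unlabeled rooted trees converging in the probability fringe sense to $\mathcal T=(\mathcal T^0,\mathcal T^1,\dots)$, and let $F_n$ be the spectral distribution of $\mathcal T_n$. Then there are a deterministic probability measure $F$ on $\mathbb R$ and constants $c_\gamma$ ($\gamma\in\mathbb R$) such that $F_n\to F$ in distribution, $F_n(\{\gamma\})\to c_\gamma$ in distribution and $F(\{\gamma\})\ge c_\gamma$ for every $\gamma\in\mathbb R$, and such that the following holds. Let $\mathcal U$ be the random forest (finite multiset of unlabeled rooted trees, each rooted at a child of the deleted root) obtained by deleting the root of $\mathcal T^0$. If $\mathbf u$ is a finite forest of finite unlabeled rooted trees, $\gamma$ is an eigenvalue of the adjacency matrix of $\mathbf u$ of multiplicity $L>1$, and $\mathbb P\{\mathcal U=\mathbf u\}>0$, then $$c_\gamma>0,\qquad F(\{\gamma\})>0,\qquad F(\{\gamma\})\ \ge\ (L-1)\,\mathbb P\{\mathcal U=\mathbf u\}.$$ Moreover, for each of the following random trees with $n$ vertices, the spectral distributions converge in distribution, as $n\to\infty$, to a deterministic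 probability measure $F$ on $\mathbb R$, and the set of atoms of $F$ is dense in $\mathbb R$: 1. the random recursive tree (start with one vertex, the root; attach each new vertex to a uniformly chosen existing vertex); 2. for each $a>-1$, the linear preferential attachment tree (start with one vertex, the root; attach each new vertex to an existing vertex $v$ chosen with probability proportional to $D(v)+1+a$, where $D(v)$ is the current number of children of $v$); 3. the uniform random rooted labeled tree on $n$ vertices. -/

import Mathlib

open MeasureTheory Filter Topology
open scoped ENNReal

namespace RandomTreeSpectra

noncomputable section

/-! ### Finite rooted trees, labeled and unlabeled -/

/-- A rooted tree with vertex set `V`: a graph on `V` that is a tree, and a distinguished vertex. -/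
structure RTree (V : Type*) where
  graph : SimpleGraph V
  root : V
  isTree : graph.IsTree

namespace RTree

variable {V W : Type*}

theorem toPair_injective :
    Function.Injective (fun t : RTree V => (t.graph, t.root)) := by
  rintro ⟨G, r, h⟩ ⟨G', r', h'⟩ he
  simp only [Prod.mk.injEq] at he
  obtain ⟨rfl, rfl⟩ := he
  rfl

instance [Finite V] : Finite (RTree V) := Finite.of_injective _ toPair_injective

instance [Nonempty V] : Nonempty (RTree V) := by
  obtain ⟨T, -, hT⟩ := (SimpleGraph.connected_top (V := V)).exists_isTree_le
  exact ⟨⟨T, Classical.arbitrary V, hT⟩⟩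

/-- All sets of labeled rooted trees are measurable. -/
instance : MeasurableSpace (RTree V) := ⊤

/-- Transport of a rooted tree along a relabeling of the vertices. -/
def relabel (e : V ≃ W) (t : RTree V) : RTree W where
  graph := t.graph.comap e.symm
  root := e t.root
  isTree := (SimpleGraph.Iso.comap e.symm t.graph).isTree_iff.mpr t.isTree

/-- Two rooted trees are isomorphic if some graph isomorphism maps root to root. -/
def Isomorphic (s : RTree V) (t : RTree W) : Prop :=
  ∃ e : s.graph ≃g t.graph, e s.root = t.root

/-- The unique path from the vertex `v` to the root. -/
def path (t : RTree V) (v : V) : t.graph.Walk v t.root :=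
  (t.isTree.existsUnique_path v t.root).choose

theorem path_isPath (t : RTree V) (v : V) : (t.path v).IsPath :=
  (t.isTree.existsUnique_path v t.root).choose_spec.1

theorem eq_path (t : RTree V) {v : V} (p : t.graph.Walk v t.root) (hp : p.IsPath) :
    p = t.path v :=
  (t.isTree.existsUnique_path v t.root).unique hp (t.path_isPath v)

/-- The distance `h` from `v` to the root. -/
def height (t : RTree V) (v : V) : ℕ := (t.path v).length

/-- The `k`-th vertex `v_k` on the path `v = v_0, v_1, …, v_h = root` from `v` to the root. -/
def ancestor (t : RTree V) (v : V) (k : ℕ) : V := (t.path v).getVert k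

/-- For `k = 0`: the set of all vertices whose path to the root passes through `v_0 = v`.
For `k ≥ 1`: the set of all vertices whose path to the root passes through `v_k`, but not
through `v_{k-1}`. -/
def branchSet (t : RTree V) (v : V) (k : ℕ) : Set V :=
  {w | t.ancestor v k ∈ (t.path w).support ∧
    ∀ j, j + 1 = k → t.ancestor v j ∉ (t.path w).support}

theorem path_ancestor (t : RTree V) (v : V) (k : ℕ) :
    t.path (t.ancestor v k) = (t.path v).drop k :=
  (t.eq_path _ ((t.path_isPath v).drop k)).symm

theorem ancestor_mem_branchSet (t : RTree V) (v : V) {k : ℕ} (hk : k ≤ t.height v) :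
    t.ancestor v k ∈ t.branchSet v k := by
  refine ⟨SimpleGraph.Walk.start_mem_support _, ?_⟩
  rintro j rfl hj
  have hj : (t.path v).getVert j ∈ ((t.path v).drop (j + 1)).support :=
    t.path_ancestor v (j + 1) ▸ hj
  rw [SimpleGraph.Walk.mem_support_iff_exists_getVert] at hj
  obtain ⟨m, hm, -⟩ := hj
  rw [SimpleGraph.Walk.drop_getVert] at hm
  have hk' : j + 1 ≤ (t.path v).length := hk
  by_cases h : j + 1 + m ≤ (t.path v).length
  · have := (t.path_isPath v).getVert_injOn (by simpa using h)
      (by simp only [Set.mem_ofPred_eq]; omega) hm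
    omega
  · rw [SimpleGraph.Walk.getVert_of_length_le _ (by omega)] at hm
    have := ((t.path_isPath v).getVert_eq_end_iff (i := j) (by omega)).mp hm.symm
    omega

theorem induce_branchSet_isTree (t : RTree V) (v : V) {k : ℕ} (hk : k ≤ t.height v) :
    (t.graph.induce (t.branchSet v k)).IsTree := by
  classical
  refine ⟨?_, t.isTree.isAcyclic.induce _⟩
  refine t.graph.induce_connected_of_patches _ (t.ancestor_mem_branchSet v hk) ?_
  intro w hw
  let p := (t.path w).takeUntil _ hw.1
  refine ⟨{x | x ∈ p.support}, ?_, p.end_mem_support, p.start_mem_support,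
    p.connected_induce_support.preconnected _ _⟩
  intro x hx
  have hx' : x ∈ (t.path w).support := (t.path w).support_takeUntil_subset_support hw.1 hx
  have hpx : (t.path w).dropUntil x hx' = t.path x :=
    t.eq_path _ ((t.path_isPath w).dropUntil hx')
  refine ⟨?_, ?_⟩
  · have h1 : (t.path w).takeUntil _ hw.1 =
        (p.takeUntil x hx).append (p.dropUntil x hx) := (p.take_spec hx).symm
    have h2 : (t.path w) = (p.takeUntil x hx).append
        ((p.dropUntil x hx).append ((t.path w).dropUntil _ hw.1)) := by
      rw [SimpleGraph.Walk.append_assoc, ← h1, SimpleGraph.Walk.take_spec]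
    have h3 : (p.dropUntil x hx).append ((t.path w).dropUntil _ hw.1) = t.path x := by
      refine t.eq_path _ ?_
      have := t.path_isPath w
      rw [h2] at this
      exact this.of_append_right
    rw [← h3, SimpleGraph.Walk.mem_support_append_iff]
    exact Or.inr (SimpleGraph.Walk.start_mem_support _)
  · intro j hj hmem
    refine hw.2 j hj ?_
    rw [← hpx] at hmem
    exact (t.path w).support_dropUntil_subset_support hx' hmem

/-- The subtree `t_k` of `t`, rooted at `v_k`, where `v = v_0, v_1, …, v_h = root`. -/
def branch (t : RTree V) (v : V) (k : ℕ) (hk : k ≤ t.height v) : RTree (t.branchSet v k) where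
  graph := t.graph.induce (t.branchSet v k)
  root := ⟨t.ancestor v k, t.ancestor_mem_branchSet v hk⟩
  isTree := t.induce_branchSet_isTree v hk

/-- The children of `v`: the neighbors of `v` whose path to the root passes through `v`. -/
def children (t : RTree V) (v : V) : Set V :=
  {w | t.graph.Adj v w ∧ v ∈ (t.path w).support}

end RTree

/-- Root-preserving isomorphism of finite rooted trees, on representatives with vertex sets
`Fin n`. -/
instance treeSetoid : Setoid (Σ n : ℕ, RTree (Fin n)) where
  r s t := s.2.Isomorphic t.2
  iseqv :=
    { refl := fun _ => ⟨SimpleGraph.Iso.refl, rfl⟩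
      symm := fun ⟨e, he⟩ => ⟨e.symm, by rw [← he]; exact e.symm_apply_apply _⟩
      trans := fun ⟨e, he⟩ ⟨f, hf⟩ => ⟨e.trans f, by rw [← hf, ← he]; rfl⟩ }

/-- The space `𝕋` of finite unlabeled rooted trees: isomorphism classes of finite rooted trees. -/
def UTree : Type := Quotient treeSetoid

instance : Countable UTree := inferInstanceAs (Countable (Quotient treeSetoid))

/-- The space `𝕋` with an adjoined point `∗`: the space `𝕋_∗`. -/
def UTreeStar : Type := Option UTree

/-- The inclusion of `𝕋` in `𝕋_∗`. -/
def UTreeStar.ofTree (t : UTree) : UTreeStar := (some t : Option UTree)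

/-- The adjoined point `∗`. -/
def UTreeStar.star : UTreeStar := (none : Option UTree)

instance : Countable UTreeStar := inferInstanceAs (Countable (Option UTree))

instance : TopologicalSpace UTree := ⊥
instance : DiscreteTopology UTree := ⟨rfl⟩
instance : MeasurableSpace UTree := ⊤
instance : BorelSpace UTree := ⟨borel_eq_top_of_discrete.symm⟩
instance : TopologicalSpace UTreeStar := ⊥
instance : DiscreteTopology UTreeStar := ⟨rfl⟩
instance : MeasurableSpace UTreeStar := ⊤
instance : BorelSpace UTreeStar := ⟨borel_eq_top_of_discrete.symm⟩

/-- The isomorphism class of a rooted tree with finite vertex set. -/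
def RTree.unlabel {V : Type*} [Finite V] (t : RTree V) : UTree :=
  Quotient.mk treeSetoid ⟨Nat.card V, t.relabel (Finite.equivFin V)⟩

namespace UTree

/-- The number of vertices of (a labeled representative of) an unlabeled rooted tree. -/
def size (t : UTree) : ℕ := (Quotient.out t).1

/-- A labeled representative of an unlabeled rooted tree. Everything that is computed from it
below is invariant under isomorphism. -/
def rep (t : UTree) : RTree (Fin t.size) := (Quotient.out t).2

instance (t : UTree) : Nonempty (Fin t.size) := ⟨t.rep.root⟩

/-- The forest, as a finite multiset of unlabeled rooted trees, obtained from `t` by deleting its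
root: one tree for each child `c` of the root, namely the subtree below `c`, rooted at `c`. -/
def deleteRoot (t : UTree) : Multiset UTree :=
  open scoped Classical in
  (Finset.univ.filter fun c => t.rep.graph.Adj t.rep.root c).val.map
    fun c => (t.rep.branch c 0 (Nat.zero_le _)).unlabel

end UTree

/-! ### Empirical distributions, spectra -/

/-- The probability measure that places mass `1 / #V` at `f v`, as `v` ranges over `V`. -/
def empirical {V E : Type*} [Fintype V] [Nonempty V] [MeasurableSpace E] (f : V → E) :
    ProbabilityMeasure E :=
  ⟨(Fintype.card V : ℝ≥0∞)⁻¹ • ∑ v, Measure.dirac (f v), ⟨by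
    simp only [Measure.smul_apply, Measure.finsetSum_apply, measure_univ, Finset.sum_const,
      Finset.card_univ, nsmul_eq_mul, mul_one, smul_eq_mul]
    exact ENNReal.inv_mul_cancel (by simp) (by simp)⟩⟩

/-- The adjacency matrix of a rooted tree. -/
def RTree.adjMatrix {V : Type*} (t : RTree V) : Matrix V V ℝ :=
  open scoped Classical in t.graph.adjMatrix ℝ

theorem RTree.adjMatrix_isHermitian {V : Type*} (t : RTree V) : t.adjMatrix.IsHermitian := by
  classical
  rw [Matrix.IsHermitian, Matrix.conjTranspose_eq_transpose_of_trivial]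
  exact t.graph.isSymm_adjMatrix

/-- The spectral distribution of a finite rooted tree: the empirical distribution of the
eigenvalues, with multiplicities, of its adjacency matrix. -/
def RTree.spectralDist {n : ℕ} [Nonempty (Fin n)] (t : RTree (Fin n)) : ProbabilityMeasure ℝ :=
  empirical t.adjMatrix_isHermitian.eigenvalues

/-- The spectral distribution of an unlabeled rooted tree. -/
def UTree.spectralDist (t : UTree) : ProbabilityMeasure ℝ := t.rep.spectralDist

/-- The adjacency matrix of a finite forest: the block diagonal matrix whose blocks are the
adjacency matrices of the trees in the forest. -/
def forestAdjMatrix (u : Multiset UTree) :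
    Matrix (Σ i : Fin u.toList.length, Fin (u.toList.get i).size)
      (Σ i : Fin u.toList.length, Fin (u.toList.get i).size) ℝ :=
  Matrix.blockDiagonal' fun i => (u.toList.get i).rep.adjMatrix

/-- The multiplicity of `γ` as an eigenvalue of the adjacency matrix of a finite forest
(it is `0` if `γ` is not an eigenvalue). -/
def forestMultiplicity (u : Multiset UTree) (γ : ℝ) : ℕ :=
  Module.finrank ℝ (Module.End.eigenspace (Matrix.toLin' (forestAdjMatrix u)) γ)

/-! ### Convergence -/

/-- Convergence in probability (equivalently, in distribution) of the random elements `X n`,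
where `X n` is defined on the probability space `(Ω n, P n)`, to the constant `c`. -/
def TendstoInProb {Ω : ℕ → Type*} [∀ n, MeasurableSpace (Ω n)] {E : Type*} [TopologicalSpace E]
    (P : ∀ n, Measure (Ω n)) (X : ∀ n, Ω n → E) (c : E) : Prop :=
  ∀ U ∈ 𝓝 c, Tendsto (fun n => P n (X n ⁻¹' U)) atTop (𝓝 1)

/-- The sequence `(t_0, t_1, …, t_h, ∗, ∗, …)` of subtrees along the path from `v` to the root. -/
def RTree.fringeSeq {V : Type*} [Finite V] (t : RTree V) (v : V) : ℕ → UTreeStar :=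
  fun k => if hk : k ≤ t.height v then .ofTree (t.branch v k hk).unlabel else .star

/-- The probability measure `Φ(t, ·)` on `𝕋_∗^∞`: the law of `(t_0, t_1, …, t_h, ∗, ∗, …)` for a
uniformly chosen vertex of `t`. -/
def UTree.fringeDist (t : UTree) : ProbabilityMeasure (ℕ → UTreeStar) :=
  empirical t.rep.fringeSeq

/-- The inclusion of `𝕋^∞` in `𝕋_∗^∞`. -/
def sinInclusion (s : ℕ → UTree) : ℕ → UTreeStar := fun k => UTreeStar.ofTree (s k)

theorem measurable_sinInclusion : Measurable sinInclusion :=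
  measurable_pi_lambda _ fun k =>
    (measurable_from_top (f := UTreeStar.ofTree)).comp (measurable_pi_apply k)

/-- The law of a `𝕋^∞`-valued random variable (a random sin-tree), as a law on `𝕋_∗^∞`. -/
def sinLaw {Ω' : Type*} [MeasurableSpace Ω'] (Q : Measure Ω') [IsProbabilityMeasure Q]
    (S : Ω' → ℕ → UTree) (hS : Measurable S) : ProbabilityMeasure (ℕ → UTreeStar) :=
  ⟨Q.map (sinInclusion ∘ S),
    Measure.isProbabilityMeasure_map (measurable_sinInclusion.comp hS).aemeasurable⟩

/-- Convergence in the probability fringe sense of the random trees `T n` to the random sin-tree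
`S`: the random probability measures `Φ(T n, ·)` converge in distribution to the law of `S`,
for the topology of weak convergence of probability measures on `𝕋_∗^∞`. -/
def FringeConverges {Ω : ℕ → Type*} [∀ n, MeasurableSpace (Ω n)] (P : ∀ n, Measure (Ω n))
    (T : ∀ n, Ω n → UTree) {Ω' : Type*} [MeasurableSpace Ω'] (Q : Measure Ω')
    [IsProbabilityMeasure Q] (S : Ω' → ℕ → UTree) (hS : Measurable S) : Prop :=
  TendstoInProb P (fun n ω => (T n ω).fringeDist) (sinLaw Q S hS)

/-! ### Three models of random trees with `n + 1` vertices -/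

/-- The rooted tree consisting of a single vertex. -/
def RTree.single : RTree (Fin 1) where
  graph := ⊥
  root := 0
  isTree := SimpleGraph.IsTree.of_subsingleton

theorem attach_isTree {m : ℕ} (t : RTree (Fin m)) (v : Fin m) :
    (t.graph.map Fin.castSuccEmb ⊔
      SimpleGraph.edge v.castSucc (Fin.last m)).IsTree := by
  classical
  rw [SimpleGraph.isTree_iff_connected_and_card]
  have hlast : ∀ x, ¬ (t.graph.map Fin.castSuccEmb).Adj x (Fin.last m) := by
    intro x hx
    obtain ⟨a, b, -, -, hb⟩ := (SimpleGraph.map_adj _ _ _ _).mp hx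
    exact (Fin.castSucc_lt_last b).ne hb
  have hadj : ¬ (t.graph.map Fin.castSuccEmb).Adj v.castSucc (Fin.last m) := hlast _
  constructor
  · have hreach : ∀ x, (t.graph.map Fin.castSuccEmb ⊔
        SimpleGraph.edge v.castSucc (Fin.last m)).Reachable v.castSucc x := by
      intro x
      induction x using Fin.lastCases with
      | last =>
        refine SimpleGraph.Adj.reachable (Or.inr ?_)
        rw [SimpleGraph.edge_adj]
        exact ⟨Or.inl ⟨rfl, rfl⟩, (Fin.castSucc_lt_last v).ne⟩
      | cast y =>
        have h := (t.isTree.connected.preconnected v y).map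
          (SimpleGraph.Embedding.map Fin.castSuccEmb t.graph).toHom
        exact h.mono le_sup_left
    have : Nonempty (Fin (m + 1)) := ⟨Fin.last m⟩
    exact ⟨fun x y => (hreach x).symm.trans (hreach y)⟩
  · have h := t.isTree.card_edgeFinset
    have hmap : (t.graph.map Fin.castSuccEmb).edgeFinset.card = t.graph.edgeFinset.card := by
      rw [SimpleGraph.edgeFinset_card, SimpleGraph.edgeFinset_card, ← Nat.card_eq_fintype_card,
        ← Nat.card_eq_fintype_card, SimpleGraph.edgeSet_map,
        Nat.card_image_of_injective (Function.Embedding.injective _)]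
    rw [Nat.card_eq_fintype_card, ← SimpleGraph.edgeFinset_card,
      SimpleGraph.card_edgeFinset_sup_edge _ hadj (Fin.castSucc_lt_last v).ne,
      hmap, h]
    simp

/-- The rooted tree obtained from `t` by adding the new vertex `Fin.last m` and an edge between
it and the vertex `v` of `t`. -/
def RTree.attach {m : ℕ} (t : RTree (Fin m)) (v : Fin m) : RTree (Fin (m + 1)) where
  graph := t.graph.map Fin.castSuccEmb ⊔ SimpleGraph.edge v.castSucc (Fin.last m)
  root := t.root.castSucc
  isTree := attach_isTree t v

/-- The vertex `v` of a tree chosen with probability proportional to `w (D v)`, where `D v` is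
the out-degree (number of children) of `v` and `w` is a positive function. -/
def attachmentVertex (w : ℕ → ℝ) (hw : ∀ d, 0 < w d) {m : ℕ} (t : RTree (Fin (m + 1))) :
    PMF (Fin (m + 1)) :=
  PMF.normalize (fun v => ENNReal.ofReal (w (t.children v).ncard))
    (by
      rw [tsum_fintype]
      exact fun h => (ENNReal.ofReal_pos.mpr (hw (t.children 0).ncard)).ne'
        (Finset.sum_eq_zero_iff.mp h 0 (Finset.mem_univ _)))
    (by
      rw [tsum_fintype]
      exact ENNReal.sum_ne_top.mpr fun v _ => ENNReal.ofReal_ne_top)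

/-- The law on trees with `n + 1` vertices given by sequential growth: start with a single vertex,
the root; at each stage attach a new vertex to a vertex `v` of the current tree that is chosen
with probability proportional to `w (D v)`, where `D v` is the out-degree of `v`. -/
def growingTree (w : ℕ → ℝ) (hw : ∀ d, 0 < w d) : ∀ n : ℕ, PMF (RTree (Fin (n + 1)))
  | 0 => PMF.pure RTree.single
  | n + 1 => (growingTree w hw n).bind fun t => (attachmentVertex w hw t).map t.attach

/-- The random recursive tree: the new vertex is attached to a uniformly chosen vertex. -/
def recursiveTree (n : ℕ) : PMF (RTree (Fin (n + 1))) :=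
  growingTree (fun _ => 1) (fun _ => one_pos) n

theorem prefWeight_pos {a : ℝ} (ha : -1 < a) (d : ℕ) : 0 < (d : ℝ) + 1 + a := by
  have : (0 : ℝ) ≤ d := d.cast_nonneg
  linarith

/-- The linear preferential attachment tree with parameter `a > -1`: the new vertex is attached
to `v` with probability proportional to `D v + 1 + a`. -/
def preferentialTree (a : ℝ) (ha : -1 < a) (n : ℕ) : PMF (RTree (Fin (n + 1))) :=
  growingTree (fun d => (d : ℝ) + 1 + a) (prefWeight_pos ha) n

/-- The uniform random rooted (unordered) labeled tree. -/
def uniformTree (n : ℕ) : PMF (RTree (Fin (n + 1))) :=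
  letI : Fintype (RTree (Fin (n + 1))) := Fintype.ofFinite _
  PMF.uniformOfFintype (RTree (Fin (n + 1)))

/-- The spectral distributions of the random trees with laws `μ n` converge weakly, in
distribution, to a deterministic probability measure `F`, and the atoms of `F` are dense in `ℝ`. -/
def HasDenseAtomsInLimit (μ : ∀ n : ℕ, PMF (RTree (Fin (n + 1)))) : Prop :=
  ∃ F : ProbabilityMeasure ℝ,
    TendstoInProb (fun n => (μ n).toMeasure) (fun _ t => t.spectralDist) F ∧
    Dense {x : ℝ | 0 < (F : Measure ℝ).real {x}}

end

end RandomTreeSpectra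

namespace RandomTreeSpectra

noncomputable section

namespace RTree

variable {V W : Type*}

/-! ### The parent function of a rooted tree -/

/-! The mass that a spectral distribution gives to a half-line is an average, over the vertices, of
a bounded function of the fringe subtree (the vertex and everything below it). Define the increment
of a tree functional `g` at `T` as `g T` minus the sum of `g` over the trees left after deleting the
root. Over all fringe subtrees of a tree the increments telescope to the value at the whole tree
(`sum_increment_fringe`). If `g` counts the eigenvalues in `(-∞, x]`, deleting the root removes one
row and one column of the adjacency matrix, so interlacing (`countP_submatrix_ne`) puts the
increment in `[0, 1]`. Fringe convergence makes the empirical law of the fringe subtrees converge to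
the law `ρ` of `𝒯⁰`, so the masses converge to integrals against `ρ`; these form a distribution
function (`limitCDF`) by dominated convergence. The same argument for `{γ}` gives `c γ`, and the
portmanteau theorem gives `c γ ≤ F {γ}`.

Atoms come from eigenvectors of fringe subtrees that vanish at the root: extended by zero they are
eigenvectors of the whole tree, and those of distinct fringe subtrees of equal size have disjoint
supports (`card_mul_finrank_le`). If `γ` has multiplicity `L` in the forest below the root, one
linear condition, the equation at the root, cuts out a space of such eigenvectors of dimension at
least `L - 1` (`count_deletedMatrix_le`).

For the three models it suffices that every finite tree has a positive limiting proportion, that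
these proportions sum to one, and that the fringe counts satisfy a law of large numbers in mean
square (`hasDenseAtomsInLimit_of_expect`). Density of the atoms is then a fact about finite trees:
symmetric caterpillars supply a dense set of eigenvalues with eigenvectors that vanish at the root
(`dense_rootedEigenspace_ne_bot`).

In the growth models a leaf attached at `v` changes only the fringe subtrees of the ancestors of
`v`. This gives a linear recursion on the tree size for the limits (`growthLimit`) and a one-step
inequality for the squared error (`sum_sq_fringeSum_attach_le`). For uniform labeled trees, cutting
the edge above a vertex (`graft_bijective`) turns moments of fringe counts into counts of pairs of
trees; Cayley's formula and the Poisson limit theorem then give the limit, whose total mass is that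
of the Borel distribution (`hasSum_borelMass`). -/

/-- The parent of a vertex; by convention the root is its own parent. -/
def par (t : RTree V) (v : V) : V := t.ancestor v 1

/-- `t.Below v w` says that `v` is on the path from `w` to the root. -/
def Below (t : RTree V) (v w : V) : Prop := ∃ k, t.par^[k] w = v

theorem ancestor_succ (t : RTree V) (v : V) (k : ℕ) :
    t.ancestor v (k + 1) = t.par (t.ancestor v k) := by
  have h : (t.path (t.ancestor v k)).getVert 1 = ((t.path v).drop k).getVert 1 :=
    congrArg (fun p => p.getVert 1) (t.path_ancestor v k)
  exact ((SimpleGraph.Walk.drop_getVert _ _ _).symm.trans h.symm)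

/-- Holds for every `k`, since both sides stay at the root once they reach it. It allows walks to be
replaced by iterates of `par`. -/
theorem ancestor_eq_iterate (t : RTree V) (v : V) (k : ℕ) :
    t.ancestor v k = t.par^[k] v := by
  induction k with
  | zero => simp [ancestor]
  | succ k ih => rw [ancestor_succ, ih, Function.iterate_succ_apply']

theorem par_root (t : RTree V) : t.par t.root = t.root := by
  have : t.path t.root = SimpleGraph.Walk.nil := (t.eq_path _ SimpleGraph.Walk.IsPath.nil).symm
  simp [par, ancestor, this]

theorem iterate_height (t : RTree V) (v : V) : t.par^[t.height v] v = t.root := by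
  rw [← ancestor_eq_iterate, ancestor, height, SimpleGraph.Walk.getVert_length]

theorem below_root (t : RTree V) (v : V) : t.Below t.root v := ⟨_, t.iterate_height v⟩

theorem below_iff_mem_support (t : RTree V) (v w : V) :
    t.Below v w ↔ v ∈ (t.path w).support := by
  rw [SimpleGraph.Walk.mem_support_iff_exists_getVert]
  constructor
  · rintro ⟨k, rfl⟩
    rw [← ancestor_eq_iterate]
    by_cases h : k ≤ (t.path w).length
    · exact ⟨k, rfl, h⟩
    · refine ⟨_, ?_, le_rfl⟩
      rw [SimpleGraph.Walk.getVert_length]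
      exact (SimpleGraph.Walk.getVert_of_length_le _ (by omega)).symm
  · rintro ⟨k, hk, -⟩
    exact ⟨k, by rw [← ancestor_eq_iterate]; exact hk⟩

theorem branchSet_zero (t : RTree V) (v : V) : t.branchSet v 0 = {w | t.Below v w} := by
  ext w
  simp [branchSet, below_iff_mem_support, ancestor]

theorem Below.refl (t : RTree V) (v : V) : t.Below v v := ⟨0, rfl⟩

theorem Below.trans {t : RTree V} {u v w : V} (h : t.Below u v) (h' : t.Below v w) :
    t.Below u w := by
  obtain ⟨k, rfl⟩ := h
  obtain ⟨l, rfl⟩ := h'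
  exact ⟨k + l, Function.iterate_add_apply _ _ _ _⟩

theorem below_par (t : RTree V) (v : V) : t.Below (t.par v) v := ⟨1, rfl⟩

theorem iterate_root (t : RTree V) (k : ℕ) : t.par^[k] t.root = t.root :=
  Function.iterate_fixed t.par_root k

theorem adj_par (t : RTree V) {v : V} (hv : v ≠ t.root) : t.graph.Adj v (t.par v) := by
  rw [par, ancestor]
  exact SimpleGraph.Walk.adj_snd (SimpleGraph.Walk.not_nil_of_ne hv)

theorem par_ne (t : RTree V) {v : V} (hv : v ≠ t.root) : t.par v ≠ v := (t.adj_par hv).ne'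

theorem par_eq_self_iff (t : RTree V) {v : V} : t.par v = v ↔ v = t.root :=
  ⟨fun h => by_contra fun hv => t.par_ne hv h, fun h => h ▸ t.par_root⟩

theorem height_par (t : RTree V) {v : V} (hv : v ≠ t.root) :
    t.height (t.par v) + 1 = t.height v := by
  have h := congrArg SimpleGraph.Walk.length (t.path_ancestor v 1)
  have h' := h.trans (SimpleGraph.Walk.drop_length (t.path v) 1)
  change (t.path (t.ancestor v 1)).length + 1 = (t.path v).length
  have : 0 < (t.path v).length := by
    rw [Nat.pos_iff_ne_zero]
    exact fun h => hv (SimpleGraph.Walk.eq_of_length_eq_zero h)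
  omega

theorem height_root (t : RTree V) : t.height t.root = 0 := by
  have : t.path t.root = SimpleGraph.Walk.nil := (t.eq_path _ SimpleGraph.Walk.IsPath.nil).symm
  simp [height, this]

theorem height_par_le (t : RTree V) (v : V) : t.height (t.par v) ≤ t.height v := by
  by_cases hv : v = t.root
  · rw [hv, par_root]
  · have := t.height_par hv; omega

/-- Prepending an edge to the path of one endpoint gives the path of the other, by uniqueness of
paths; which endpoint comes first depends on whether `v` lies on the path of `w`. -/
theorem adj_iff (t : RTree V) {v w : V} :
    t.graph.Adj v w ↔ (v ≠ t.root ∧ t.par v = w) ∨ (w ≠ t.root ∧ t.par w = v) := by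
  classical
  constructor
  · intro h
    by_cases hv : v ∈ (t.path w).support
    · right
      have hp : (SimpleGraph.Walk.cons h.symm ((t.path w).dropUntil v hv)) = t.path w := by
        refine t.eq_path _ ?_
        rw [SimpleGraph.Walk.cons_isPath_iff]
        refine ⟨(t.path_isPath w).dropUntil hv, fun hw => ?_⟩
        have h1 := (t.path_isPath w)
        rw [← (t.path w).take_spec hv] at h1
        -- If `w` recurred on the tail of its own path after `v`, comparing lengths would force the
        -- piece from `w` to `v` to be empty.
        have h2 : ((t.path w).takeUntil v hv).length = 0 := by
          have e1 : (t.path w).dropUntil v hv = t.path v :=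
            t.eq_path _ ((t.path_isPath w).dropUntil hv)
          have e2 : ((t.path w).dropUntil v hv).dropUntil w hw = t.path w :=
            t.eq_path _ (((t.path_isPath w).dropUntil hv).dropUntil hw)
          have l1 := congrArg SimpleGraph.Walk.length ((t.path w).take_spec hv)
          have l2 := congrArg SimpleGraph.Walk.length
            (((t.path w).dropUntil v hv).take_spec hw)
          rw [SimpleGraph.Walk.length_append] at l1 l2
          rw [e2] at l2
          omega
        exact h.ne (SimpleGraph.Walk.eq_of_length_eq_zero h2).symm
      refine ⟨?_, ?_⟩
      · rintro rfl
        have : t.path t.root = SimpleGraph.Walk.nil :=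
          (t.eq_path _ SimpleGraph.Walk.IsPath.nil).symm
        rw [this] at hv
        simp only [SimpleGraph.Walk.support_nil, List.mem_singleton] at hv
        exact h.ne hv
      · rw [par, ancestor, ← hp]
        simp
    · left
      have hp : SimpleGraph.Walk.cons h (t.path w) = t.path v :=
        t.eq_path _ ((SimpleGraph.Walk.cons_isPath_iff _ _).mpr ⟨t.path_isPath w, hv⟩)
      refine ⟨?_, ?_⟩
      · rintro rfl
        exact hv (SimpleGraph.Walk.end_mem_support _)
      · rw [par, ancestor, ← hp]
        simp
  · rintro (⟨h, rfl⟩ | ⟨h, rfl⟩)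
    · exact t.adj_par h
    · exact (t.adj_par h).symm

/-- The root is the unique fixed point of `par`, and the edges join the other vertices to their
parents. -/
theorem ext_par {s t : RTree V} (h : s.par = t.par) : s = t := by
  have hr : s.root = t.root := by
    rw [← t.par_eq_self_iff, ← h, s.par_root]
  apply toPair_injective
  simp only [Prod.mk.injEq]
  refine ⟨?_, hr⟩
  ext v w
  rw [adj_iff, adj_iff, h, hr]

/-- A function that moves every vertex other than the root to a neighbor of lower rank is the
parent function. -/
theorem par_eq_of (t : RTree V) (p : V → V) (d : V → ℕ) (hr : p t.root = t.root)
    (hadj : ∀ v, v ≠ t.root → t.graph.Adj v (p v)) (hd : ∀ v, v ≠ t.root → d (p v) < d v) :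
    t.par = p := by
  -- The bound on ranks along the path is carried through the induction because it shows that `v` is
  -- not on the path of `p v`, so that prepending `v` gives a path.
  have key : ∀ n v, d v ≤ n → t.par v = p v ∧ ∀ u ∈ (t.path v).support, d u ≤ d v := by
    intro n
    induction n with
    | zero =>
      intro v hv
      by_cases h : v = t.root
      · subst h
        have : t.path t.root = SimpleGraph.Walk.nil :=
          (t.eq_path _ SimpleGraph.Walk.IsPath.nil).symm
        rw [t.par_root, hr, this]
        simp
      · have := hd v h; omega
    | succ n ih =>
      intro v hv
      by_cases h : v = t.root
      · subst h
        have : t.path t.root = SimpleGraph.Walk.nil :=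
          (t.eq_path _ SimpleGraph.Walk.IsPath.nil).symm
        rw [t.par_root, hr, this]
        simp
      · have hlt := hd v h
        obtain ⟨-, h2⟩ := ih (p v) (by omega)
        have hp : SimpleGraph.Walk.cons (hadj v h) (t.path (p v)) = t.path v := by
          refine t.eq_path _ ((SimpleGraph.Walk.cons_isPath_iff _ _).mpr ⟨t.path_isPath _, ?_⟩)
          intro hm
          have := h2 v hm; omega
        refine ⟨?_, ?_⟩
        · rw [par, ancestor, ← hp]; simp
        · intro u hu
          rw [← hp, SimpleGraph.Walk.support_cons, List.mem_cons] at hu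
          rcases hu with rfl | hu
          · exact le_rfl
          · have := h2 u hu; omega
  funext v
  exact (key _ v le_rfl).1

/-- The graph whose edges join the vertices other than `r` to their images under `p`. -/
def parGraph (r : V) (p : V → V) (d : V → ℕ) (hd : ∀ v, v ≠ r → d (p v) < d v) :
    SimpleGraph V where
  Adj v w := (v ≠ r ∧ p v = w) ∨ (w ≠ r ∧ p w = v)
  symm := ⟨fun _ _ h => h.symm⟩
  loopless := ⟨fun v h => by
    rcases h with ⟨h, h'⟩ | ⟨h, h'⟩ <;>
    · have := hd v h
      rw [h'] at this
      exact lt_irrefl _ this⟩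

/-- Following `p` lowers the rank until `r` is reached, so the graph is connected; each vertex other
than `r` owns exactly one edge, because two vertices cannot each have the lower rank, so there is
one edge fewer than vertices. -/
theorem parGraph_isTree [Finite V] (r : V) (p : V → V) (d : V → ℕ)
    (hd : ∀ v, v ≠ r → d (p v) < d v) : (parGraph r p d hd).IsTree := by
  rw [SimpleGraph.isTree_iff_connected_and_card]
  constructor
  · have hreach : ∀ n v, d v ≤ n → (parGraph r p d hd).Reachable r v := by
      intro n
      induction n with
      | zero =>
        intro v hv
        by_cases h : v = r
        · rw [h]
        · have := hd v h; omega
      | succ n ih =>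
        intro v hv
        by_cases h : v = r
        · rw [h]
        · have hlt := hd v h
          refine (ih (p v) (by omega)).trans (SimpleGraph.Adj.reachable ?_)
          exact Or.inr ⟨h, rfl⟩
    have : Nonempty V := ⟨r⟩
    exact ⟨fun x y => (hreach _ x le_rfl).symm.trans (hreach _ y le_rfl)⟩
  · have e : {v // v ≠ r} ≃ (parGraph r p d hd).edgeSet := by
      refine Equiv.ofBijective (fun v => ⟨s(v.1, p v.1), Or.inl ⟨v.2, rfl⟩⟩) ⟨?_, ?_⟩
      · rintro ⟨v, hv⟩ ⟨w, hw⟩ h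
        have h := Sym2.eq_iff.mp (congrArg Subtype.val h)
        rcases h with ⟨h, -⟩ | ⟨h, h'⟩
        · exact Subtype.ext h
        · have h1 := hd v hv
          have h2 := hd w hw
          dsimp only at h h'
          rw [h'] at h1
          rw [← h] at h2
          omega
      · rintro ⟨e, he⟩
        induction e with
        | _ v w =>
          rcases he with ⟨h, h'⟩ | ⟨h, h'⟩
          · exact ⟨⟨v, h⟩, by simp [h']⟩
          · exact ⟨⟨w, h⟩, by simp [h', Sym2.eq_swap]⟩
    rw [← Nat.card_congr e]
    have := Fintype.ofFinite V
    classical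
    rw [Nat.card_eq_fintype_card, Nat.card_eq_fintype_card, Fintype.card_subtype_compl,
      Fintype.card_subtype_eq]
    have : 0 < Fintype.card V := Fintype.card_pos_iff.mpr ⟨r⟩
    omega

/-- The rooted tree with a given root and a given parent function. -/
def ofParent [Finite V] (r : V) (p : V → V) (d : V → ℕ) (hd : ∀ v, v ≠ r → d (p v) < d v) :
    RTree V where
  graph := parGraph r p d hd
  root := r
  isTree := parGraph_isTree r p d hd

theorem par_ofParent [Finite V] (r : V) (p : V → V) (d : V → ℕ)
    (hd : ∀ v, v ≠ r → d (p v) < d v) (hr : p r = r) : (ofParent r p d hd).par = p :=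
  par_eq_of _ p d hr (fun _ hv => Or.inl ⟨hv, rfl⟩) hd

/-- The right side needs no condition on the root, which is preserved as the only fixed point of the
parent function. -/
theorem isomorphic_iff {s : RTree V} {t : RTree W} :
    s.Isomorphic t ↔ ∃ e : V ≃ W, ∀ v, e (s.par v) = t.par (e v) := by
  constructor
  · rintro ⟨e, he⟩
    refine ⟨e.toEquiv, fun v => ?_⟩
    have h : s.par = fun v => e.symm (t.par (e v)) := by
      refine par_eq_of s _ (fun v => t.height (e v)) ?_ ?_ ?_
      · rw [he, t.par_root, ← he, e.symm_apply_apply]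
      · intro v hv
        rw [← e.map_adj_iff, e.apply_symm_apply]
        refine t.adj_par fun h => hv ?_
        rw [← he] at h
        exact e.injective h
      · intro v hv
        simp only [e.apply_symm_apply]
        have := t.height_par (v := e v) (fun h => hv (e.injective (h.trans he.symm)))
        omega
    rw [h]
    exact e.apply_symm_apply _
  · rintro ⟨e, he⟩
    have hr : e s.root = t.root := by
      rw [← t.par_eq_self_iff, ← he, s.par_root]
    refine ⟨⟨e, ?_⟩, hr⟩
    intro v w
    rw [adj_iff, adj_iff, ← he, ← he, e.injective.eq_iff, e.injective.eq_iff, ← hr,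
      e.injective.ne_iff, e.injective.ne_iff]

theorem Isomorphic.symm {s : RTree V} {t : RTree W} (h : s.Isomorphic t) : t.Isomorphic s := by
  obtain ⟨e, he⟩ := h
  exact ⟨e.symm, by rw [← he]; exact e.symm_apply_apply _⟩

theorem Isomorphic.trans {X : Type*} {s : RTree V} {t : RTree W} {u : RTree X}
    (h : s.Isomorphic t) (h' : t.Isomorphic u) : s.Isomorphic u := by
  obtain ⟨e, he⟩ := h
  obtain ⟨f, hf⟩ := h'
  exact ⟨e.trans f, by rw [← hf, ← he]; rfl⟩

theorem isomorphic_relabel (t : RTree V) (e : V ≃ W) : t.Isomorphic (t.relabel e) :=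
  ⟨(SimpleGraph.Iso.comap e.symm t.graph).symm, rfl⟩

theorem par_relabel (t : RTree V) (e : V ≃ W) (w : W) :
    (t.relabel e).par w = e (t.par (e.symm w)) := by
  have h : (t.relabel e).par = fun w => e (t.par (e.symm w)) := by
    refine par_eq_of _ _ (fun w => t.height (e.symm w)) ?_ ?_ ?_
    · simp [relabel, t.par_root]
    · intro w hw
      change t.graph.Adj (e.symm w) (e.symm (e (t.par (e.symm w))))
      rw [e.symm_apply_apply]
      exact t.adj_par fun h => hw (by simp [relabel, ← h])
    · intro w hw
      simp only [e.symm_apply_apply]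
      have := t.height_par (v := e.symm w) fun h => hw (by simp [relabel, ← h])
      omega
  rw [h]

theorem unlabel_eq_iff [Finite V] [Finite W] {s : RTree V} {t : RTree W} :
    s.unlabel = t.unlabel ↔ s.Isomorphic t := by
  unfold unlabel
  constructor
  · intro h
    have h' : (s.relabel (Finite.equivFin V)).Isomorphic (t.relabel (Finite.equivFin W)) :=
      Quotient.exact h
    exact (s.isomorphic_relabel _).trans (h'.trans (t.isomorphic_relabel _).symm)
  · intro h
    refine Quotient.sound (?_ : (s.relabel _).Isomorphic (t.relabel _))
    exact (s.isomorphic_relabel _).symm.trans (h.trans (t.isomorphic_relabel _))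

theorem unlabel_rep (T : UTree) : T.rep.unlabel = T := by
  conv_rhs => rw [← Quotient.out_eq T]
  exact Quotient.sound (T.rep.isomorphic_relabel _).symm

theorem rep_unlabel_isomorphic [Finite V] (t : RTree V) : t.unlabel.rep.Isomorphic t :=
  unlabel_eq_iff.mp (unlabel_rep _)

theorem Isomorphic.card_eq {s : RTree V} {t : RTree W} (h : s.Isomorphic t) :
    Nat.card V = Nat.card W := Nat.card_congr h.choose.toEquiv

theorem size_unlabel [Finite V] (t : RTree V) : t.unlabel.size = Nat.card V := by
  rw [← t.rep_unlabel_isomorphic.card_eq, Nat.card_eq_fintype_card, Fintype.card_fin]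

/-! ### Fringe subtrees -/

/-- The subtree consisting of `v` and everything below it, as an unlabeled tree. -/
def fringe [Finite V] (t : RTree V) (v : V) : UTree := (t.branch v 0 (Nat.zero_le _)).unlabel

/-- The subtree consisting of `v` and everything below it. -/
def sub (t : RTree V) (v : V) : RTree {w // t.Below v w} :=
  (t.branch v 0 (Nat.zero_le _)).relabel
    (Equiv.setCongr (t.branchSet_zero v))

theorem sub_isomorphic (t : RTree V) (v : V) :
    (t.sub v).Isomorphic (t.branch v 0 (Nat.zero_le _)) :=
  (isomorphic_relabel _ _).symm

theorem unlabel_sub [Finite V] (t : RTree V) (v : V) : (t.sub v).unlabel = t.fringe v :=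
  unlabel_eq_iff.mpr (t.sub_isomorphic v)

theorem sub_root (t : RTree V) (v : V) : (t.sub v).root = ⟨v, Below.refl t v⟩ := by
  apply Subtype.ext
  change t.ancestor v 0 = v
  simp [ancestor]

theorem sub_adj (t : RTree V) (v : V) (a b : {w // t.Below v w}) :
    (t.sub v).graph.Adj a b ↔ t.graph.Adj a.1 b.1 :=
  Iff.rfl

theorem below_par_of_ne {t : RTree V} {v w : V} (h : t.Below v w) (hne : w ≠ v) :
    t.Below v (t.par w) := by
  obtain ⟨k, hk⟩ := h
  cases k with
  | zero => exact absurd hk hne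
  | succ k => exact ⟨k, by rw [← hk, Function.iterate_succ_apply]⟩

theorem height_le_of_below {t : RTree V} {v w : V} (h : t.Below v w) :
    t.height v ≤ t.height w := by
  obtain ⟨k, rfl⟩ := h
  induction k with
  | zero => exact le_rfl
  | succ k ih =>
    rw [Function.iterate_succ_apply']
    exact (t.height_par_le _).trans ih

theorem below_root_iff {t : RTree V} {v : V} : t.Below v t.root ↔ v = t.root :=
  ⟨fun ⟨k, hk⟩ => by rw [← hk, t.iterate_root], fun h => h ▸ Below.refl t _⟩

theorem height_lt_of_below {t : RTree V} {v w : V} (h : t.Below v w) (hne : w ≠ v) :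
    t.height v < t.height w := by
  have h1 := height_le_of_below (below_par_of_ne h hne)
  have h2 : w ≠ t.root := by
    rintro rfl
    exact hne (below_root_iff.mp h).symm
  have := t.height_par h2
  omega

theorem Below.antisymm {t : RTree V} {v w : V} (h : t.Below v w) (h' : t.Below w v) : v = w := by
  by_contra hne
  have := height_lt_of_below h (Ne.symm hne)
  have := height_le_of_below h'
  omega

theorem Below.total {t : RTree V} {u v w : V} (h : t.Below u w) (h' : t.Below v w) :
    t.Below u v ∨ t.Below v u := by
  obtain ⟨k, rfl⟩ := h
  obtain ⟨l, rfl⟩ := h'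
  rcases le_total k l with hkl | hkl
  · right
    exact ⟨l - k, by rw [← Function.iterate_add_apply, Nat.sub_add_cancel hkl]⟩
  · left
    exact ⟨k - l, by rw [← Function.iterate_add_apply, Nat.sub_add_cancel hkl]⟩

open scoped Classical in
theorem par_sub (t : RTree V) (v : V) (w : {w // t.Below v w}) :
    ((t.sub v).par w : V) = if (w : V) = v then v else t.par w := by
  have h : (t.sub v).par = fun w : {w // t.Below v w} =>
      if h : (w : V) = v then ⟨v, Below.refl t v⟩ else ⟨t.par w, below_par_of_ne w.2 h⟩ := by
    refine par_eq_of _ _ (fun w => t.height w.1) ?_ ?_ ?_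
    · simp [sub_root]
    · intro w hw
      have hw' : (w : V) ≠ v := fun h => hw (by rw [sub_root]; exact Subtype.ext h)
      rw [dif_neg hw', sub_adj]
      refine t.adj_par fun h => hw' ?_
      have := w.2
      rw [h, below_root_iff] at this
      rw [h, this]
    · intro w hw
      have hw' : (w : V) ≠ v := fun h => hw (by rw [sub_root]; exact Subtype.ext h)
      simp only [dif_neg hw']
      have hr : (w : V) ≠ t.root := by
        intro h
        have := w.2
        rw [h, below_root_iff] at this
        exact hw' (by rw [h, this])
      have := t.height_par hr
      omega
  rw [h]
  dsimp only
  split_ifs <;> rfl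

theorem par_sub_of_ne (t : RTree V) (v : V) (w : {w // t.Below v w}) (hw : (w : V) ≠ v) :
    ((t.sub v).par w : V) = t.par w := by
  classical
  rw [par_sub, if_neg hw]

theorem below_sub_iff (t : RTree V) (v : V) (u w : {w // t.Below v w}) :
    (t.sub v).Below u w ↔ t.Below u.1 w.1 := by
  constructor
  · rintro ⟨k, hk⟩
    induction k generalizing w with
    | zero => rw [← hk]; exact Below.refl _ _
    | succ k ih =>
      rw [Function.iterate_succ_apply] at hk
      have h1 := ih _ hk
      by_cases hw : (w : V) = v
      · have : (t.sub v).par w = w := by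
          rw [par_eq_self_iff, sub_root]
          exact Subtype.ext hw
        rwa [this] at h1
      · rw [par_sub_of_ne _ _ _ hw] at h1
        exact h1.trans (t.below_par _)
  · rintro ⟨k, hk⟩
    induction k generalizing w with
    | zero =>
      have : w = u := Subtype.ext hk
      rw [this]; exact Below.refl _ _
    | succ k ih =>
      by_cases hw : (w : V) = v
      · have h1 : t.Below u.1 v := by
          have h3 : t.Below u.1 w.1 := ⟨k + 1, hk⟩
          rwa [hw] at h3
        have h2 : w = u := Subtype.ext (hw.trans (u.2.antisymm h1))
        rw [h2]; exact Below.refl _ _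
      · have h1 := ih ((t.sub v).par w)
          (by rw [par_sub_of_ne _ _ _ hw]; rw [Function.iterate_succ_apply] at hk; exact hk)
        exact h1.trans (below_par _ _)

theorem sub_sub_isomorphic (t : RTree V) (v : V) (u : {w // t.Below v w}) :
    ((t.sub v).sub u).Isomorphic (t.sub u.1) := by
  rw [isomorphic_iff]
  refine ⟨⟨fun w => ⟨w.1.1, (below_sub_iff _ _ _ _).mp w.2⟩,
    fun w => ⟨⟨w.1, u.2.trans w.2⟩, (below_sub_iff _ _ _ _).mpr w.2⟩,
    fun _ => rfl, fun _ => rfl⟩, ?_⟩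
  intro w
  apply Subtype.ext
  change (((t.sub v).sub u).par w).1.1 = ((t.sub u.1).par ⟨w.1.1, _⟩).1
  classical
  rw [par_sub, par_sub]
  by_cases h : w.1 = u
  · rw [if_pos h, if_pos (congrArg Subtype.val h)]
  · have h' : w.1.1 ≠ u.1 := fun e => h (Subtype.ext e)
    rw [if_neg h, if_neg h', par_sub_of_ne]
    intro hv
    have h1 := (below_sub_iff _ _ _ _).mp w.2
    rw [hv] at h1
    exact h' (hv.trans (u.2.antisymm h1))

theorem fringe_sub [Finite V] (t : RTree V) (v : V) (u : {w // t.Below v w}) :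
    (t.sub v).fringe u = t.fringe u.1 := by
  rw [← unlabel_sub, ← unlabel_sub, unlabel_eq_iff]
  exact t.sub_sub_isomorphic v u

theorem below_iff_of_par {s : RTree V} {t : RTree W} (e : V ≃ W)
    (he : ∀ v, e (s.par v) = t.par (e v)) (u v : V) : t.Below (e u) (e v) ↔ s.Below u v := by
  have : ∀ k, t.par^[k] (e v) = e (s.par^[k] v) := by
    intro k
    induction k with
    | zero => rfl
    | succ k ih => rw [Function.iterate_succ_apply', Function.iterate_succ_apply', ih, he]
  simp only [Below, this, e.injective.eq_iff]

theorem sub_isomorphic_of_par {s : RTree V} {t : RTree W} (e : V ≃ W)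
    (he : ∀ v, e (s.par v) = t.par (e v)) (v : V) : (s.sub v).Isomorphic (t.sub (e v)) := by
  classical
  rw [isomorphic_iff]
  refine ⟨e.subtypeEquiv fun w => (below_iff_of_par e he v w).symm, fun w => ?_⟩
  apply Subtype.ext
  rw [par_sub]
  simp only [Equiv.subtypeEquiv_apply, par_sub, e.injective.eq_iff]
  split_ifs with h
  · rfl
  · exact he _

theorem fringe_of_par [Finite V] [Finite W] {s : RTree V} {t : RTree W} (e : V ≃ W)
    (he : ∀ v, e (s.par v) = t.par (e v)) (v : V) : t.fringe (e v) = s.fringe v := by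
  rw [← unlabel_sub, ← unlabel_sub, unlabel_eq_iff]
  exact (sub_isomorphic_of_par e he v).symm

theorem fringe_root [Finite V] (t : RTree V) : t.fringe t.root = t.unlabel := by
  classical
  rw [← unlabel_sub, unlabel_eq_iff, isomorphic_iff]
  refine ⟨Equiv.subtypeUnivEquiv fun w => t.below_root w, fun w => ?_⟩
  rw [Equiv.subtypeUnivEquiv_apply, Equiv.subtypeUnivEquiv_apply, par_sub]
  split_ifs with h
  · rw [h, t.par_root]
  · rfl

theorem size_fringe [Finite V] (t : RTree V) (v : V) :
    (t.fringe v).size = Nat.card {w // t.Below v w} := by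
  rw [← unlabel_sub, size_unlabel]

/-! ### Children -/

theorem mem_children_iff (t : RTree V) {v w : V} :
    w ∈ t.children v ↔ w ≠ t.root ∧ t.par w = v := by
  rw [children, Set.mem_ofPred_eq, ← below_iff_mem_support, adj_iff]
  constructor
  · rintro ⟨⟨hv, rfl⟩ | h, hb⟩
    · exact absurd (hb.antisymm (t.below_par v)) (t.par_ne hv).symm
    · exact h
  · rintro ⟨hw, rfl⟩
    exact ⟨Or.inr ⟨hw, rfl⟩, t.below_par w⟩

theorem adj_root_iff (t : RTree V) {w : V} :
    t.graph.Adj t.root w ↔ w ≠ t.root ∧ t.par w = t.root := by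
  rw [adj_iff]
  simp

end RTree


open Matrix Polynomial

/-! ### Characteristic polynomials and interlacing -/

/-- A block diagonal matrix is block triangular for any linear order of the blocks; an arbitrary
order is chosen on `ι` and the determinant formula is applied to the characteristic matrix. -/
theorem charpoly_blockDiagonal' {ι : Type*} [Fintype ι] [DecidableEq ι] {m : ι → Type*}
    [∀ i, Fintype (m i)] [∀ i, DecidableEq (m i)] (M : ∀ i, Matrix (m i) (m i) ℝ) :
    (blockDiagonal' M).charpoly = ∏ i, (M i).charpoly := by
  let : LinearOrder ι := LinearOrder.lift' (Fintype.equivFin ι) (Fintype.equivFin ι).injective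
  have h : (blockDiagonal' M).charmatrix = blockDiagonal' fun i => (M i).charmatrix := by
    ext ⟨i, a⟩ ⟨j, b⟩ : 2
    by_cases hij : i = j
    · subst hij
      by_cases hab : a = b
      · subst hab; simp [charmatrix_apply_eq]
      · rw [charmatrix_apply_ne _ _ _ (by simpa using hab), blockDiagonal'_apply_eq,
          blockDiagonal'_apply_eq, charmatrix_apply_ne _ _ _ hab]
    · rw [charmatrix_apply_ne _ _ _ (by simp [hij]), blockDiagonal'_apply_ne _ _ _ hij,
        blockDiagonal'_apply_ne _ _ _ hij]
      simp
  unfold Matrix.charpoly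
  rw [h, (blockTriangular_blockDiagonal' _).det_fintype]
  refine Finset.prod_congr rfl fun i _ => ?_
  rw [← det_reindex_self (Equiv.sigmaSubtype i)]
  congr 1
  ext a b : 2
  simp [toSquareBlock_def, Equiv.sigmaSubtype]

section Hermitian

variable {m n : Type*} [Fintype m] [Fintype n] [DecidableEq m] [DecidableEq n]

/-- The spectral theorem in coordinates: the columns of `U` are an orthonormal eigenbasis and `Uᵀ *ᵥ
w` lists the coefficients of `w` in it. -/
theorem quadratic_eq_of_isHermitian {A : Matrix n n ℝ} (hA : A.IsHermitian) :
    ∃ U : Matrix n n ℝ, Uᵀ * U = 1 ∧ ∀ w : n → ℝ,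
      w ⬝ᵥ w = ∑ i, (Uᵀ *ᵥ w) i ^ 2 ∧
      w ⬝ᵥ (A *ᵥ w) = ∑ i, hA.eigenvalues i * (Uᵀ *ᵥ w) i ^ 2 := by
  let U : Matrix n n ℝ := hA.eigenvectorUnitary
  have hU : Uᵀ * U = 1 := by
    have := Unitary.coe_star_mul_self hA.eigenvectorUnitary
    rwa [star_eq_conjTranspose, conjTranspose_eq_transpose_of_trivial] at this
  have hU' : U * Uᵀ = 1 := mul_eq_one_comm.mp hU
  have hspec : A = U * diagonal hA.eigenvalues * Uᵀ := by
    conv_lhs => rw [hA.spectral_theorem, Unitary.conjStarAlgAut_apply]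
    rw [star_eq_conjTranspose, conjTranspose_eq_transpose_of_trivial]
    rfl
  refine ⟨U, hU, fun w => ⟨?_, ?_⟩⟩
  · have h : w ⬝ᵥ w = (Uᵀ *ᵥ w) ⬝ᵥ (Uᵀ *ᵥ w) := by
      rw [dotProduct_mulVec, vecMul_transpose, mulVec_mulVec, hU', one_mulVec]
    rw [h, dotProduct]
    simp only [sq]
  · have h : w ⬝ᵥ (A *ᵥ w) = (Uᵀ *ᵥ w) ⬝ᵥ (diagonal hA.eigenvalues *ᵥ (Uᵀ *ᵥ w)) := by
      conv_lhs => rw [hspec, ← mulVec_mulVec, ← mulVec_mulVec, dotProduct_mulVec,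
        ← mulVec_transpose]
    rw [h, dotProduct]
    refine Finset.sum_congr rfl fun i _ => ?_
    rw [mulVec_diagonal]
    ring

/-- If `B` is a compression of `A`, then the number of eigenvalues of `B` in a set that is
separated (in the sense of `σ = ± 1`) from the eigenvalues of `A` with indices outside `I` is at
most the cardinality of `I`. -/
theorem card_le_card_of_compression {A : Matrix n n ℝ} (hA : A.IsHermitian)
    {B : Matrix m m ℝ} (hB : B.IsHermitian) (E : (m → ℝ) →ₗ[ℝ] (n → ℝ))
    (h1 : ∀ w, E w ⬝ᵥ E w = w ⬝ᵥ w) (h2 : ∀ w, E w ⬝ᵥ (A *ᵥ E w) = w ⬝ᵥ (B *ᵥ w))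
    (J : Finset m) (I : Finset n) (σ : ℝ)
    (hσ : ∀ j ∈ J, ∀ i ∉ I, 0 < σ * (hA.eigenvalues i - hB.eigenvalues j)) :
    J.card ≤ I.card := by
  by_contra! hlt
  obtain ⟨U, -, hUA⟩ := quadratic_eq_of_isHermitian hA
  obtain ⟨V, hV, hVB⟩ := quadratic_eq_of_isHermitian hB
  let Z : (J → ℝ) →ₗ[ℝ] (m → ℝ) := Function.ExtendByZero.linearMap ℝ (Subtype.val : J → m)
  have hZ : ∀ c (j : J), Z c j = c j := fun c j =>
    Subtype.val_injective.extend_apply c 0 j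
  have hZ' : ∀ c, ∀ j ∉ J, Z c j = 0 := fun c j hj =>
    Function.extend_apply' _ _ _ (by rintro ⟨a, rfl⟩; exact hj a.2)
  let T : (J → ℝ) →ₗ[ℝ] (I → ℝ) :=
    (LinearMap.funLeft ℝ ℝ (Subtype.val : I → n)) ∘ₗ (Uᵀ).mulVecLin ∘ₗ E ∘ₗ V.mulVecLin ∘ₗ Z
  -- By dimension, some nonzero combination of the eigenvectors of `B` indexed by `J` has image
  -- under `E` orthogonal to all eigenvectors of `A` indexed by `I`.
  obtain ⟨c, hc, hc0⟩ : ∃ c, T c = 0 ∧ c ≠ 0 := by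
    have : ¬ Function.Injective T := fun h => by
      have := LinearMap.finrank_le_finrank_of_injective h
      simp at this
      omega
    rw [← LinearMap.ker_eq_bot, Submodule.eq_bot_iff] at this
    push Not at this
    obtain ⟨c, h, h'⟩ := this
    exact ⟨c, h, h'⟩
  let w := V *ᵥ Z c
  let d := Uᵀ *ᵥ E w
  have hVw : Vᵀ *ᵥ w = Z c := by simp only [w, mulVec_mulVec, hV, one_mulVec]
  have e1 : ∑ i, d i ^ 2 = ∑ j, Z c j ^ 2 := by
    rw [← (hUA (E w)).1, h1, (hVB w).1, hVw]
  have e2 : ∑ i, hA.eigenvalues i * d i ^ 2 = ∑ j, hB.eigenvalues j * Z c j ^ 2 := by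
    rw [← (hUA (E w)).2, h2, (hVB w).2, hVw]
  have hd : ∀ i ∈ I, d i = 0 := fun i hi => congrFun hc ⟨i, hi⟩
  obtain ⟨j₀, hj₀⟩ : ∃ j, c j ≠ 0 := by
    by_contra! h
    exact hc0 (funext h)
  have hpos : 0 < ∑ j, Z c j ^ 2 :=
    Finset.sum_pos' (fun _ _ => sq_nonneg _) ⟨j₀, Finset.mem_univ _, by rw [hZ]; positivity⟩
  obtain ⟨i₀, -, hi₀⟩ : ∃ i ∈ Finset.univ, 0 < d i ^ 2 := by
    by_contra! h
    rw [← e1] at hpos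
    exact absurd (Finset.sum_nonpos h) (not_le.mpr hpos)
  -- The two quadratic forms and the two norms agree on this vector, so the cross-multiplied
  -- difference of Rayleigh quotients vanishes. By the separation hypothesis all its terms are
  -- nonnegative and one is positive.
  have hz : ∑ j, ∑ i, σ * (hA.eigenvalues i - hB.eigenvalues j) * (Z c j ^ 2 * d i ^ 2) = 0 := by
    have : ∀ j, ∑ i, σ * (hA.eigenvalues i - hB.eigenvalues j) * (Z c j ^ 2 * d i ^ 2) =
        σ * (Z c j ^ 2 * ∑ i, hA.eigenvalues i * d i ^ 2 -
          hB.eigenvalues j * Z c j ^ 2 * ∑ i, d i ^ 2) := by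
      intro j
      rw [Finset.mul_sum, Finset.mul_sum, ← Finset.sum_sub_distrib, Finset.mul_sum]
      exact Finset.sum_congr rfl fun i _ => by ring
    simp only [this]
    rw [← Finset.mul_sum, Finset.sum_sub_distrib, ← Finset.sum_mul, ← Finset.sum_mul, e1, e2]
    ring
  have hterm : ∀ j i, 0 ≤ σ * (hA.eigenvalues i - hB.eigenvalues j) * (Z c j ^ 2 * d i ^ 2) := by
    intro j i
    by_cases hj : j ∈ J
    · by_cases hi : i ∈ I
      · rw [hd i hi]; simp
      · exact mul_nonneg (hσ j hj i hi).le (by positivity)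
    · rw [hZ' c j hj]; simp
  refine hz.not_gt (Finset.sum_pos' (fun j _ => Finset.sum_nonneg fun i _ => hterm j i)
    ⟨j₀, Finset.mem_univ _, Finset.sum_pos' (fun i _ => hterm j₀ i)
      ⟨i₀, Finset.mem_univ _, ?_⟩⟩)
  refine mul_pos (hσ _ j₀.2 _ fun hi => ?_) (mul_pos (by rw [hZ]; positivity) hi₀)
  rw [hd _ hi] at hi₀
  simp at hi₀

theorem countP_roots_charpoly {A : Matrix n n ℝ} (hA : A.IsHermitian) (p : ℝ → Prop)
    [DecidablePred p] :
    A.charpoly.roots.countP p = (Finset.univ.filter fun i => p (hA.eigenvalues i)).card := by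
  rw [hA.roots_charpoly_eq_eigenvalues, Multiset.countP_map]
  rfl

theorem card_roots_charpoly {A : Matrix n n ℝ} (hA : A.IsHermitian) :
    Multiset.card A.charpoly.roots = Fintype.card n := by
  rw [hA.roots_charpoly_eq_eigenvalues, Multiset.card_map]
  rfl

/-- Symmetric operators are semisimple, so their generalized eigenspaces are eigenspaces. Euclidean
space enters only to supply the inner product. -/
theorem count_roots_charpoly {A : Matrix n n ℝ} (hA : A.IsHermitian) (γ : ℝ) :
    A.charpoly.roots.count γ = Module.finrank ℝ (Module.End.eigenspace (toLin' A) γ) := by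
  let e := WithLp.linearEquiv 2 ℝ (n → ℝ)
  have hs : (toEuclideanLin A).charpoly = A.charpoly := by
    rw [← LinearMap.charpoly_toMatrix (toEuclideanLin A) (EuclideanSpace.basisFun n ℝ).toBasis]
    congr 1
    exact LinearMap.toMatrix_toLin _ _ A
  have hsymm : (toEuclideanLin A).IsSymmetric := isSymmetric_toEuclideanLin_iff.mpr hA
  rw [Polynomial.count_roots, ← hs, ← LinearMap.finrank_maxGenEigenspace_eq,
    hsymm.isFinitelySemisimple.maxGenEigenspace_eq_eigenspace]
  refine (LinearEquiv.ofSubmodules e _ _ ?_).finrank_eq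
  ext v
  rw [Submodule.mem_map_equiv, Module.End.mem_eigenspace_iff, Module.End.mem_eigenspace_iff,
    ← e.injective.eq_iff]
  rfl

/-- One-vertex interlacing: the numbers of eigenvalues in a lower set differ by at most one. -/
theorem countP_submatrix_ne {A : Matrix n n ℝ} (hA : A.IsHermitian) (r : n) (p : ℝ → Prop)
    [DecidablePred p] (hp : ∀ a b, b ≤ a → p a → p b) :
    (A.submatrix (Subtype.val : {v // v ≠ r} → n) Subtype.val).charpoly.roots.countP p ≤
        A.charpoly.roots.countP p ∧
      A.charpoly.roots.countP p ≤
        (A.submatrix (Subtype.val : {v // v ≠ r} → n) Subtype.val).charpoly.roots.countP p + 1 := by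
  set B := A.submatrix (Subtype.val : {v // v ≠ r} → n) Subtype.val with hBdef
  have hB : B.IsHermitian := hA.submatrix _
  let E : ({v // v ≠ r} → ℝ) →ₗ[ℝ] (n → ℝ) :=
    Function.ExtendByZero.linearMap ℝ (Subtype.val : {v // v ≠ r} → n)
  have hE : ∀ w (v : {v // v ≠ r}), E w v = w v := fun w v =>
    Subtype.val_injective.extend_apply w 0 v
  have hE' : ∀ w, E w r = 0 := fun w =>
    Function.extend_apply' _ _ _ (by rintro ⟨a, ha⟩; exact a.2 ha)
  have hsum : ∀ f : n → ℝ, f r = 0 → ∑ v, f v = ∑ v : {v // v ≠ r}, f v := by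
    intro f hf
    rw [← Finset.sum_erase Finset.univ hf]
    exact Finset.sum_subtype _ (by simp) f
  have h1 : ∀ w, E w ⬝ᵥ E w = w ⬝ᵥ w := by
    intro w
    rw [dotProduct, hsum _ (by rw [hE', zero_mul]), dotProduct]
    simp only [hE]
  have h2 : ∀ w, E w ⬝ᵥ (A *ᵥ E w) = w ⬝ᵥ (B *ᵥ w) := by
    intro w
    rw [dotProduct, hsum _ (by rw [hE', zero_mul]), dotProduct]
    refine Finset.sum_congr rfl fun v _ => ?_
    rw [hE, mulVec, dotProduct, hsum _ (by rw [hE', mul_zero]), mulVec, dotProduct]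
    simp only [hE]
    rfl
  constructor
  · rw [countP_roots_charpoly hA, countP_roots_charpoly hB]
    refine card_le_card_of_compression hA hB E h1 h2 _ _ 1 fun j hj i hi => ?_
    simp only [Finset.mem_filter, Finset.mem_univ, true_and] at hj hi
    have := not_le.mp fun h => hi (hp _ _ h hj)
    linarith
  · have h3 : (Finset.univ.filter fun j => ¬ p (hB.eigenvalues j)).card ≤
        (Finset.univ.filter fun i => ¬ p (hA.eigenvalues i)).card := by
      refine card_le_card_of_compression hA hB E h1 h2 _ _ (-1) fun j hj i hi => ?_
      simp only [Finset.mem_filter, Finset.mem_univ, true_and, not_not] at hj hi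
      have := not_le.mp fun h => hj (hp _ _ h hi)
      linarith
    have h4 := Finset.card_filter_add_card_filter_not (s := (Finset.univ : Finset n))
      (fun i => p (hA.eigenvalues i))
    have h5 := Finset.card_filter_add_card_filter_not (s := (Finset.univ : Finset {v // v ≠ r}))
      (fun i => p (hB.eigenvalues i))
    have h6 : Fintype.card {v // v ≠ r} + 1 = Fintype.card n := by
      rw [Fintype.card_subtype_compl, Fintype.card_subtype_eq]
      have : 0 < Fintype.card n := Fintype.card_pos_iff.mpr ⟨r⟩
      omega
    rw [Finset.card_univ] at h4 h5
    rw [countP_roots_charpoly hA, countP_roots_charpoly hB]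
    omega

end Hermitian


open Matrix

/-! ### Additive functionals of fringe subtrees -/

namespace RTree

variable {V W : Type*}

open scoped Classical in
/-- The finite set of children of a vertex. -/
def childFinset [Fintype V] (t : RTree V) (v : V) : Finset V :=
  Finset.univ.filter fun c => c ≠ t.root ∧ t.par c = v

theorem mem_childFinset [Fintype V] (t : RTree V) {v c : V} :
    c ∈ t.childFinset v ↔ c ≠ t.root ∧ t.par c = v := by
  simp [childFinset]

theorem root_of_par {s : RTree V} {t : RTree W} (e : V ≃ W)
    (he : ∀ v, e (s.par v) = t.par (e v)) : e s.root = t.root := by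
  rw [← t.par_eq_self_iff, ← he, s.par_root]

theorem childFinset_of_par [Fintype V] [Fintype W] {s : RTree V} {t : RTree W} (e : V ≃ W)
    (he : ∀ v, e (s.par v) = t.par (e v)) (v : V) :
    t.childFinset (e v) = (s.childFinset v).map e.toEmbedding := by
  ext w
  obtain ⟨w, rfl⟩ := e.surjective w
  rw [Finset.mem_map_equiv, e.symm_apply_apply, mem_childFinset, mem_childFinset, ← he,
    e.injective.eq_iff, ← root_of_par e he, e.injective.ne_iff]

theorem deleteRoot_unlabel [Fintype V] (t : RTree V) :
    t.unlabel.deleteRoot = (t.childFinset t.root).val.map t.fringe := by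
  obtain ⟨e, he⟩ := isomorphic_iff.mp t.rep_unlabel_isomorphic
  rw [← root_of_par e he, childFinset_of_par e he, Finset.map_val, Multiset.map_map]
  have h : t.unlabel.deleteRoot =
      (t.unlabel.rep.childFinset t.unlabel.rep.root).val.map t.unlabel.rep.fringe := by
    unfold UTree.deleteRoot childFinset
    congr 2
    ext c
    simp only [Finset.mem_filter, adj_root_iff]
  rw [h]
  exact Multiset.map_congr rfl fun c _ => (fringe_of_par e he c).symm

theorem childFinset_sub [Fintype V] (t : RTree V) (v : V) [Fintype {w // t.Below v w}]
    (u : {w // t.Below v w}) :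
    ((t.sub v).childFinset u).map (Function.Embedding.subtype _) = t.childFinset u.1 := by
  ext c
  simp only [Finset.mem_map, mem_childFinset, Function.Embedding.subtype_apply, sub_root]
  constructor
  · rintro ⟨w, ⟨h1, h2⟩, rfl⟩
    have h3 : (w : V) ≠ v := fun h => h1 (Subtype.ext h)
    have h4 := congrArg Subtype.val h2
    rw [par_sub_of_ne _ _ _ h3] at h4
    refine ⟨fun h => ?_, h4⟩
    have := w.2
    rw [h, below_root_iff] at this
    exact h3 (h.trans this.symm)
  · rintro ⟨h1, h2⟩
    have h3 : t.Below v c := u.2.trans (h2 ▸ t.below_par c)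
    have h4 : c ≠ v := by
      rintro rfl
      have h5 := u.2
      rw [← h2] at h5
      exact t.par_ne h1 (h5.antisymm (t.below_par c)).symm
    refine ⟨⟨c, h3⟩, ⟨fun h => h4 (congrArg Subtype.val h), Subtype.ext ?_⟩, rfl⟩
    rw [par_sub_of_ne _ _ _ h4, h2]

theorem deleteRoot_fringe [Fintype V] (t : RTree V) (v : V) :
    (t.fringe v).deleteRoot = (t.childFinset v).val.map t.fringe := by
  have : Fintype {w // t.Below v w} := Fintype.ofFinite _
  rw [← unlabel_sub, deleteRoot_unlabel, sub_root,
    ← childFinset_sub t v ⟨v, Below.refl t v⟩, Finset.map_val, Multiset.map_map]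
  exact Multiset.map_congr rfl fun c _ => t.fringe_sub v c

end RTree

namespace UTree

/-- The increment of a functional of trees when the root is deleted. -/
def increment (g : UTree → ℝ) (T : UTree) : ℝ := g T - (T.deleteRoot.map g).sum

end UTree

/-- Telescoping: every vertex other than the root contributes `g` of its fringe subtree once
positively, and once negatively at its parent. Only the root term survives. -/
theorem RTree.sum_increment_fringe {V : Type*} [Fintype V] (t : RTree V) (g : UTree → ℝ) :
    ∑ v, UTree.increment g (t.fringe v) = g t.unlabel := by
  classical
  have h : ∀ v, ((t.fringe v).deleteRoot.map g).sum = ∑ c ∈ t.childFinset v, g (t.fringe c) := by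
    intro v
    rw [deleteRoot_fringe, Multiset.map_map]
    rfl
  simp only [UTree.increment, h, Finset.sum_sub_distrib]
  have h2 : ∑ v, ∑ c ∈ t.childFinset v, g (t.fringe c) =
      ∑ c ∈ Finset.univ.erase t.root, g (t.fringe c) := by
    rw [← Finset.sum_fiberwise (Finset.univ.erase t.root) t.par]
    refine Finset.sum_congr rfl fun v _ => Finset.sum_congr ?_ fun _ _ => rfl
    ext c
    simp [mem_childFinset]
  rw [h2, ← Finset.add_sum_erase Finset.univ _ (Finset.mem_univ t.root), fringe_root]
  ring

/-! ### Spectra of trees -/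

/-- The eigenvalues of the adjacency matrix, with multiplicities. -/
def UTree.spec (T : UTree) : Multiset ℝ := T.rep.adjMatrix.charpoly.roots

namespace RTree

theorem adjMatrix_apply {V : Type*} (t : RTree V) (v w : V) :
    t.adjMatrix v w = open scoped Classical in if t.graph.Adj v w then 1 else 0 := by
  simp [adjMatrix]

theorem adjMatrix_sub {V : Type*} (t : RTree V) (v : V) (a b : {w // t.Below v w}) :
    (t.sub v).adjMatrix a b = t.adjMatrix a.1 b.1 := by
  rw [adjMatrix_apply, adjMatrix_apply]
  classical exact if_congr (t.sub_adj v a b) rfl rfl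

variable {V : Type*} [Fintype V] [DecidableEq V]

theorem spec_unlabel (t : RTree V) : t.unlabel.spec = t.adjMatrix.charpoly.roots := by
  obtain ⟨e, he⟩ := t.rep_unlabel_isomorphic
  rw [UTree.spec, ← charpoly_reindex e.toEquiv]
  congr 2
  ext v w
  rw [reindex_apply, submatrix_apply, adjMatrix_apply, adjMatrix_apply, ← e.map_adj_iff]
  congr 2 <;> exact e.apply_symm_apply _

theorem exists_child_below (t : RTree V) {v : V} (hv : v ≠ t.root) :
    ∃ c ∈ t.childFinset t.root, t.Below c v := by
  have key : ∀ n v, t.height v = n → v ≠ t.root → ∃ c ∈ t.childFinset t.root, t.Below c v := by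
    intro n
    induction n with
    | zero => intro v h hv; have := t.height_par hv; omega
    | succ n ih =>
      intro v h hv
      by_cases hp : t.par v = t.root
      · exact ⟨v, t.mem_childFinset.mpr ⟨hv, hp⟩, Below.refl t v⟩
      · obtain ⟨c, hc, hb⟩ := ih (t.par v) (by have := t.height_par hv; omega) hp
        exact ⟨c, hc, hb.trans (t.below_par v)⟩
  exact key _ v rfl hv

theorem child_unique (t : RTree V) {u c c' v : V} (hc : c ∈ t.childFinset u)
    (hc' : c' ∈ t.childFinset u) (h : t.Below c v) (h' : t.Below c' v) : c = c' := by
  rw [mem_childFinset] at hc hc'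
  have key : ∀ a b, a ≠ t.root → t.par a = u → b ≠ t.root → t.par b = u → t.Below a b → a = b := by
    intro a b ha ha' hb hb' hab
    by_contra hne
    have h1 := below_par_of_ne hab (Ne.symm hne)
    have h2 := height_le_of_below h1
    have h3 := t.height_par ha
    rw [hb'] at h2
    rw [ha'] at h3
    omega
  rcases h.total h' with hb | hb
  · exact key _ _ hc.1 hc.2 hc'.1 hc'.2 hb
  · exact (key _ _ hc'.1 hc'.2 hc.1 hc.2 hb).symm

/-- The adjacency matrix of the forest obtained by deleting the root. -/
def deletedMatrix (t : RTree V) : Matrix {v // v ≠ t.root} {v // v ≠ t.root} ℝ :=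
  t.adjMatrix.submatrix Subtype.val Subtype.val

/-- Every vertex other than the root lies below exactly one child of the root, and no edge joins
vertices below different children; relabeling makes the matrix block diagonal. -/
theorem roots_charpoly_deletedMatrix (t : RTree V) :
    t.deletedMatrix.charpoly.roots = (t.unlabel.deleteRoot.map UTree.spec).sum := by
  classical
  have : ∀ c, Fintype {w // t.Below c w} := fun c => Fintype.ofFinite _
  let f : (Σ c : t.childFinset t.root, {w // t.Below c.1 w}) → {v // v ≠ t.root} :=
    fun x => ⟨x.2.1, by
      obtain ⟨⟨c, hc⟩, w, hw⟩ := x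
      rintro rfl
      rw [mem_childFinset] at hc
      exact hc.1 (below_root_iff.mp hw)⟩
  have hf : Function.Bijective f := by
    constructor
    · rintro ⟨⟨c, hc⟩, w, hw⟩ ⟨⟨c', hc'⟩, w', hw'⟩ h
      obtain rfl : w = w' := congrArg Subtype.val h
      obtain rfl := t.child_unique hc hc' hw hw'
      rfl
    · rintro ⟨v, hv⟩
      obtain ⟨c, hc, hb⟩ := t.exists_child_below hv
      exact ⟨⟨⟨c, hc⟩, v, hb⟩, rfl⟩
  let e := Equiv.ofBijective f hf
  have hM : t.deletedMatrix.submatrix e e =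
      blockDiagonal' fun c : t.childFinset t.root => (t.sub c.1).adjMatrix := by
    ext ⟨⟨c, hc⟩, w, hw⟩ ⟨⟨c', hc'⟩, w', hw'⟩
    change t.adjMatrix w w' = _
    by_cases h : c = c'
    · subst h
      rw [blockDiagonal'_apply_eq, adjMatrix_sub]
    · rw [blockDiagonal'_apply_ne _ _ _ (by simpa using h), adjMatrix_apply, if_neg]
      rw [adj_iff]
      rintro (⟨h1, rfl⟩ | ⟨h1, rfl⟩)
      · exact h (t.child_unique hc hc' hw (hw'.trans (t.below_par w)))
      · exact h (t.child_unique hc hc' (hw.trans (t.below_par w')) hw')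
  have hch : t.deletedMatrix.charpoly = ∏ c : t.childFinset t.root, (t.sub c.1).adjMatrix.charpoly := by
    rw [← charpoly_blockDiagonal', ← hM, ← charpoly_reindex e.symm]
    rfl
  rw [hch, Polynomial.roots_prod _ _ (Finset.prod_ne_zero_iff.mpr fun c _ =>
    (charpoly_monic _).ne_zero), deleteRoot_unlabel, Multiset.map_map]
  have hs : ∀ c, (t.sub c).adjMatrix.charpoly.roots = (t.fringe c).spec := by
    intro c
    rw [← unlabel_sub, spec_unlabel]
  simp only [hs]
  exact Finset.sum_coe_sort (t.childFinset t.root) fun c => (t.fringe c).spec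

end RTree

namespace UTree

/-- The number of eigenvalues in a set. -/
def specCount (B : Set ℝ) (T : UTree) : ℝ :=
  open scoped Classical in (T.spec.countP (· ∈ B) : ℝ)

open scoped Classical in
theorem sum_map_specCount (B : Set ℝ) (u : Multiset UTree) :
    (u.map (specCount B)).sum = (((u.map spec).sum.countP (· ∈ B) : ℕ) : ℝ) := by
  induction u using Multiset.induction_on with
  | empty => simp
  | cons a u ih => simp [ih, specCount, Multiset.countP_add]

theorem increment_specCount {B : Set ℝ} {T : UTree} :
    increment (specCount B) T = specCount B T -
      (open scoped Classical in (T.rep.deletedMatrix.charpoly.roots.countP (· ∈ B) : ℝ)) := by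
  classical
  rw [increment, sum_map_specCount, RTree.roots_charpoly_deletedMatrix, RTree.unlabel_rep]

/-- Interlacing. The bound is uniform in `T` although the counts are not, which makes the increment
a bounded test function. -/
theorem increment_specCount_of_lower {B : Set ℝ} (hB : ∀ a b, b ≤ a → a ∈ B → b ∈ B) (T : UTree) :
    0 ≤ increment (specCount B) T ∧ increment (specCount B) T ≤ 1 := by
  classical
  obtain ⟨h1, h2⟩ := countP_submatrix_ne T.rep.adjMatrix_isHermitian T.rep.root (· ∈ B) hB
  rw [increment_specCount, specCount, spec]
  constructor
  · have : ((T.rep.deletedMatrix.charpoly.roots.countP (· ∈ B) : ℕ) : ℝ) ≤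
      (T.rep.adjMatrix.charpoly.roots.countP (· ∈ B) : ℕ) := by exact_mod_cast h1
    linarith
  · have : ((T.rep.adjMatrix.charpoly.roots.countP (· ∈ B) : ℕ) : ℝ) ≤
      (T.rep.deletedMatrix.charpoly.roots.countP (· ∈ B) : ℕ) + 1 := by exact_mod_cast h2
    linarith

theorem card_spec (T : UTree) : Multiset.card T.spec = T.size := by
  rw [spec, card_roots_charpoly T.rep.adjMatrix_isHermitian, Fintype.card_fin]

theorem specCount_univ (T : UTree) : specCount Set.univ T = T.size := by
  simp [specCount, card_spec]

theorem size_pos (T : UTree) : 0 < T.size := Fin.pos_iff_nonempty.mpr inferInstance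

end UTree

theorem empirical_real {V E : Type*} [Fintype V] [Nonempty V] [MeasurableSpace E] (f : V → E)
    {B : Set E} (hB : MeasurableSet B) :
    (empirical f : Measure E).real B =
      (open scoped Classical in ((Finset.univ.filter fun v => f v ∈ B).card : ℝ)) /
        Fintype.card V := by
  classical
  rw [Measure.real]
  change (((Fintype.card V : ℝ≥0∞)⁻¹ • ∑ v, Measure.dirac (f v) : Measure E) B).toReal = _
  rw [Measure.smul_apply, Measure.finsetSum_apply, smul_eq_mul, ENNReal.toReal_mul,
    ENNReal.toReal_inv, ENNReal.toReal_natCast, div_eq_inv_mul]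
  congr 1
  simp only [Measure.dirac_apply' _ hB, Set.indicator_apply, Pi.one_apply]
  rw [Finset.sum_boole, ENNReal.toReal_natCast]

theorem RTree.spectralDist_real {n : ℕ} [Nonempty (Fin n)] (t : RTree (Fin n)) {B : Set ℝ}
    (hB : MeasurableSet B) :
    (t.spectralDist : Measure ℝ).real B = UTree.specCount B t.unlabel / n := by
  classical
  rw [RTree.spectralDist, empirical_real _ hB, UTree.specCount, spec_unlabel,
    countP_roots_charpoly t.adjMatrix_isHermitian, Fintype.card_fin]

theorem UTree.spectralDist_real (T : UTree) {B : Set ℝ} (hB : MeasurableSet B) :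
    (T.spectralDist : Measure ℝ).real B = specCount B T / T.size := by
  rw [UTree.spectralDist, RTree.spectralDist_real _ hB, RTree.unlabel_rep]

theorem RTree.spectralDist_unlabel {n : ℕ} [Nonempty (Fin n)] (t : RTree (Fin n)) :
    t.unlabel.spectralDist = t.spectralDist := by
  suffices h : (t.unlabel.spectralDist : Measure ℝ) = (t.spectralDist : Measure ℝ) from
    Subtype.ext h
  refine Measure.ext fun B hB => ?_
  rw [← measureReal_eq_measureReal_iff (measure_ne_top _ _) (measure_ne_top _ _)]
  refine (UTree.spectralDist_real _ hB).trans ?_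
  rw [RTree.size_unlabel, Nat.card_eq_fintype_card, Fintype.card_fin]
  exact (RTree.spectralDist_real t hB).symm

/-- The average of `g` over the fringe subtrees of `T`. -/
def UTree.fringeAvg (g : UTree → ℝ) (T : UTree) : ℝ := (∑ v, g (T.rep.fringe v)) / T.size

theorem RTree.fringeAvg_unlabel {V : Type*} [Fintype V] (t : RTree V) (g : UTree → ℝ) :
    t.unlabel.fringeAvg g = (∑ v, g (t.fringe v)) / Fintype.card V := by
  obtain ⟨e, he⟩ := isomorphic_iff.mp t.rep_unlabel_isomorphic
  have hsz : t.unlabel.size = Fintype.card V := by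
    rw [size_unlabel, Nat.card_eq_fintype_card]
  have hsz' : (t.unlabel.size : ℝ) = Fintype.card V := by rw [hsz]
  rw [UTree.fringeAvg]
  refine congrArg₂ _ ?_ hsz'
  exact Fintype.sum_equiv e _ _ fun v => by rw [fringe_of_par e he]

/-- The bridge from spectra to fringe statistics: the telescoping sum divided by the number of
vertices. -/
theorem UTree.spectralDist_real_eq_fringeAvg (T : UTree) {B : Set ℝ} (hB : MeasurableSet B) :
    (T.spectralDist : Measure ℝ).real B = T.fringeAvg (increment (specCount B)) := by
  rw [spectralDist_real T hB, fringeAvg, RTree.sum_increment_fringe, RTree.unlabel_rep]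


open Matrix

/-! ### Eigenvectors that vanish at the root -/

namespace RTree

variable {V W : Type*}

/-- The eigenvectors, for the eigenvalue `γ`, that vanish at the root. -/
def rootedEigenspace [Fintype V] (t : RTree V) (γ : ℝ) : Submodule ℝ (V → ℝ) where
  carrier := {φ | t.adjMatrix *ᵥ φ = γ • φ ∧ φ t.root = 0}
  add_mem' := by
    rintro φ ψ ⟨h1, h2⟩ ⟨h3, h4⟩
    exact ⟨by rw [mulVec_add, h1, h3, smul_add], by simp [h2, h4]⟩
  zero_mem' := by simp
  smul_mem' := by
    rintro c φ ⟨h1, h2⟩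
    exact ⟨by rw [mulVec_smul, h1, smul_comm], by simp [h2]⟩

theorem mem_rootedEigenspace [Fintype V] (t : RTree V) {γ : ℝ} {φ : V → ℝ} :
    φ ∈ t.rootedEigenspace γ ↔ t.adjMatrix *ᵥ φ = γ • φ ∧ φ t.root = 0 := Iff.rfl

theorem rootedEigenspace_equiv [Fintype V] [Fintype W] {s : RTree V} {t : RTree W}
    (h : s.Isomorphic t) (γ : ℝ) :
    Module.finrank ℝ (s.rootedEigenspace γ) = Module.finrank ℝ (t.rootedEigenspace γ) := by
  obtain ⟨e, he⟩ := h
  let E : (W → ℝ) ≃ₗ[ℝ] (V → ℝ) := LinearEquiv.funCongrLeft ℝ ℝ e.toEquiv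
  refine (LinearEquiv.finrank_eq (LinearEquiv.ofSubmodules E.symm _ _ ?_))
  ext φ
  rw [Submodule.mem_map_equiv, LinearEquiv.symm_symm, mem_rootedEigenspace, mem_rootedEigenspace]
  have hE : ∀ v, E φ v = φ (e v) := fun v => rfl
  refine and_congr ?_ (by rw [hE, he])
  have hA : ∀ v, (s.adjMatrix *ᵥ E φ) v = (t.adjMatrix *ᵥ φ) (e v) := by
    intro v
    simp only [mulVec, dotProduct]
    refine Fintype.sum_equiv e.toEquiv _ _ fun w => ?_
    rw [hE, adjMatrix_apply, adjMatrix_apply]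
    congr 1
    classical exact if_congr e.map_adj_iff.symm rfl rfl
  constructor
  · intro h
    ext w
    obtain ⟨v, rfl⟩ := e.surjective w
    rw [← hA, h]
    rfl
  · intro h
    ext v
    rw [hA, h]
    rfl

/-- Extension by zero from the vertices below `v`. -/
def extend (t : RTree V) (v : V) : ({w // t.Below v w} → ℝ) →ₗ[ℝ] (V → ℝ) :=
  Function.ExtendByZero.linearMap ℝ Subtype.val

theorem extend_apply (t : RTree V) (v : V) (φ : {w // t.Below v w} → ℝ) (w : V)
    (hw : t.Below v w) : t.extend v φ w = φ ⟨w, hw⟩ :=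
  Subtype.val_injective.extend_apply φ 0 ⟨w, hw⟩

theorem extend_apply_of_not (t : RTree V) (v : V) (φ : {w // t.Below v w} → ℝ) (w : V)
    (hw : ¬ t.Below v w) : t.extend v φ w = 0 :=
  Function.extend_apply' _ _ _ (by rintro ⟨a, rfl⟩; exact hw a.2)

theorem sum_eq_sum_subtype [Fintype V] (p : V → Prop) [Fintype {v // p v}] (f : V → ℝ)
    (hf : ∀ v, ¬ p v → f v = 0) : ∑ v, f v = ∑ v : {v // p v}, f v := by
  classical
  rw [← Finset.sum_filter_of_ne (p := p) (fun v _ h => by_contra fun hp => h (hf v hp))]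
  exact Finset.sum_subtype _ (by simp) f

/-- Outside the subtree, only the parent of `v` is adjacent to it, and only through `v`, where the
vector vanishes; so extension by zero keeps the eigenvalue equation. -/
theorem extend_mem [Fintype V] (t : RTree V) (v : V) [Fintype {w // t.Below v w}] {γ : ℝ}
    {φ : {w // t.Below v w} → ℝ} (hφ : φ ∈ (t.sub v).rootedEigenspace γ) :
    t.adjMatrix *ᵥ t.extend v φ = γ • t.extend v φ := by
  classical
  obtain ⟨h1, h2⟩ := hφ
  ext w
  rw [mulVec, dotProduct, sum_eq_sum_subtype (t.Below v) _ (fun u hu => by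
    rw [extend_apply_of_not _ _ _ _ hu, mul_zero])]
  by_cases hw : t.Below v w
  · have h3 := congrFun h1 ⟨w, hw⟩
    rw [Pi.smul_apply, extend_apply _ _ _ _ hw]
    rw [mulVec, dotProduct] at h3
    rw [← Pi.smul_apply, ← h3]
    exact Finset.sum_congr rfl fun u _ => by rw [adjMatrix_sub, extend_apply _ _ _ _ u.2]
  · rw [Pi.smul_apply, extend_apply_of_not _ _ _ _ hw, smul_zero]
    refine Finset.sum_eq_zero fun u _ => ?_
    rw [extend_apply _ _ _ _ u.2, adjMatrix_apply]
    split_ifs with hadj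
    · have hu : (u : V) = v := by
        by_contra hne
        rw [adj_iff] at hadj
        rcases hadj with ⟨h3, h4⟩ | ⟨h3, h4⟩
        · exact hw (u.2.trans (h4 ▸ t.below_par w))
        · exact hw (h4 ▸ below_par_of_ne u.2 hne)
      have : u = (t.sub v).root := by rw [sub_root]; exact Subtype.ext hu
      rw [this, h2, mul_zero]
    · rw [zero_mul]

/-- The ancestors of `w` form a chain whose fringe subtrees are nested, and nested finite sets of
equal size coincide. Hence distinct fringe subtrees of the same size are disjoint. -/
theorem eq_of_below_of_card [Finite V] {t : RTree V} {u v w : V} (hu : t.Below u w)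
    (hv : t.Below v w) (h : (t.fringe u).size = (t.fringe v).size) : u = v := by
  rw [size_fringe, size_fringe] at h
  have key : ∀ a b, t.Below a b → Nat.card {w // t.Below a w} = Nat.card {w // t.Below b w} →
      a = b := by
    intro a b hab hc
    have hsub : {w | t.Below b w} ⊆ {w | t.Below a w} := fun w hw => hab.trans hw
    have := Set.eq_of_subset_of_ncard_le hsub hc.le
    have h3 : a ∈ {w | t.Below b w} := this ▸ Below.refl t a
    exact hab.antisymm h3
  rcases hu.total hv with h' | h'
  · exact key _ _ h' h
  · exact (key _ _ h' h.symm).symm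

-- Fringe subtrees of the common size `m` are disjoint, so eigenvectors extended by zero from
-- different ones have disjoint supports and together span a direct sum inside the eigenspace of
-- `t`.
open scoped Classical in
theorem card_mul_finrank_le [Fintype V] [DecidableEq V] (t : RTree V) {A : Set UTree} {m k : ℕ}
    {γ : ℝ} (hm : ∀ s ∈ A, s.size = m)
    (hk : ∀ s ∈ A, k ≤ Module.finrank ℝ (s.rep.rootedEigenspace γ)) :
    (Finset.univ.filter fun v => t.fringe v ∈ A).card * k ≤
      t.adjMatrix.charpoly.roots.count γ := by
  have : ∀ c, Fintype {w // t.Below c w} := fun c => Fintype.ofFinite _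
  set S := Finset.univ.filter fun v => t.fringe v ∈ A with hS
  have hfr : ∀ v : S, k ≤ Module.finrank ℝ ((t.sub v.1).rootedEigenspace γ) := by
    rintro ⟨v, hv⟩
    have h := hk _ (Finset.mem_filter.mp hv).2
    rwa [rootedEigenspace_equiv (t := t.sub v)
      (unlabel_eq_iff.mp (by rw [unlabel_rep, unlabel_sub]))] at h
  rw [count_roots_charpoly t.adjMatrix_isHermitian]
  let F : ((v : S) → (t.sub v.1).rootedEigenspace γ) →ₗ[ℝ] (V → ℝ) :=
    ∑ v : S, (t.extend v.1) ∘ₗ Submodule.subtype _ ∘ₗ LinearMap.proj v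
  have hF : ∀ φ w, F φ w = ∑ v : S, t.extend v.1 (φ v).1 w := by
    intro φ w
    simp [F]
  have hmem : ∀ φ, F φ ∈ Module.End.eigenspace (toLin' t.adjMatrix) γ := by
    intro φ
    rw [LinearMap.sum_apply]
    refine Submodule.sum_mem _ fun v _ => ?_
    rw [Module.End.mem_eigenspace_iff, toLin'_apply]
    exact t.extend_mem v.1 (φ v).2
  let G : ((v : S) → (t.sub v.1).rootedEigenspace γ) →ₗ[ℝ]
    Module.End.eigenspace (toLin' t.adjMatrix) γ := F.codRestrict _ hmem
  have hG : Function.Injective G := by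
    rw [← LinearMap.ker_eq_bot, LinearMap.ker_eq_bot']
    intro φ h
    have h0 : F φ = 0 := congrArg Subtype.val h
    funext v
    apply Subtype.ext
    funext w
    have h1 := congrFun h0 w.1
    rw [hF, Finset.sum_eq_single v] at h1
    · rwa [extend_apply _ _ _ _ w.2] at h1
    · intro v' _ hne
      refine extend_apply_of_not _ _ _ _ fun hb => hne (Subtype.ext ?_)
      refine eq_of_below_of_card hb w.2 ?_
      rw [hm _ (Finset.mem_filter.mp v.2).2, hm _ (Finset.mem_filter.mp v'.2).2]
    · simp
  have := LinearMap.finrank_le_finrank_of_injective hG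
  rw [Module.finrank_pi_fintype] at this
  refine le_trans ?_ this
  refine le_trans (le_of_eq ?_) (Finset.sum_le_sum fun v _ => hfr v)
  simp

theorem sum_ne_root [Fintype V] (t : RTree V) [Fintype {v // v ≠ t.root}] {f : V → ℝ}
    (hf : f t.root = 0) : ∑ v, f v = ∑ v : {v // v ≠ t.root}, f v :=
  sum_eq_sum_subtype _ _ fun v hv => by rw [not_not.mp hv, hf]

/-- Eigenvectors on the deleted forest that sum to zero over the children of the root extend. -/
theorem count_deletedMatrix_le [Fintype V] [DecidableEq V] (t : RTree V) (γ : ℝ) :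
    t.deletedMatrix.charpoly.roots.count γ ≤ Module.finrank ℝ (t.rootedEigenspace γ) + 1 := by
  have hB : t.deletedMatrix.IsHermitian := t.adjMatrix_isHermitian.submatrix _
  rw [count_roots_charpoly hB]
  set K := Module.End.eigenspace (toLin' t.deletedMatrix) γ
  let E : ({v // v ≠ t.root} → ℝ) →ₗ[ℝ] (V → ℝ) :=
    Function.ExtendByZero.linearMap ℝ (Subtype.val : {v // v ≠ t.root} → V)
  have hE : ∀ w (v : {v // v ≠ t.root}), E w v = w v := fun w v =>
    Subtype.val_injective.extend_apply w 0 v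
  have hE' : ∀ w, E w t.root = 0 := fun w =>
    Function.extend_apply' _ _ _ (by rintro ⟨a, ha⟩; exact a.2 ha)
  -- The equation at the root is the only one that extension by zero can violate; it is the
  -- vanishing of this functional, whose kernel has codimension at most one.
  let ℓ : K →ₗ[ℝ] ℝ := LinearMap.proj t.root ∘ₗ t.adjMatrix.mulVecLin ∘ₗ E ∘ₗ K.subtype
  have hmem : ∀ φ : LinearMap.ker ℓ, (E ∘ₗ K.subtype ∘ₗ (LinearMap.ker ℓ).subtype) φ ∈
      t.rootedEigenspace γ := by
    rintro ⟨⟨φ, hφ⟩, hk⟩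
    refine ⟨?_, hE' φ⟩
    have hφ' : t.deletedMatrix *ᵥ φ = γ • φ := by
      rwa [Module.End.mem_eigenspace_iff, toLin'_apply] at hφ
    have hk' : (t.adjMatrix *ᵥ E φ) t.root = 0 := hk
    change t.adjMatrix *ᵥ E φ = γ • E φ
    ext v
    by_cases hv : v = t.root
    · rw [hv, hk', Pi.smul_apply, hE', smul_zero]
    · have h1 := congrFun hφ' ⟨v, hv⟩
      rw [Pi.smul_apply, hE φ ⟨v, hv⟩, ← Pi.smul_apply, ← h1, mulVec, dotProduct,
        t.sum_ne_root (by rw [hE', mul_zero]), mulVec, dotProduct]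
      simp only [hE]
      rfl
  have hinj : Function.Injective ((E ∘ₗ K.subtype ∘ₗ (LinearMap.ker ℓ).subtype).codRestrict _
      hmem) := by
    intro φ ψ h
    have h0 : E φ.1.1 = E ψ.1.1 := congrArg Subtype.val h
    apply Subtype.ext
    apply Subtype.ext
    funext v
    rw [← hE φ.1.1, h0, hE]
  have h1 := LinearMap.finrank_le_finrank_of_injective hinj
  have h2 := LinearMap.finrank_range_add_finrank_ker ℓ
  have h3 : Module.finrank ℝ (LinearMap.range ℓ) ≤ 1 := by
    have := Submodule.finrank_le (LinearMap.range ℓ)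
    simpa using this
  omega

end RTree

open scoped Classical in
theorem forestMultiplicity_eq_count (u : Multiset UTree) (γ : ℝ) :
    forestMultiplicity u γ = (u.map UTree.spec).sum.count γ := by
  have hA : (forestAdjMatrix u).IsHermitian := by
    refine (blockDiagonal'_conjTranspose _).trans (congrArg blockDiagonal' ?_)
    funext i
    exact (u.toList.get i).rep.adjMatrix_isHermitian
  rw [forestMultiplicity]
  have h := count_roots_charpoly hA γ
  rw [← h, forestAdjMatrix, charpoly_blockDiagonal', Polynomial.roots_prod _ _
    (Finset.prod_ne_zero_iff.mpr fun c _ => (charpoly_monic _).ne_zero)]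
  congr 1
  conv_rhs => rw [← Multiset.coe_toList u, Multiset.map_coe, Multiset.sum_coe]
  exact Fin.sum_univ_fun_getElem u.toList UTree.spec

theorem forestMultiplicity_deleteRoot_le (s : UTree) (γ : ℝ) :
    forestMultiplicity s.deleteRoot γ ≤ Module.finrank ℝ (s.rep.rootedEigenspace γ) + 1 := by
  classical
  have h := s.rep.count_deletedMatrix_le γ
  rw [RTree.roots_charpoly_deletedMatrix, RTree.unlabel_rep] at h
  rw [forestMultiplicity_eq_count]
  exact h

theorem UTree.specCount_singleton (T : UTree) (γ : ℝ) :
    specCount {γ} T = (open scoped Classical in (T.spec.count γ : ℝ)) := by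
  classical
  rw [specCount, Multiset.count]
  norm_cast
  exact Multiset.countP_congr rfl fun x _ => by simp [eq_comm]

theorem UTree.mul_le_spectralDist (T : UTree) {A : Set UTree} {m k : ℕ} {γ : ℝ}
    (hm : ∀ s ∈ A, s.size = m)
    (hk : ∀ s ∈ A, k ≤ Module.finrank ℝ (s.rep.rootedEigenspace γ)) :
    T.fringeAvg (Set.indicator A 1) * k ≤ (T.spectralDist : Measure ℝ).real {γ} := by
  classical
  rw [spectralDist_real T (measurableSet_singleton γ), fringeAvg, specCount_singleton,
    div_mul_eq_mul_div]
  have h := T.rep.card_mul_finrank_le hm hk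
  gcongr
  have h1 : ∑ v, (Set.indicator A 1 (T.rep.fringe v) : ℝ) =
      (Finset.univ.filter fun v => T.rep.fringe v ∈ A).card := by
    simp only [Set.indicator_apply, Pi.one_apply]
    rw [Finset.sum_boole]
  rw [h1]
  exact_mod_cast h


/-! ### Convergence of fringe averages implies convergence of spectral distributions -/

namespace UTree

/-- The empirical distribution of the fringe subtrees. -/
def fringeLaw (T : UTree) : ProbabilityMeasure UTree := empirical T.rep.fringe

theorem integral_fringeLaw (T : UTree) (g : UTree → ℝ) :
    ∫ s, g s ∂(T.fringeLaw : Measure UTree) = T.fringeAvg g := by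
  change ∫ s, g s ∂((Fintype.card (Fin T.size) : ℝ≥0∞)⁻¹ •
    ∑ v, Measure.dirac (T.rep.fringe v) : Measure UTree) = _
  rw [integral_smul_measure, integral_finsetSum_measure, fringeAvg]
  · simp only [integral_dirac, Fintype.card_fin, ENNReal.toReal_inv, ENNReal.toReal_natCast,
      smul_eq_mul]
    rw [div_eq_inv_mul]
  · intro v _
    exact integrable_dirac (by simp)

theorem fringeLaw_real_singleton (T s : UTree) :
    (T.fringeLaw : Measure UTree).real {s} = T.fringeAvg (Set.indicator {s} 1) := by
  rw [← integral_fringeLaw, integral_indicator_one (MeasurableSet.of_discrete)]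

end UTree

/-- The coarsest filter along which the proportions of fringe subtrees converge to the masses
of `ρ`. -/
def massFilter (ρ : ProbabilityMeasure UTree) : Filter UTree :=
  ⨅ s : UTree, comap (fun T => T.fringeAvg (Set.indicator {s} 1)) (𝓝 ((ρ : Measure UTree).real {s}))

instance (ρ : ProbabilityMeasure UTree) : (massFilter ρ).IsCountablyGenerated := by
  unfold massFilter
  infer_instance

theorem tendsto_real_iff {ι Ω : Type*} [MeasurableSpace Ω] {l : Filter ι}
    {μ : ι → ProbabilityMeasure Ω} {ν : ProbabilityMeasure Ω} {s : Set Ω} :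
    Tendsto (fun i => μ i s) l (𝓝 (ν s)) ↔
      Tendsto (fun i => (μ i : Measure Ω).real s) l (𝓝 ((ν : Measure Ω).real s)) :=
  NNReal.tendsto_coe.symm

/-- On a countable discrete space, convergence of point masses to those of a probability measure is
weak convergence: the sets with at most one element form a π-system that contains a neighborhood of
each point in every open set. -/
theorem tendsto_fringeLaw (ρ : ProbabilityMeasure UTree) :
    Tendsto UTree.fringeLaw (massFilter ρ) (𝓝 ρ) := by
  have hS : IsPiSystem {s : Set UTree | s.Subsingleton} := fun s hs t _ _ =>
    Set.Subsingleton.anti hs Set.inter_subset_left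
  refine hS.tendsto_probabilityMeasure_of_tendsto_of_mem (fun _ _ => MeasurableSet.of_discrete)
    (fun u _ x hx => ⟨{x}, Set.subsingleton_singleton, by simp, by simpa using hx⟩) ?_
  intro s hs
  rw [tendsto_real_iff]
  rcases hs.eq_empty_or_singleton with rfl | ⟨t, rfl⟩
  · simpa using tendsto_const_nhds
  · simp only [UTree.fringeLaw_real_singleton]
    exact tendsto_iff_comap.mpr (iInf_le _ t)

/-- Every bounded function on the discrete space `UTree` is a test function for weak convergence. -/
theorem tendsto_fringeAvg (ρ : ProbabilityMeasure UTree) {g : UTree → ℝ} {C : ℝ}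
    (hg : ∀ T, |g T| ≤ C) :
    Tendsto (UTree.fringeAvg g) (massFilter ρ) (𝓝 (∫ T, g T ∂(ρ : Measure UTree))) := by
  have h := ProbabilityMeasure.tendsto_iff_forall_integral_tendsto.mp (tendsto_fringeLaw ρ)
    (BoundedContinuousFunction.ofNormedAddCommGroup g continuous_of_discreteTopology C hg)
  simpa [UTree.integral_fringeLaw] using! h

namespace UTree

theorem increment_sub (g h : UTree → ℝ) (T : UTree) :
    increment (fun T => g T - h T) T = increment g T - increment h T := by
  simp only [increment, Multiset.sum_map_sub]
  ring

theorem specCount_Iic_eq (x : ℝ) (T : UTree) :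
    specCount (Set.Iic x) T = T.size * ProbabilityTheory.cdf (T.spectralDist : Measure ℝ) x := by
  rw [ProbabilityTheory.cdf_eq_real, spectralDist_real T measurableSet_Iic,
    mul_div_cancel₀ _ (by exact_mod_cast T.size_pos.ne')]

theorem specCount_singleton_eq (γ : ℝ) (T : UTree) :
    specCount {γ} T = specCount (Set.Iic γ) T - specCount (Set.Iio γ) T := by
  have hT : (T.size : ℝ) ≠ 0 := by exact_mod_cast T.size_pos.ne'
  have key : ∀ B : Set ℝ, MeasurableSet B →
      specCount B T = T.size * (T.spectralDist : Measure ℝ).real B := by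
    intro B hB
    rw [spectralDist_real T hB, mul_div_cancel₀ _ hT]
  rw [key _ (measurableSet_singleton γ), key _ measurableSet_Iic, key _ measurableSet_Iio,
    ← mul_sub, ← measureReal_sdiff Set.Iio_subset_Iic_self measurableSet_Iio,
    Set.Iic_sdiff_Iio_same]

theorem increment_size (T : UTree) : increment (fun T => (T.size : ℝ)) T = 1 := by
  classical
  have h : (fun T : UTree => (T.size : ℝ)) = specCount Set.univ := by
    funext T
    rw [specCount_univ]
  rw [h, increment_specCount, specCount_univ]
  have hc : ∀ (m : Multiset ℝ) (_ : DecidablePred (· ∈ (Set.univ : Set ℝ))),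
      m.countP (· ∈ Set.univ) = m.card :=
    fun m _ => Multiset.countP_eq_card.mpr fun _ _ => Set.mem_univ _
  rw [hc]
  have hB : T.rep.deletedMatrix.IsHermitian := T.rep.adjMatrix_isHermitian.submatrix _
  rw [card_roots_charpoly hB, Fintype.card_subtype_compl, Fintype.card_subtype_eq,
    Fintype.card_fin, Nat.cast_sub T.size_pos]
  simp

theorem tendsto_increment {l : Filter ℝ} {g : ℝ → UTree → ℝ} {g₀ : UTree → ℝ}
    (h : ∀ T, Tendsto (fun x => g x T) l (𝓝 (g₀ T))) (T : UTree) :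
    Tendsto (fun x => increment (g x) T) l (𝓝 (increment g₀ T)) :=
  (h T).sub (tendsto_multiset_sum _ fun s _ => h s)

theorem abs_increment_Iic_le (x : ℝ) (T : UTree) : |increment (specCount (Set.Iic x)) T| ≤ 1 := by
  obtain ⟨h1, h2⟩ := increment_specCount_of_lower (B := Set.Iic x) (fun a b h h' => h.trans h') T
  rw [abs_le]
  constructor <;> linarith

/-- A point is the difference of two lower sets, whose increments both lie in `[0, 1]`. -/
theorem abs_increment_singleton_le (γ : ℝ) (T : UTree) : |increment (specCount {γ}) T| ≤ 1 := by
  obtain ⟨h1, h2⟩ := increment_specCount_of_lower (B := Set.Iic γ) (fun a b h h' => h.trans h') T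
  obtain ⟨h3, h4⟩ := increment_specCount_of_lower (B := Set.Iio γ)
    (fun a b h h' => h.trans_lt h') T
  have h : specCount {γ} = fun T => specCount (Set.Iic γ) T - specCount (Set.Iio γ) T :=
    funext (specCount_singleton_eq γ)
  rw [h, increment_sub, abs_le]
  constructor <;> linarith

end UTree

/-! ### The limiting spectral distribution and the limiting point masses. -/

open UTree in
/-- The distribution function of the limit of the spectral distributions. -/
def limitCDF (ρ : ProbabilityMeasure UTree) [(massFilter ρ).NeBot] : StieltjesFunction ℝ where
  toFun x := ∫ T, increment (specCount (Set.Iic x)) T ∂(ρ : Measure UTree)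
  mono' x y hxy := by
    -- The integrand need not be monotone in `x`; monotonicity is inherited from the spectral
    -- distribution functions of finite trees, and this is where nontriviality of `massFilter ρ`
    -- enters.
    refine le_of_tendsto_of_tendsto' (tendsto_fringeAvg ρ (abs_increment_Iic_le x))
      (tendsto_fringeAvg ρ (abs_increment_Iic_le y)) fun T => ?_
    rw [← spectralDist_real_eq_fringeAvg T measurableSet_Iic,
      ← spectralDist_real_eq_fringeAvg T measurableSet_Iic]
    exact measureReal_mono (Set.Iic_subset_Iic.mpr hxy)
  right_continuous' x := by
    refine tendsto_integral_filter_of_dominated_convergence (fun _ => 1)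
      (Eventually.of_forall fun _ => measurable_from_top.aestronglyMeasurable)
      (Eventually.of_forall fun y => Eventually.of_forall (abs_increment_Iic_le y))
      (integrable_const _) (Eventually.of_forall fun T => ?_)
    refine tendsto_increment (fun T => ?_) T
    simp only [specCount_Iic_eq]
    exact Tendsto.const_mul _ (StieltjesFunction.right_continuous _ x)

open UTree in
theorem tendsto_limitCDF_atBot (ρ : ProbabilityMeasure UTree) [(massFilter ρ).NeBot] :
    Tendsto (limitCDF ρ) atBot (𝓝 0) := by
  have h : Tendsto (fun x => ∫ T, increment (specCount (Set.Iic x)) T ∂(ρ : Measure UTree)) atBot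
      (𝓝 (∫ T, increment (fun _ => 0) T ∂(ρ : Measure UTree))) := by
    refine tendsto_integral_filter_of_dominated_convergence (fun _ => 1)
      (Eventually.of_forall fun _ => measurable_from_top.aestronglyMeasurable)
      (Eventually.of_forall fun y => Eventually.of_forall (abs_increment_Iic_le y))
      (integrable_const _) (Eventually.of_forall fun T => ?_)
    refine tendsto_increment (fun T => ?_) T
    simp only [specCount_Iic_eq]
    simpa using (ProbabilityTheory.tendsto_cdf_atBot (T.spectralDist : Measure ℝ)).const_mul
      (T.size : ℝ)
  have h0 : ∫ T, increment (fun _ => 0) T ∂(ρ : Measure UTree) = 0 := by simp [increment]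
  rwa [h0] at h

-- For each tree the counts tend to the number of vertices, whose increment is `1` because deleting
-- the root loses one vertex. So no spectral mass escapes to infinity.
open UTree in
theorem tendsto_limitCDF_atTop (ρ : ProbabilityMeasure UTree) [(massFilter ρ).NeBot] :
    Tendsto (limitCDF ρ) atTop (𝓝 1) := by
  have h : Tendsto (fun x => ∫ T, increment (specCount (Set.Iic x)) T ∂(ρ : Measure UTree)) atTop
      (𝓝 (∫ T, increment (fun T => (T.size : ℝ)) T ∂(ρ : Measure UTree))) := by
    refine tendsto_integral_filter_of_dominated_convergence (fun _ => 1)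
      (Eventually.of_forall fun _ => measurable_from_top.aestronglyMeasurable)
      (Eventually.of_forall fun y => Eventually.of_forall (abs_increment_Iic_le y))
      (integrable_const _) (Eventually.of_forall fun T => ?_)
    refine tendsto_increment (fun T => ?_) T
    simp only [specCount_Iic_eq]
    simpa using (ProbabilityTheory.tendsto_cdf_atTop (T.spectralDist : Measure ℝ)).const_mul
      (T.size : ℝ)
  have h1 : ∫ T, increment (fun T => (T.size : ℝ)) T ∂(ρ : Measure UTree) = 1 := by
    simp [increment_size]
  rwa [h1] at h

/-- The limit of the spectral distributions. -/
def limitDist (ρ : ProbabilityMeasure UTree) [(massFilter ρ).NeBot] : ProbabilityMeasure ℝ :=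
  ⟨(limitCDF ρ).measure,
    (limitCDF ρ).isProbabilityMeasure (tendsto_limitCDF_atBot ρ) (tendsto_limitCDF_atTop ρ)⟩

theorem limitDist_real_Ioc (ρ : ProbabilityMeasure UTree) [(massFilter ρ).NeBot] {a b : ℝ}
    (hab : a ≤ b) :
    (limitDist ρ : Measure ℝ).real (Set.Ioc a b) = limitCDF ρ b - limitCDF ρ a := by
  change ((limitCDF ρ).measure (Set.Ioc a b)).toReal = _
  rw [StieltjesFunction.measure_Ioc, ENNReal.toReal_ofReal]
  exact sub_nonneg.mpr ((limitCDF ρ).mono hab)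

-- The masses of half-open intervals converge with no continuity condition at the endpoints, since
-- they are fringe averages of bounded functions. These intervals form a π-system that contains
-- small neighborhoods of every point.
open UTree in
theorem tendsto_spectralDist (ρ : ProbabilityMeasure UTree) [(massFilter ρ).NeBot] :
    Tendsto UTree.spectralDist (massFilter ρ) (𝓝 (limitDist ρ)) := by
  have hS : IsPiSystem {s : Set ℝ | ∃ a b, Set.Ioc a b = s} := by
    rintro _ ⟨a, b, rfl⟩ _ ⟨c, d, rfl⟩ -
    exact ⟨_, _, Set.Ioc_inter_Ioc.symm⟩
  refine hS.tendsto_probabilityMeasure_of_tendsto_of_mem ?_ ?_ ?_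
  · rintro _ ⟨a, b, rfl⟩
    exact measurableSet_Ioc
  · intro u hu x hx
    obtain ⟨ε, hε, hb⟩ := Metric.isOpen_iff.mp hu x hx
    refine ⟨_, ⟨x - ε / 2, x + ε / 2, rfl⟩, Ioc_mem_nhds (by linarith) (by linarith), ?_⟩
    rintro y ⟨h1, h2⟩
    refine hb ?_
    rw [Metric.mem_ball, Real.dist_eq, abs_lt]
    constructor <;> linarith
  · rintro _ ⟨a, b, rfl⟩
    rw [tendsto_real_iff]
    rcases le_total a b with hab | hab
    · have hT : ∀ T : UTree, (T.spectralDist : Measure ℝ).real (Set.Ioc a b) =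
          fringeAvg (increment (specCount (Set.Iic b))) T -
            fringeAvg (increment (specCount (Set.Iic a))) T := by
        intro T
        rw [← spectralDist_real_eq_fringeAvg T measurableSet_Iic,
          ← spectralDist_real_eq_fringeAvg T measurableSet_Iic,
          ← measureReal_sdiff (Set.Iic_subset_Iic.mpr hab) measurableSet_Iic,
          Set.Iic_sdiff_Iic]
      simp only [hT]
      rw [limitDist_real_Ioc ρ hab]
      exact (tendsto_fringeAvg ρ (abs_increment_Iic_le b)).sub
        (tendsto_fringeAvg ρ (abs_increment_Iic_le a))
    · simp [Set.Ioc_eq_empty (not_lt.mpr hab)]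

/-- The limit of the masses that the spectral distributions give to `γ`. -/
def limitMass (ρ : ProbabilityMeasure UTree) (γ : ℝ) : ℝ :=
  ∫ T, UTree.increment (UTree.specCount {γ}) T ∂(ρ : Measure UTree)

theorem tendsto_spectralDist_singleton (ρ : ProbabilityMeasure UTree) (γ : ℝ) :
    Tendsto (fun T => (T.spectralDist : Measure ℝ).real {γ}) (massFilter ρ)
      (𝓝 (limitMass ρ γ)) := by
  simp only [UTree.spectralDist_real_eq_fringeAvg _ (measurableSet_singleton γ)]
  exact tendsto_fringeAvg ρ (UTree.abs_increment_singleton_le γ)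

/-- Portmanteau for the closed set `{γ}`: the limit measure can only gain mass there. -/
theorem limitMass_le (ρ : ProbabilityMeasure UTree) [(massFilter ρ).NeBot] (γ : ℝ) :
    limitMass ρ γ ≤ (limitDist ρ : Measure ℝ).real {γ} := by
  have h := ProbabilityMeasure.limsup_measure_closed_le_of_tendsto (tendsto_spectralDist ρ)
    (isClosed_singleton (x := γ))
  have h2 : Tendsto (fun T : UTree => (T.spectralDist : Measure ℝ) {γ}) (massFilter ρ)
      (𝓝 (ENNReal.ofReal (limitMass ρ γ))) := by
    have := ENNReal.tendsto_ofReal (tendsto_spectralDist_singleton ρ γ)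
    simpa using this
  rw [h2.limsup_eq] at h
  exact (ENNReal.ofReal_le_iff_le_toReal (measure_ne_top _ _)).mp h

theorem real_mul_le_limitMass (ρ : ProbabilityMeasure UTree) [(massFilter ρ).NeBot]
    {A : Set UTree} {m k : ℕ} {γ : ℝ} (hm : ∀ s ∈ A, s.size = m)
    (hk : ∀ s ∈ A, k ≤ Module.finrank ℝ (s.rep.rootedEigenspace γ)) :
    (ρ : Measure UTree).real A * k ≤ limitMass ρ γ := by
  have h := tendsto_fringeAvg ρ (g := Set.indicator A 1) (C := 1) (by
    classical
    intro T
    rw [Set.indicator_apply]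
    split_ifs <;> simp)
  rw [integral_indicator_one MeasurableSet.of_discrete] at h
  exact le_of_tendsto_of_tendsto' (h.mul_const _) (tendsto_spectralDist_singleton ρ γ) fun T =>
    T.mul_le_spectralDist hm hk


/-! ### Random trees that converge in the probability fringe sense -/

theorem tendsto_prob_one_iff {Ω : ℕ → Type*} [∀ n, MeasurableSpace (Ω n)]
    (P : ∀ n, Measure (Ω n)) [∀ n, IsProbabilityMeasure (P n)] (A : ∀ n, Set (Ω n))
    (hA : ∀ n, MeasurableSet (A n)) :
    Tendsto (fun n => P n (A n)) atTop (𝓝 1) ↔ Tendsto (fun n => P n (A n)ᶜ) atTop (𝓝 0) := by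
  constructor
  · intro h
    simp only [fun n => prob_compl_eq_one_sub (μ := P n) (hA n)]
    simpa using ENNReal.Tendsto.sub tendsto_const_nhds h (Or.inl ENNReal.one_ne_top)
  · intro h
    have h1 : ∀ n, P n (A n) = 1 - P n (A n)ᶜ := fun n => by
      rw [← prob_compl_eq_one_sub (hA n).compl, compl_compl]
    simp only [h1]
    simpa using ENNReal.Tendsto.sub tendsto_const_nhds h (Or.inl ENNReal.one_ne_top)

/-- The sets of trees whose probabilities under the laws of `T n` tend to one. -/
def probFilter {Ω : ℕ → Type*} [∀ n, MeasurableSpace (Ω n)] (P : ∀ n, Measure (Ω n))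
    [∀ n, IsProbabilityMeasure (P n)] (T : ∀ n, Ω n → UTree) (hT : ∀ n, Measurable (T n)) :
    Filter UTree where
  sets := {U | Tendsto (fun n => P n (T n ⁻¹' U)) atTop (𝓝 1)}
  univ_sets := by simp
  sets_of_superset {U V} hU hUV := tendsto_of_tendsto_of_tendsto_of_le_of_le hU tendsto_const_nhds
    (fun n => measure_mono (Set.preimage_mono hUV)) fun n => prob_le_one
  inter_sets {U V} hU hV := by
    have hm : ∀ (U : Set UTree) n, MeasurableSet (T n ⁻¹' U) := fun U n =>
      hT n MeasurableSet.of_discrete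
    change Tendsto _ _ _
    rw [tendsto_prob_one_iff P _ (hm _)]
    have h := ((tendsto_prob_one_iff P _ (hm U)).mp hU).add
      ((tendsto_prob_one_iff P _ (hm V)).mp hV)
    rw [add_zero] at h
    refine tendsto_of_tendsto_of_tendsto_of_le_of_le tendsto_const_nhds h (fun _ => zero_le)
      fun n => ?_
    rw [Set.preimage_inter, Set.compl_inter]
    exact measure_union_le _ _

section

variable {Ω : ℕ → Type*} [∀ n, MeasurableSpace (Ω n)] (P : ∀ n, Measure (Ω n))
    [∀ n, IsProbabilityMeasure (P n)] (T : ∀ n, Ω n → UTree) (hT : ∀ n, Measurable (T n))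

instance : (probFilter P T hT).NeBot := by
  rw [neBot_iff]
  intro h
  have h1 : (∅ : Set UTree) ∈ probFilter P T hT := by rw [h]; exact mem_bot
  have h2 : Tendsto (fun n => P n (T n ⁻¹' ∅)) atTop (𝓝 1) := h1
  simp at h2

/-- Convergence in probability of functionals of the trees is convergence along a filter on `UTree`.
The probabilistic claims thus follow from deterministic ones along `massFilter ρ` as soon as
`probFilter` is finer. -/
theorem tendstoInProb_iff {E : Type*} [TopologicalSpace E] (X : UTree → E) (c : E) :
    TendstoInProb P (fun n ω => X (T n ω)) c ↔ Tendsto X (probFilter P T hT) (𝓝 c) :=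
  Iff.rfl

theorem massFilter_neBot {ρ : ProbabilityMeasure UTree} (h : probFilter P T hT ≤ massFilter ρ) :
    (massFilter ρ).NeBot := neBot_of_le h

theorem UTree.fringeSeq_zero (t : UTree) (v : Fin t.size) :
    t.rep.fringeSeq v 0 = .ofTree (t.rep.fringe v) := by
  rw [RTree.fringeSeq, dif_pos (Nat.zero_le _)]
  rfl

theorem UTree.ofTree_injective : Function.Injective UTreeStar.ofTree :=
  fun _ _ h => Option.some_injective _ h

theorem UTree.fringeDist_real (t s : UTree) :
    (t.fringeDist : Measure (ℕ → UTreeStar)).real {x | x 0 = .ofTree s} =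
      t.fringeAvg (Set.indicator {s} 1) := by
  classical
  have h0 : Measurable fun x : ℕ → UTreeStar => x 0 := measurable_pi_apply 0
  have hm : MeasurableSet {x : ℕ → UTreeStar | x 0 = .ofTree s} :=
    h0 (MeasurableSet.of_discrete (s := {UTreeStar.ofTree s}))
  rw [UTree.fringeDist, empirical_real _ hm, fringeAvg, Fintype.card_fin]
  congr 1
  simp only [Set.indicator_apply, Pi.one_apply, Set.mem_singleton_iff]
  rw [Finset.sum_boole]
  congr 2
  ext v
  simp only [Finset.mem_filter, Set.mem_ofPred_eq, fringeSeq_zero, ofTree_injective.eq_iff]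

variable {Ω' : Type*} [MeasurableSpace Ω'] (Q : Measure Ω')
    [IsProbabilityMeasure Q] (S : Ω' → ℕ → UTree) (hS : Measurable S)

/-- The law of the first tree of a random sin-tree. -/
def fringeLimit : ProbabilityMeasure UTree :=
  ⟨Q.map fun ω => S ω 0, Measure.isProbabilityMeasure_map
    ((measurable_pi_apply 0).comp hS).aemeasurable⟩

theorem fringeLimit_apply (A : Set UTree) :
    (fringeLimit Q S hS : Measure UTree).real A = Q.real {ω | S ω 0 ∈ A} := by
  change (Q.map (fun ω => S ω 0)).real A = _
  have hm : Measurable fun ω => S ω 0 := (measurable_pi_apply 0).comp hS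
  rw [map_measureReal_apply hm MeasurableSet.of_discrete]
  rfl

/-- Prescribing the zeroth tree is a clopen condition on sequences, so its probability converges
under weak convergence. Nothing beyond the law of the zeroth tree is extracted from the sin-tree. -/
theorem probFilter_le_of_fringeConverges (h : FringeConverges P T Q S hS) :
    probFilter P T hT ≤ massFilter (fringeLimit Q S hS) := by
  refine le_iInf fun s => tendsto_iff_comap.mp ?_
  have h1 := (tendstoInProb_iff P T hT UTree.fringeDist _).mp h
  have hc : IsClopen {x : ℕ → UTreeStar | x 0 = .ofTree s} :=
    (isClopen_discrete {UTreeStar.ofTree s}).preimage (continuous_apply 0)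
  have h2 := tendsto_real_iff.mp
    (ProbabilityMeasure.tendsto_measure_of_isClopen_of_tendsto h1 hc)
  simp only [UTree.fringeDist_real] at h2
  convert h2 using 2
  rw [fringeLimit_apply]
  change _ = (Q.map (sinInclusion ∘ S)).real _
  rw [map_measureReal_apply (measurable_sinInclusion.comp hS) hc.2.measurableSet]
  congr 1
  ext ω
  simp [sinInclusion, UTree.ofTree_injective.eq_iff]

theorem exists_limit_of_fringeConverges (hT : ∀ n, Measurable (T n))
    (h : FringeConverges P T Q S hS) :
    ∃ (F : ProbabilityMeasure ℝ) (c : ℝ → ℝ),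
      TendstoInProb P (fun n ω => (T n ω).spectralDist) F ∧
      (∀ γ : ℝ,
        TendstoInProb P (fun n ω => ((T n ω).spectralDist : Measure ℝ).real {γ}) (c γ) ∧
        c γ ≤ (F : Measure ℝ).real {γ}) ∧
      ∀ (u : Multiset UTree) (γ : ℝ) (L : ℕ), forestMultiplicity u γ = L → 1 < L →
        0 < Q.real {ω | (S ω 0).deleteRoot = u} →
        0 < c γ ∧ 0 < (F : Measure ℝ).real {γ} ∧
        ((L : ℝ) - 1) * Q.real {ω | (S ω 0).deleteRoot = u} ≤ (F : Measure ℝ).real {γ} := by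
  let ρ := fringeLimit Q S hS
  have hle : probFilter P T hT ≤ massFilter ρ := probFilter_le_of_fringeConverges P T hT Q S hS h
  have := massFilter_neBot P T hT hle
  refine ⟨limitDist ρ, limitMass ρ, ?_, fun γ => ⟨?_, limitMass_le ρ γ⟩, ?_⟩
  · exact (tendstoInProb_iff P T hT _ _).mpr ((tendsto_spectralDist ρ).mono_left hle)
  · exact (tendstoInProb_iff P T hT (fun T => (T.spectralDist : Measure ℝ).real {γ}) _).mpr
      ((tendsto_spectralDist_singleton ρ γ).mono_left hle)
  · intro u γ L hL h1 hpos
    let A : Set UTree := {s | s.deleteRoot = u}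
    have hA : Q.real {ω | (S ω 0).deleteRoot = u} = (ρ : Measure UTree).real A :=
      (fringeLimit_apply Q S hS A).symm
    rw [hA] at hpos ⊢
    -- The forest below the root determines the size, so the fringe subtrees in `A` have a common
    -- size and are disjoint.
    have hm : ∀ s ∈ A, (s.size : ℝ) = 1 + (u.map fun s => (s.size : ℝ)).sum := by
      intro s hs
      have h1 := UTree.increment_size s
      rw [UTree.increment, show s.deleteRoot = u from hs] at h1
      linarith
    obtain ⟨s₀, hs₀⟩ : A.Nonempty := by
      rw [Set.nonempty_iff_ne_empty]
      intro h0
      rw [h0] at hpos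
      simp at hpos
    have hm' : ∀ s ∈ A, s.size = s₀.size := fun s hs => by
      exact_mod_cast (hm s hs).trans (hm s₀ hs₀).symm
    have hk : ∀ s ∈ A, L - 1 ≤ Module.finrank ℝ (s.rep.rootedEigenspace γ) := by
      intro s hs
      have h1 := forestMultiplicity_deleteRoot_le s γ
      rw [show s.deleteRoot = u from hs, hL] at h1
      omega
    have key := real_mul_le_limitMass ρ hm' hk
    rw [Nat.cast_sub h1.le, Nat.cast_one, mul_comm] at key
    have hL' : (0 : ℝ) < L - 1 := by
      have : (1 : ℝ) < L := by exact_mod_cast h1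
      linarith
    have hc : 0 < limitMass ρ γ := (mul_pos hL' hpos).trans_le key
    exact ⟨hc, hc.trans_le (limitMass_le ρ γ), key.trans (limitMass_le ρ γ)⟩

end

/-- Convergence of the fringe proportions in mean implies convergence of the spectral
distributions; the atoms of the limit are dense if there are enough eigenvectors that vanish at
the root. -/
theorem hasDenseAtomsInLimit_of_tendsto (μ : ∀ n : ℕ, PMF (RTree (Fin (n + 1))))
    (ρ : ProbabilityMeasure UTree) (hpos : ∀ s, 0 < (ρ : Measure UTree).real {s})
    (hlim : ∀ s, ∀ ε > 0, Tendsto (fun n => (μ n).toMeasure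
      {t | ε ≤ |t.unlabel.fringeAvg (Set.indicator {s} 1) - (ρ : Measure UTree).real {s}|})
        atTop (𝓝 0))
    (hdense : Dense {γ : ℝ | ∃ s : UTree, s.rep.rootedEigenspace γ ≠ ⊥}) :
    HasDenseAtomsInLimit μ := by
  have hT : ∀ n, Measurable (fun t : RTree (Fin (n + 1)) => t.unlabel) :=
    fun n => measurable_from_top
  have hle : probFilter (fun n => (μ n).toMeasure) (fun n t => t.unlabel) hT ≤ massFilter ρ := by
    refine le_iInf fun s => tendsto_iff_comap.mp ?_
    rw [Metric.tendsto_nhds]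
    intro ε hε
    change Tendsto _ _ _
    rw [tendsto_prob_one_iff _ _ fun n => hT n MeasurableSet.of_discrete]
    convert hlim s ε hε using 3 with n
    ext t
    simp [Real.dist_eq]
  have := massFilter_neBot _ _ _ hle
  refine ⟨limitDist ρ, ?_, hdense.mono ?_⟩
  · have h := (tendstoInProb_iff _ _ hT UTree.spectralDist _).mpr
      ((tendsto_spectralDist ρ).mono_left hle)
    simpa only [RTree.spectralDist_unlabel] using h
  · rintro γ ⟨s, hs⟩
    have hk : 1 ≤ Module.finrank ℝ (s.rep.rootedEigenspace γ) :=
      Module.finrank_pos_iff.mpr (Submodule.nontrivial_iff_ne_bot.mpr hs)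
    -- A single tree of positive limiting proportion with one eigenvector vanishing at its root
    -- already forces an atom at `γ`.
    have key := real_mul_le_limitMass ρ (A := {s}) (m := s.size) (k := 1) (γ := γ)
      (by simp) (by simpa using hk)
    rw [Nat.cast_one, mul_one] at key
    exact (hpos s).trans_le (key.trans (limitMass_le ρ γ))


open Matrix

/-! ### Eigenvalues of caterpillars -/

open scoped Classical in
theorem RTree.adjMatrix_mulVec {V : Type*} [Fintype V] (t : RTree V) (φ : V → ℝ) (v : V) :
    (t.adjMatrix *ᵥ φ) v = (if v = t.root then 0 else φ (t.par v)) +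
      ∑ c, if c ≠ t.root ∧ t.par c = v then φ c else 0 := by
  have h : ∀ c, t.adjMatrix v c * φ c = (if v ≠ t.root ∧ t.par v = c then φ c else 0) +
      if c ≠ t.root ∧ t.par c = v then φ c else 0 := by
    intro c
    rw [adjMatrix_apply, if_congr t.adj_iff rfl rfl]
    by_cases h1 : v ≠ t.root ∧ t.par v = c
    · have h2 : ¬ (c ≠ t.root ∧ t.par c = v) := by
        rintro ⟨h3, h4⟩
        have h5 := t.height_par h1.1
        have h6 := t.height_par h3
        rw [h1.2] at h5
        rw [h4] at h6
        omega
      simp [h1, h2]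
    · simp [h1]
  rw [mulVec, dotProduct, Finset.sum_congr rfl fun c _ => h c, Finset.sum_add_distrib]
  congr 1
  by_cases hv : v = t.root <;> simp [hv]

/-- The vertices of the symmetric caterpillar: a root, and two paths with `K` vertices starting at
its two children, with `m` leaves attached to every vertex of the paths. -/
abbrev CaterpillarVertex (K m : ℕ) : Type := Option (Bool × Fin K × Option (Fin m))

namespace Caterpillar

variable {K m : ℕ}

/-- The parent function of the symmetric caterpillar. -/
def parent : CaterpillarVertex K m → CaterpillarVertex K m
  | none => none
  | some (b, j, some _) => some (b, j, none)
  | some (b, j, none) =>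
    if j.val = 0 then none else some (b, ⟨j.val - 1, (Nat.sub_le _ _).trans_lt j.isLt⟩, none)

/-- The distance from the root. -/
def rank : CaterpillarVertex K m → ℕ
  | none => 0
  | some (_, j, some _) => j + 2
  | some (_, j, none) => j + 1

theorem rank_parent (v : CaterpillarVertex K m) (hv : v ≠ none) : rank (parent v) < rank v := by
  match v with
  | none => exact absurd rfl hv
  | some (b, j, some l) => simp [parent, rank]
  | some (b, j, none) =>
    by_cases hj : j.val = 0
    · simp [parent, rank, hj]
    · simp only [parent, rank, if_neg hj]
      omega

/-- The symmetric caterpillar. -/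
def tree (K m : ℕ) : RTree (CaterpillarVertex K m) := RTree.ofParent none parent rank rank_parent

theorem par_tree : (tree K m).par = parent := RTree.par_ofParent _ _ _ _ rfl

/-- The sign of an arm of the caterpillar. -/
def sign (b : Bool) : ℝ := if b then 1 else -1

/-- An eigenvector that vanishes at the root. -/
def vector (θ lam : ℝ) : CaterpillarVertex K m → ℝ
  | none => 0
  | some (b, j, some _) => sign b * (Real.sin ((j + 1) * θ) / lam)
  | some (b, j, none) => sign b * Real.sin ((j + 1) * θ)

/-- Along an arm, sines satisfy the path recursion with eigenvalue `2 cos θ`, and the `m` leaves at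
each vertex add `m / lam`. The zeros of the sine at `0` and `(K + 1) θ` are the boundary conditions,
and the opposite signs of the arms cancel at the root. For `m = 0` the quotient `m / lam` is `0`
even if `lam = 0`. -/
theorem mulVec_vector {θ lam : ℝ} (hθ : Real.sin ((K + 1) * θ) = 0) (hm : m ≠ 0 → lam ≠ 0)
    (hlam : lam = 2 * Real.cos θ + m / lam) :
    (tree K m).adjMatrix *ᵥ (vector θ lam) = lam • vector θ lam := by
  classical
  funext v
  rw [RTree.adjMatrix_mulVec, par_tree, Pi.smul_apply, smul_eq_mul]
  have hroot : (tree K m).root = none := rfl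
  have hnone : vector θ lam (none : CaterpillarVertex K m) = 0 := rfl
  rw [hroot, Fintype.sum_option, Fintype.sum_prod_type, hnone, ite_self, zero_add]
  simp only [Fintype.sum_prod_type, Fintype.sum_option]
  match v with
  | none =>
    simp only [Fintype.sum_bool, if_true, zero_add, vector, mul_zero, sign]
    rw [← Finset.sum_add_distrib]
    refine Finset.sum_eq_zero fun j _ => ?_
    by_cases hj : j.val = 0
    · simp [parent, hj]
    · simp [parent, hj]
  | some (b, j, some l) =>
    have hl : lam ≠ 0 := hm (by rintro rfl; exact l.elim0)
    have h0 : ∀ (b' : Bool) (j' : Fin K), ¬ parent (some (b', j', none)) =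
        (some (b, j, some l) : CaterpillarVertex K m) := by
      intro b' j'
      by_cases hj : j'.val = 0 <;> simp [parent, hj]
    have h1 : ∀ (b' : Bool) (j' : Fin K) (l' : Fin m), ¬ parent (some (b', j', some l')) =
        (some (b, j, some l) : CaterpillarVertex K m) := by
      intro b' j' l'
      simp [parent]
    simp only [h0, h1, and_false, if_false, Finset.sum_const_zero, add_zero]
    rw [if_neg (by simp)]
    simp only [parent, vector]
    field_simp
  | some (b, j, none) =>
    have h0 : ∀ (b' : Bool) (j' : Fin K), (some (b', j', none) ≠ (none : CaterpillarVertex K m) ∧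
        parent (some (b', j', none)) = (some (b, j, none) : CaterpillarVertex K m)) ↔
        b' = b ∧ j'.val = j.val + 1 := by
      intro b' j'
      by_cases hj : j'.val = 0
      · simp [parent, hj]
      · simp only [parent, if_neg hj, ne_eq, reduceCtorEq, not_false_eq_true, true_and,
          Option.some.injEq, Prod.mk.injEq, Fin.ext_iff, and_true]
        refine and_congr_right fun _ => ?_
        omega
    have h1 : ∀ (b' : Bool) (j' : Fin K) (l' : Fin m),
        (some (b', j', some l') ≠ (none : CaterpillarVertex K m) ∧
        parent (some (b', j', some l')) = (some (b, j, none) : CaterpillarVertex K m)) ↔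
        b' = b ∧ j' = j := by
      intro b' j' l'
      simp [parent]
    have e1 : vector θ lam (parent (some (b, j, none) : CaterpillarVertex K m)) =
        sign b * Real.sin (j * θ) := by
      by_cases hj : j.val = 0
      · simp [parent, hj, vector]
      · simp only [parent, if_neg hj, vector]
        rw [Nat.cast_sub (by omega)]
        simp
    have e2 : ∑ b', ∑ j' : Fin K, (if b' = b ∧ j'.val = j.val + 1 then
        sign b' * Real.sin ((j' + 1) * θ) else 0) = sign b * Real.sin ((j + 2) * θ) := by
      rw [Finset.sum_eq_single b (fun b' _ hb => by simp [hb]) (by simp)]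
      by_cases hj : j.val + 1 < K
      · rw [Finset.sum_eq_single (⟨j.val + 1, hj⟩ : Fin K)]
        · simp only [and_self, if_true]
          push_cast
          congr 3
          ring
        · intro j' _ hj'
          rw [if_neg]
          rintro ⟨-, h⟩
          exact hj' (Fin.ext h)
        · simp
      · have hK : (j : ℝ) + 2 = K + 1 := by
          have : j.val + 1 = K := by have := j.isLt; omega
          have h' : ((j.val + 1 : ℕ) : ℝ) = K := by exact_mod_cast this
          rw [← h']; push_cast; ring
        rw [hK, hθ, mul_zero]
        refine Finset.sum_eq_zero fun j' _ => if_neg ?_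
        rintro ⟨-, h⟩
        have := j'.isLt
        omega
    have e3 : ∑ b', ∑ j' : Fin K, ∑ _l : Fin m, (if b' = b ∧ j' = j then
        sign b' * (Real.sin ((j' + 1) * θ) / lam) else 0) =
        m * (sign b * (Real.sin ((j + 1) * θ) / lam)) := by
      rw [Finset.sum_eq_single b (fun b' _ hb => by simp [hb]) (by simp),
        Finset.sum_eq_single j (fun j' _ hj => by simp [hj]) (by simp)]
      simp
    rw [if_neg (by simp), e1]
    simp only [h0, h1, Finset.sum_add_distrib, vector]
    rw [e2, e3]
    have t1 : (j : ℝ) * θ = (j + 1) * θ - θ := by ring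
    have t2 : ((j : ℝ) + 2) * θ = (j + 1) * θ + θ := by ring
    rw [t1, t2, Real.sin_sub, Real.sin_add]
    calc _ = (2 * Real.cos θ + m / lam) * (sign b * Real.sin ((j + 1) * θ)) := by ring
      _ = _ := by rw [← hlam]

theorem rootedEigenspace_ne_bot {θ lam : ℝ} (hK : 0 < K) (hθ : Real.sin ((K + 1) * θ) = 0)
    (hm : m ≠ 0 → lam ≠ 0) (hlam : lam = 2 * Real.cos θ + m / lam) (hs : Real.sin θ ≠ 0) :
    ∃ s : UTree, s.rep.rootedEigenspace lam ≠ ⊥ := by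
  have h1 : (tree K m).rootedEigenspace lam ≠ ⊥ := by
    rw [Submodule.ne_bot_iff]
    refine ⟨vector θ lam, ⟨mulVec_vector hθ hm hlam, rfl⟩, fun h => hs ?_⟩
    have h2 := congrFun h (some (true, ⟨0, hK⟩, none))
    simpa [vector, sign] using h2
  refine ⟨(tree K m).unlabel, fun h => h1 ?_⟩
  rw [← Submodule.finrank_eq_zero (R := ℝ)] at h ⊢
  rw [← RTree.rootedEigenspace_equiv (tree K m).rep_unlabel_isomorphic, h]

end Caterpillar

theorem mem_closure_fractions {r : ℝ} (h0 : 0 < r) (h1 : r < 1) :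
    r ∈ closure {r : ℝ | ∃ K i : ℕ, 0 < i ∧ i ≤ K ∧ r = i / (K + 1)} := by
  rw [Metric.mem_closure_iff]
  intro ε hε
  obtain ⟨q, hq1, hq2⟩ := exists_rat_btwn (max_lt h0 (sub_lt_self r hε))
  obtain ⟨hq0, hq3⟩ := max_lt_iff.mp hq1
  have hq0' : 0 < q := by exact_mod_cast hq0
  have hq1' : q < 1 := by exact_mod_cast hq2.trans h1
  have hnum : 0 < q.num := Rat.num_pos.mpr hq0'
  have hden : 0 < q.den := q.den_pos
  have hlt : q.num < q.den := Rat.num_lt_denom_iff.mpr hq1'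
  -- A rational in `(0, 1)` already has the required form, with `K + 1` its denominator.
  refine ⟨q, ⟨q.den - 1, q.num.toNat, by omega, by omega, ?_⟩, ?_⟩
  · have e1 : ((q.den - 1 : ℕ) : ℝ) + 1 = q.den := by
      rw [Nat.cast_sub (by omega)]; simp
    have e2 : ((q.num.toNat : ℕ) : ℝ) = q.num := by
      have : ((q.num.toNat : ℕ) : ℤ) = q.num := Int.toNat_of_nonneg hnum.le
      exact_mod_cast this
    rw [e1, e2, Rat.cast_def]
  · rw [Real.dist_eq, abs_lt]
    constructor <;> linarith

/-- For fixed `m` the caterpillar eigenvalues are the roots `c ± √(c ^ 2 + m)` of `lam = 2 * c + m /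
lam`, where `c = cos (π i / (K + 1))` runs through a dense subset of `(-1, 1)`. It remains to reach
`x` from some `m` and some `c` in `(-1, 1)`, by a continuous branch of the root. -/
theorem dense_rootedEigenspace_ne_bot :
    Dense {γ : ℝ | ∃ s : UTree, s.rep.rootedEigenspace γ ≠ ⊥} := by
  intro x
  have main : ∀ (m : ℕ) (c : ℝ) (f : ℝ → ℝ), -1 < c → c < 1 → Continuous f → f c = x →
      (∀ c', (m ≠ 0 → f c' ≠ 0) ∧ f c' = 2 * c' + m / f c') →
      x ∈ closure {γ : ℝ | ∃ s : UTree, s.rep.rootedEigenspace γ ≠ ⊥} := by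
    intro m c f hc1 hc2 hf hfc hf'
    have hr := mem_closure_fractions (r := Real.arccos c / Real.pi)
      (div_pos (Real.arccos_pos.mpr hc2) Real.pi_pos) (by
        rw [div_lt_one Real.pi_pos]
        refine lt_of_le_of_ne (Real.arccos_le_pi c) fun h => ?_
        rw [Real.arccos_eq_pi] at h
        linarith)
    have hg : Continuous fun r : ℝ => f (Real.cos (Real.pi * r)) := by fun_prop
    have hx : f (Real.cos (Real.pi * (Real.arccos c / Real.pi))) = x := by
      rw [mul_div_cancel₀ _ Real.pi_ne_zero, Real.cos_arccos hc1.le hc2.le, hfc]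
    rw [← hx]
    refine map_mem_closure (f := fun r : ℝ => f (Real.cos (Real.pi * r))) hg hr ?_
    rintro _ ⟨K, i, hi, hiK, rfl⟩
    obtain ⟨h1, h2⟩ := hf' (Real.cos (Real.pi * (i / (K + 1))))
    have hK : (0 : ℝ) < K + 1 := by positivity
    refine Caterpillar.rootedEigenspace_ne_bot (K := K) (m := m) (by omega) ?_ h1 h2 ?_
    · rw [show ((K : ℝ) + 1) * (Real.pi * (i / (K + 1))) = i * Real.pi by field_simp]
      exact Real.sin_nat_mul_pi i
    · refine (Real.sin_pos_of_pos_of_lt_pi (by positivity) ?_).ne'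
      have : (i : ℝ) / (K + 1) < 1 := by
        rw [div_lt_one hK]
        have : (i : ℝ) ≤ K := by exact_mod_cast hiK
        linarith
      nlinarith [Real.pi_pos]
  by_cases hx : |x| < 1
  · rw [abs_lt] at hx
    exact main 0 (x / 2) (fun c => 2 * c) (by linarith) (by linarith) (by fun_prop) (by ring)
      fun c' => by simp
  · have hx1 : 1 ≤ x ^ 2 := by
      rw [← sq_abs]; nlinarith [abs_nonneg x]
    have hx0 : x ≠ 0 := by
      rintro rfl; norm_num at hx1
    -- With this `m`, `x ^ 2 - m` lies in `[0, 1)` and `|x| ≥ 1`, so solving `x = 2 * c + m / x` for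
    -- `c` gives `|c| < 1`.
    set m := ⌊x ^ 2⌋₊ with hm
    have hm1 : (m : ℝ) ≤ x ^ 2 := Nat.floor_le (by positivity)
    have hm2 : x ^ 2 < m + 1 := Nat.lt_floor_add_one _
    have hm0 : (0 : ℝ) < m := by linarith
    set c := (x - m / x) / 2 with hc
    have hcx : 2 * c * x = x ^ 2 - m := by rw [hc]; field_simp
    have hcabs : |c| < 1 := by
      have h1 : |2 * c * x| < 1 := by rw [hcx, abs_lt]; constructor <;> linarith
      rw [abs_mul, abs_mul, abs_two] at h1
      nlinarith [abs_nonneg c]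
    rw [abs_lt] at hcabs
    -- The sign `σ` selects the branch of the quadratic equation on which `x` lies.
    have key : ∀ σ : ℝ, σ * σ = 1 → σ * √(c ^ 2 + m) = x - c →
        x ∈ closure {γ : ℝ | ∃ s : UTree, s.rep.rootedEigenspace γ ≠ ⊥} := by
      intro σ hσ hσx
      refine main m c (fun c' => c' + σ * √(c' ^ 2 + m)) hcabs.1 hcabs.2 (by fun_prop)
        (by rw [hσx]; ring) fun c' => ?_
      have hsq : (√(c' ^ 2 + m)) ^ 2 = c' ^ 2 + m := Real.sq_sqrt (by positivity)
      have hq : (c' + σ * √(c' ^ 2 + m)) * ((c' + σ * √(c' ^ 2 + m)) - 2 * c') = m := by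
        have : (c' + σ * √(c' ^ 2 + m)) * ((c' + σ * √(c' ^ 2 + m)) - 2 * c') =
          σ * σ * (√(c' ^ 2 + m)) ^ 2 - c' ^ 2 := by ring
        rw [this, hσ, hsq]; ring
      have hne : c' + σ * √(c' ^ 2 + m) ≠ 0 := by
        intro h
        rw [h, zero_mul] at hq
        linarith
      refine ⟨fun _ => hne, ?_⟩
      have h3 := eq_div_of_mul_eq hne ((mul_comm _ _).trans hq)
      rw [← h3]
      ring
    have hsq : c ^ 2 + m = (x - c) ^ 2 := by nlinarith
    rw [hsq, Real.sqrt_sq_eq_abs] at key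
    rcases le_total 0 (x - c) with h | h
    · exact key 1 (by norm_num) (by rw [abs_of_nonneg h, one_mul])
    · exact key (-1) (by norm_num) (by rw [abs_of_nonpos h]; ring)


/-! ### Adding a leaf to a tree -/

namespace RTree

variable {V W : Type*}

/-- If `s` sits inside `t` as a set of vertices that is closed under taking parents, then the
fringe subtrees that do not leave `s` are the same. -/
theorem below_map_iff {s : RTree W} {t : RTree V} (ι : W → V) (hι : Function.Injective ι)
    (hpar : ∀ w, t.par (ι w) = ι (s.par w)) (u w : W) :
    t.Below (ι u) (ι w) ↔ s.Below u w := by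
  have : ∀ k, t.par^[k] (ι w) = ι (s.par^[k] w) := by
    intro k
    induction k with
    | zero => rfl
    | succ k ih => rw [Function.iterate_succ_apply', Function.iterate_succ_apply', ih, hpar]
  simp only [Below, this, hι.eq_iff]

theorem fringe_map [Finite V] [Finite W] {s : RTree W} {t : RTree V} (ι : W → V)
    (hι : Function.Injective ι) (hpar : ∀ w, t.par (ι w) = ι (s.par w)) (u : W)
    (hu : ∀ z, t.Below (ι u) z → z ∈ Set.range ι) : t.fringe (ι u) = s.fringe u := by
  classical
  rw [← unlabel_sub, ← unlabel_sub, unlabel_eq_iff]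
  refine Isomorphic.symm (isomorphic_iff.mpr ?_)
  let f : {w // s.Below u w} → {z // t.Below (ι u) z} :=
    fun w => ⟨ι w.1, (below_map_iff ι hι hpar _ _).mpr w.2⟩
  have hf : Function.Bijective f := by
    constructor
    · intro a b h
      exact Subtype.ext (hι (congrArg Subtype.val h))
    · rintro ⟨z, hz⟩
      obtain ⟨w, rfl⟩ := hu z hz
      exact ⟨⟨w, (below_map_iff ι hι hpar _ _).mp hz⟩, rfl⟩
  refine ⟨Equiv.ofBijective f hf, fun w => ?_⟩
  apply Subtype.ext
  rw [par_sub]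
  change ι ((s.sub u).par w).1 = if ι w.1 = ι u then ι u else t.par (ι w.1)
  rw [par_sub, hpar]
  simp only [hι.eq_iff]
  split_ifs <;> rfl

/-- The tree obtained by adding a new leaf below `x`. -/
def grow [Finite W] (s : RTree W) (x : W) : RTree (Option W) :=
  ofParent (some s.root) (fun z => z.elim (some x) fun w => some (s.par w))
    (fun z => z.elim (s.height x + 1) s.height) (by
      intro z hz
      match z with
      | none => exact Nat.lt_succ_self _
      | some w =>
        have := s.height_par (v := w) (fun h => hz (congrArg some h))
        change s.height (s.par w) < s.height w
        omega)

theorem par_grow_none [Finite W] (s : RTree W) (x : W) : (s.grow x).par none = some x := by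
  rw [grow, par_ofParent _ _ _ _ (by simp [par_root])]
  rfl

theorem par_grow_some [Finite W] (s : RTree W) (x w : W) :
    (s.grow x).par (some w) = some (s.par w) := by
  rw [grow, par_ofParent _ _ _ _ (by simp [par_root])]
  rfl

theorem grow_isomorphic [Finite V] [Finite W] {s : RTree V} {t : RTree W} (e : V ≃ W)
    (he : ∀ v, e (s.par v) = t.par (e v)) (x : V) : (s.grow x).Isomorphic (t.grow (e x)) := by
  refine isomorphic_iff.mpr ⟨Equiv.optionCongr e, fun z => ?_⟩
  match z with
  | none => simp [par_grow_none]
  | some v => simp [par_grow_some, he]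

theorem size_grow [Finite W] (s : RTree W) (x : W) :
    (s.grow x).unlabel.size = s.unlabel.size + 1 := by
  rw [size_unlabel, size_unlabel, Finite.card_option]

theorem par_attach {m : ℕ} (t : RTree (Fin m)) (v : Fin m) :
    (t.attach v).par = Fin.lastCases v.castSucc fun w => (t.par w).castSucc := by
  refine par_eq_of _ _ (Fin.lastCases (t.height v + 1) t.height) ?_ ?_ ?_
  · simp [attach, par_root]
  · intro z hz
    refine Fin.lastCases ?_ (fun w hw => ?_) z hz
    · intro _
      refine Or.inr ?_
      simp only [Fin.lastCases_last]
      rw [SimpleGraph.edge_adj]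
      exact ⟨Or.inr ⟨rfl, rfl⟩, (Fin.castSucc_lt_last v).ne'⟩
    · refine Or.inl ?_
      simp only [Fin.lastCases_castSucc]
      have hw' : w ≠ t.root := fun h => hw (by rw [h]; rfl)
      exact (SimpleGraph.map_adj _ _ _ _).mpr ⟨_, _, t.adj_par hw', rfl, rfl⟩
  · intro z hz
    refine Fin.lastCases ?_ (fun w hw => ?_) z hz
    · intro _
      simp
    · simp only [Fin.lastCases_castSucc]
      have := t.height_par (v := w) (fun h => hw (by rw [h]; rfl))
      omega

theorem par_attach_last {m : ℕ} (t : RTree (Fin m)) (v : Fin m) :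
    (t.attach v).par (Fin.last m) = v.castSucc := by
  rw [par_attach]
  exact Fin.lastCases_last

theorem par_attach_castSucc {m : ℕ} (t : RTree (Fin m)) (v w : Fin m) :
    (t.attach v).par w.castSucc = (t.par w).castSucc := by
  rw [par_attach]
  exact Fin.lastCases_castSucc _

theorem below_attach_castSucc {m : ℕ} (t : RTree (Fin m)) (v u w : Fin m) :
    (t.attach v).Below u.castSucc w.castSucc ↔ t.Below u w :=
  below_map_iff Fin.castSucc (Fin.castSucc_injective m) (par_attach_castSucc t v) u w

theorem below_attach_last {m : ℕ} (t : RTree (Fin m)) (v u : Fin m) :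
    (t.attach v).Below u.castSucc (Fin.last m) ↔ t.Below u v := by
  rw [← below_attach_castSucc t v, ← par_attach_last t v]
  exact ⟨fun h => below_par_of_ne h (Fin.castSucc_lt_last u).ne', fun h => h.trans (below_par _ _)⟩

theorem not_below_attach_last {m : ℕ} (t : RTree (Fin m)) (v w : Fin m) :
    ¬ (t.attach v).Below (Fin.last m) w.castSucc := by
  rintro ⟨k, hk⟩
  have : ∀ k, (t.attach v).par^[k] w.castSucc = (t.par^[k] w).castSucc := by
    intro k
    induction k with
    | zero => rfl
    | succ k ih =>
      rw [Function.iterate_succ_apply', Function.iterate_succ_apply', ih, par_attach_castSucc]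
  rw [this] at hk
  exact (Fin.castSucc_lt_last _).ne hk

theorem unlabel_eq_single [Finite V] (t : RTree V) (h : Nat.card V = 1) :
    t.unlabel = single.unlabel := by
  rw [unlabel_eq_iff, isomorphic_iff]
  have e : V ≃ Fin 1 := Finite.equivFinOfCardEq h
  exact ⟨e, fun v => Subsingleton.elim _ _⟩

theorem fringe_attach_last {m : ℕ} (t : RTree (Fin m)) (v : Fin m) :
    (t.attach v).fringe (Fin.last m) = single.unlabel := by
  rw [← unlabel_sub]
  refine unlabel_eq_single _ ?_
  rw [Nat.card_eq_one_iff_unique]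
  refine ⟨⟨?_⟩, ⟨⟨_, Below.refl _ _⟩⟩⟩
  have key : ∀ z, (t.attach v).Below (Fin.last m) z → z = Fin.last m := by
    intro z
    refine Fin.lastCases (fun _ => rfl) (fun w hw => ?_) z
    exact absurd hw (not_below_attach_last t v w)
  rintro ⟨a, ha⟩ ⟨b, hb⟩
  exact Subtype.ext ((key a ha).trans (key b hb).symm)

theorem fringe_attach_of_not_below {m : ℕ} (t : RTree (Fin m)) (v u : Fin m)
    (h : ¬ t.Below u v) : (t.attach v).fringe u.castSucc = t.fringe u := by
  refine fringe_map Fin.castSucc (Fin.castSucc_injective m) (par_attach_castSucc t v) u ?_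
  intro z
  refine Fin.lastCases (fun hz => ?_) (fun w _ => ⟨w, rfl⟩) z
  exact absurd ((below_attach_last t v u).mp hz) h

theorem fringe_attach_of_below {m : ℕ} (t : RTree (Fin m)) (v u : Fin m) (h : t.Below u v) :
    (t.attach v).fringe u.castSucc = ((t.sub u).grow ⟨v, h⟩).unlabel := by
  classical
  rw [← unlabel_sub, unlabel_eq_iff]
  refine Isomorphic.symm (isomorphic_iff.mpr ?_)
  let f : Option {w // t.Below u w} → {z // (t.attach v).Below u.castSucc z} :=
    fun z => z.elim ⟨Fin.last m, (below_attach_last t v u).mpr h⟩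
      fun w => ⟨w.1.castSucc, (below_attach_castSucc t v u w.1).mpr w.2⟩
  have hf : Function.Bijective f := by
    constructor
    · intro a b hab
      have h' := congrArg Subtype.val hab
      match a, b with
      | none, none => rfl
      | none, some b => exact absurd h'.symm (Fin.castSucc_lt_last _).ne
      | some a, none => exact absurd h' (Fin.castSucc_lt_last _).ne
      | some a, some b => exact congrArg some (Subtype.ext (Fin.castSucc_injective _ h'))
    · rintro ⟨z, hz⟩
      revert hz
      refine Fin.lastCases (fun hz => ⟨none, rfl⟩) (fun w hw => ?_) z
      exact ⟨some ⟨w, (below_attach_castSucc t v u w).mp hw⟩, rfl⟩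
  refine ⟨Equiv.ofBijective f hf, fun z => ?_⟩
  apply Subtype.ext
  rw [par_sub]
  match z with
  | none =>
    rw [par_grow_none]
    refine Eq.trans ?_ (if_neg (Fin.castSucc_lt_last u).ne').symm
    exact (par_attach_last t v).symm
  | some w =>
    rw [par_grow_some]
    change ((t.sub u).par w).1.castSucc = _
    rw [par_sub]
    by_cases hw : w.1 = u
    · rw [if_pos hw]
      exact (if_pos (congrArg Fin.castSucc hw)).symm
    · rw [if_neg hw]
      refine Eq.trans ?_ (if_neg fun h => hw (Fin.castSucc_injective _ h)).symm
      exact (par_attach_castSucc t v w.1).symm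

/-! ### Fringe sums, out-degrees and removable leaves. -/

/-- The sum of `g` over the fringe subtrees. -/
def fringeSum [Fintype V] (t : RTree V) (g : UTree → ℝ) : ℝ := ∑ v, g (t.fringe v)

-- A leaf attached at `v` creates one single-vertex fringe subtree and alters precisely the fringe
-- subtrees of `v` and its ancestors, each of which gains the same leaf.
open scoped Classical in
theorem fringeSum_attach {m : ℕ} (t : RTree (Fin m)) (v : Fin m) (g : UTree → ℝ) :
    (t.attach v).fringeSum g = g single.unlabel + t.fringeSum g +
      ∑ u, if h : t.Below u v then g ((t.sub u).grow ⟨v, h⟩).unlabel - g (t.fringe u) else 0 := by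
  rw [fringeSum, Fin.sum_univ_castSucc, fringe_attach_last, fringeSum, add_comm, add_assoc,
    ← Finset.sum_add_distrib]
  congr 1
  refine Finset.sum_congr rfl fun u _ => ?_
  split_ifs with h
  · rw [fringe_attach_of_below t v u h]
    ring
  · rw [fringe_attach_of_not_below t v u h, add_zero]

/-- The number of children of a vertex. -/
def outDegree [Fintype V] (t : RTree V) (v : V) : ℕ := (t.childFinset v).card

theorem ncard_children [Fintype V] (t : RTree V) (v : V) :
    (t.children v).ncard = t.outDegree v := by
  rw [outDegree, ← Set.ncard_coe_finset]
  congr 1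
  ext w
  rw [mem_children_iff, Finset.mem_coe, mem_childFinset]

theorem outDegree_of_par [Fintype V] [Fintype W] {s : RTree V} {t : RTree W} (e : V ≃ W)
    (he : ∀ v, e (s.par v) = t.par (e v)) (v : V) : t.outDegree (e v) = s.outDegree v := by
  rw [outDegree, childFinset_of_par e he, Finset.card_map, outDegree]

theorem outDegree_sub [Fintype V] (t : RTree V) (v : V) [Fintype {w // t.Below v w}]
    (u : {w // t.Below v w}) : (t.sub v).outDegree u = t.outDegree u.1 := by
  rw [outDegree, outDegree, ← childFinset_sub, Finset.card_map]

theorem sum_outDegree [Fintype V] (t : RTree V) :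
    ∑ v, (t.outDegree v : ℝ) = Fintype.card V - 1 := by
  classical
  have h : ∑ v, t.outDegree v = (Finset.univ.erase t.root).card := by
    rw [Finset.card_eq_sum_card_fiberwise (f := t.par) (t := Finset.univ) (by simp)]
    refine Finset.sum_congr rfl fun v _ => ?_
    rw [outDegree]
    congr 1
    ext c
    simp [mem_childFinset]
  have hpos : 0 < Fintype.card V := Fintype.card_pos_iff.mpr ⟨t.root⟩
  rw [← Nat.cast_sum, h, Finset.card_erase_of_mem (Finset.mem_univ _), Finset.card_univ,
    Nat.cast_sub hpos, Nat.cast_one]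

/-- Every tree with more than one vertex has a leaf that can be removed. -/
theorem exists_grow [Finite V] (t : RTree V) (h : 1 < Nat.card V) :
    ∃ (v : V) (s : RTree {w // w ≠ v}) (x : {w // w ≠ v}), t.unlabel = (s.grow x).unlabel := by
  classical
  have : Nonempty V := ⟨t.root⟩
  -- A vertex of maximal height has no children, so removing it leaves a tree.
  obtain ⟨v, hv⟩ := Finite.exists_max t.height
  have hvr : v ≠ t.root := by
    rintro rfl
    have hs : Subsingleton V := by
      refine ⟨fun a b => ?_⟩
      have key : ∀ c, c = t.root := by
        intro c
        by_contra hc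
        have h1 := hv c
        have h2 := t.height_par hc
        rw [t.height_root] at h1
        omega
      rw [key a, key b]
    have := Finite.card_le_one_iff_subsingleton.mpr hs
    omega
  have hpar : ∀ w, w ≠ t.root → t.par w ≠ v := by
    intro w hw h'
    have h1 := hv w
    have h2 := t.height_par hw
    rw [h'] at h2
    omega
  have hpar' : ∀ w, w ≠ v → t.par w ≠ v := by
    intro w hw
    by_cases hwr : w = t.root
    · rw [hwr, t.par_root]; exact hvr.symm
    · exact hpar w hwr
  let s : RTree {w // w ≠ v} := ofParent ⟨t.root, hvr.symm⟩
    (fun w => ⟨t.par w.1, hpar' w.1 w.2⟩) (fun w => t.height w.1) (by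
      intro w hw
      have := t.height_par (v := w.1) fun h' => hw (Subtype.ext h')
      dsimp only
      omega)
  have hs : s.par = fun w => ⟨t.par w.1, hpar' w.1 w.2⟩ :=
    par_ofParent _ _ _ _ (Subtype.ext t.par_root)
  refine ⟨v, s, ⟨t.par v, hpar v hvr⟩, ?_⟩
  refine (unlabel_eq_iff.mpr (isomorphic_iff.mpr ⟨Equiv.optionSubtypeNe v, fun z => ?_⟩)).symm
  match z with
  | none => simp [par_grow_none]
  | some w => simp [par_grow_some, hs]

end RTree


/-! ### Expectations of functions of finitely supported random variables -/

/-- The expectation of `φ` under a probability mass function on a finite type. -/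
def expect {α : Type*} [Fintype α] (p : PMF α) (φ : α → ℝ) : ℝ := ∑ a, (p a).toReal * φ a

section expect

variable {α β : Type*} [Fintype α] [Fintype β]

theorem sum_toReal (p : PMF α) : ∑ a, (p a).toReal = 1 := by
  rw [← ENNReal.toReal_sum fun a _ => p.apply_ne_top a, ← tsum_fintype (L := .unconditional _),
    p.tsum_coe, ENNReal.toReal_one]

theorem expect_const (p : PMF α) (c : ℝ) : expect p (fun _ => c) = c := by
  rw [expect, ← Finset.sum_mul, sum_toReal, one_mul]

theorem expect_add (p : PMF α) (φ ψ : α → ℝ) :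
    expect p (fun a => φ a + ψ a) = expect p φ + expect p ψ := by
  simp only [expect, mul_add, Finset.sum_add_distrib]

theorem expect_const_mul (p : PMF α) (c : ℝ) (φ : α → ℝ) :
    expect p (fun a => c * φ a) = c * expect p φ := by
  simp only [expect, Finset.mul_sum]
  exact Finset.sum_congr rfl fun a _ => by ring

theorem expect_mono (p : PMF α) {φ ψ : α → ℝ} (h : ∀ a, φ a ≤ ψ a) : expect p φ ≤ expect p ψ :=
  Finset.sum_le_sum fun a _ => mul_le_mul_of_nonneg_left (h a) ENNReal.toReal_nonneg

theorem expect_nonneg (p : PMF α) {φ : α → ℝ} (h : ∀ a, 0 ≤ φ a) : 0 ≤ expect p φ :=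
  Finset.sum_nonneg fun a _ => mul_nonneg ENNReal.toReal_nonneg (h a)

theorem expect_bind (p : PMF α) (f : α → PMF β) (φ : β → ℝ) :
    expect (p.bind f) φ = expect p fun a => expect (f a) φ := by
  have : ∀ b, (p.bind f b).toReal = ∑ a, (p a).toReal * (f a b).toReal := by
    intro b
    rw [PMF.bind_apply, tsum_fintype, ENNReal.toReal_sum fun a _ =>
      ENNReal.mul_ne_top (p.apply_ne_top a) ((f a).apply_ne_top b)]
    simp only [ENNReal.toReal_mul]
  simp only [expect, this, Finset.sum_mul, Finset.mul_sum]
  rw [Finset.sum_comm]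
  exact Finset.sum_congr rfl fun a _ => Finset.sum_congr rfl fun b _ => mul_assoc _ _ _

theorem expect_pure (a : α) (φ : α → ℝ) : expect (PMF.pure a) φ = φ a := by
  classical
  rw [expect, Finset.sum_eq_single a]
  · simp
  · intro b _ hb
    simp [PMF.pure_apply, hb]
  · simp

theorem expect_map (p : PMF α) (f : α → β) (φ : β → ℝ) :
    expect (p.map f) φ = expect p fun a => φ (f a) := by
  rw [PMF.map, expect_bind]
  exact congrArg (expect p) (funext fun a => expect_pure (f a) φ)

theorem expect_normalize (f : α → ℝ) (hf : ∀ a, 0 ≤ f a) (h0 h1) (φ : α → ℝ) :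
    expect (PMF.normalize (fun a => ENNReal.ofReal (f a)) h0 h1) φ =
      (∑ a, f a * φ a) / ∑ a, f a := by
  rw [expect, Finset.sum_div]
  refine Finset.sum_congr rfl fun a _ => ?_
  rw [PMF.normalize_apply, tsum_fintype, ENNReal.toReal_mul, ENNReal.toReal_ofReal (hf a),
    ENNReal.toReal_inv, ← ENNReal.ofReal_sum_of_nonneg fun a _ => hf a,
    ENNReal.toReal_ofReal (Finset.sum_nonneg fun a _ => hf a)]
  ring

/-- Nonnegativity of the variance of `|φ|`. -/
theorem sq_expect_abs_le (p : PMF α) (φ : α → ℝ) :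
    expect p (fun a => |φ a|) ^ 2 ≤ expect p fun a => φ a ^ 2 := by
  have h : 0 ≤ expect p fun a => (|φ a| - expect p fun a => |φ a|) ^ 2 :=
    expect_nonneg p fun a => sq_nonneg _
  set c := expect p fun a => |φ a| with hc
  have h2 : (expect p fun a => (|φ a| - c) ^ 2) =
      (expect p fun a => φ a ^ 2) + (-(2 * c) * c + c ^ 2) := by
    conv_rhs => rw [← expect_const p (c ^ 2)]
    nth_rewrite 4 [hc]
    rw [← expect_const_mul, ← expect_add, ← expect_add]
    refine congrArg (expect p) (funext fun a => ?_)
    rw [← sq_abs (φ a)]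
    ring
  rw [h2] at h
  linarith

/-- Chebyshev's inequality. -/
theorem toMeasure_le_expect [MeasurableSpace α] [MeasurableSingletonClass α] (p : PMF α)
    (φ : α → ℝ) {ε : ℝ} (hε : 0 < ε) :
    p.toMeasure {a | ε ≤ |φ a|} ≤ ENNReal.ofReal ((expect p fun a => φ a ^ 2) / ε ^ 2) := by
  classical
  rw [PMF.toMeasure_apply_fintype, expect, Finset.sum_div,
    ENNReal.ofReal_sum_of_nonneg fun a _ => by positivity]
  refine Finset.sum_le_sum fun a _ => ?_
  by_cases h : ε ≤ |φ a|
  · rw [Set.indicator_of_mem (show a ∈ {a | ε ≤ |φ a|} from h)]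
    refine ENNReal.le_ofReal_iff_toReal_le (p.apply_ne_top a) (by positivity) |>.mpr ?_
    rw [le_div_iff₀ (by positivity)]
    refine mul_le_mul_of_nonneg_left ?_ ENNReal.toReal_nonneg
    rw [← sq_abs (φ a)]
    exact pow_le_pow_left₀ hε.le h 2
  · rw [Set.indicator_of_notMem (show a ∉ {a | ε ≤ |φ a|} from h)]
    exact zero_le

end expect

/-! ### A second moment criterion -/

instance {V : Type*} [Finite V] : Fintype (RTree V) := Fintype.ofFinite _

instance {V : Type*} [Finite V] : MeasurableSingletonClass (RTree V) :=
  ⟨fun _ => MeasurableSpace.measurableSet_top⟩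

theorem exists_unlabel_eq {k : ℕ} {s : UTree} (hs : s.size = k) :
    ∃ t : RTree (Fin k), t.unlabel = s := by
  subst hs
  exact ⟨s.rep, RTree.unlabel_rep s⟩

instance (k : ℕ) : Finite {s : UTree // s.size = k} :=
  Finite.of_surjective
    (fun t : RTree (Fin k) => (⟨t.unlabel, by rw [RTree.size_unlabel, Nat.card_fin]⟩ :
      {s : UTree // s.size = k})) fun ⟨s, hs⟩ => by
    obtain ⟨t, ht⟩ := exists_unlabel_eq hs
    exact ⟨t, Subtype.ext ht⟩

instance (k : ℕ) : Fintype {s : UTree // s.size = k} := Fintype.ofFinite _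

theorem hasSum_of_sum_size {p : UTree → ℝ} (hp : ∀ s, 0 ≤ p s) {P : ℕ → ℝ} {a : ℝ}
    (h : ∀ k, ∑ s : {s : UTree // s.size = k}, p s = P k) (hP : HasSum P a) : HasSum p a := by
  rw [← (Equiv.sigmaFiberEquiv UTree.size).hasSum_iff]
  have h1 : ∀ k, HasSum (fun s : {s : UTree // s.size = k} => p s) (P k) := fun k =>
    h k ▸ hasSum_fintype _
  have h2 : Summable (p ∘ Equiv.sigmaFiberEquiv UTree.size) := by
    refine (summable_sigma_of_nonneg fun _ => hp _).mpr ⟨fun k => (h1 k).summable, ?_⟩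
    refine hP.summable.congr fun k => ?_
    exact ((h1 k).tsum_eq).symm
  exact HasSum.sigma_of_hasSum hP h1 h2

theorem exists_probabilityMeasure_of_hasSum {p : UTree → ℝ} (hp : ∀ s, 0 ≤ p s)
    (h : HasSum p 1) : ∃ ρ : ProbabilityMeasure UTree, ∀ s, (ρ : Measure UTree).real {s} = p s := by
  have h1 : HasSum (fun s => ENNReal.ofReal (p s)) 1 := by
    have := ENNReal.ofReal_tsum_of_nonneg hp h.summable
    rw [h.tsum_eq, ENNReal.ofReal_one] at this
    rw [this]
    exact ENNReal.summable.hasSum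
  let q : PMF UTree := ⟨_, h1⟩
  refine ⟨⟨q.toMeasure, inferInstance⟩, fun s => ?_⟩
  change ENNReal.toReal (q.toMeasure {s}) = p s
  rw [PMF.toMeasure_apply_singleton _ _ MeasurableSpace.measurableSet_top]
  exact ENNReal.toReal_ofReal (hp s)

/-- Total mass one makes `p` a genuine law on finite trees, so no fringe subtrees of unbounded size
carry mass in the limit; Chebyshev turns the mean-square bound into convergence in probability. -/
theorem hasDenseAtomsInLimit_of_expect (μ : ∀ n : ℕ, PMF (RTree (Fin (n + 1)))) {p : UTree → ℝ}
    (hp : ∀ s, 0 < p s) {P : ℕ → ℝ} (hsum : ∀ k, ∑ s : {s : UTree // s.size = k}, p s = P k)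
    (hP : HasSum P 1)
    (hlim : ∀ s, Tendsto (fun n : ℕ => (expect (μ n) fun t =>
      (t.fringeSum (Set.indicator {s} 1) - (n + 1) * p s) ^ 2) / ((n : ℝ) + 1) ^ 2)
      atTop (𝓝 0)) : HasDenseAtomsInLimit μ := by
  obtain ⟨ρ, hρ⟩ := exists_probabilityMeasure_of_hasSum (fun s => (hp s).le)
    (hasSum_of_sum_size (fun s => (hp s).le) hsum hP)
  refine hasDenseAtomsInLimit_of_tendsto μ ρ (fun s => hρ s ▸ hp s) (fun s ε hε => ?_)
    dense_rootedEigenspace_ne_bot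
  have key : ∀ n : ℕ, (μ n).toMeasure {t | ε ≤ |t.unlabel.fringeAvg (Set.indicator {s} 1) -
      (ρ : Measure UTree).real {s}|} ≤ ENNReal.ofReal (((expect (μ n) fun t =>
      (t.fringeSum (Set.indicator {s} 1) - (n + 1) * p s) ^ 2) / ((n : ℝ) + 1) ^ 2) / ε ^ 2) := by
    intro n
    refine (toMeasure_le_expect _ _ hε).trans (le_of_eq ?_)
    congr 2
    rw [div_eq_inv_mul _ (((n : ℝ) + 1) ^ 2), ← expect_const_mul]
    refine congrArg (expect (μ n)) (funext fun t => ?_)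
    rw [RTree.fringeAvg_unlabel, hρ, Fintype.card_fin, RTree.fringeSum]
    have : (n : ℝ) + 1 ≠ 0 := by positivity
    push_cast
    field_simp
  refine tendsto_of_tendsto_of_tendsto_of_le_of_le tendsto_const_nhds ?_ (fun n => zero_le) key
  have := ENNReal.tendsto_ofReal ((hlim s).div_const (ε ^ 2))
  rwa [zero_div, ENNReal.ofReal_zero] at this

/-- Iteration bounds `e n` by `e 0 + (n + 1) * ∑ |b j|`, and the Cesàro means of `|b j|` tend to
zero. -/
theorem tendsto_div_sq_of_le_add {e b : ℕ → ℝ} (he : ∀ n, 0 ≤ e n) (hb : Tendsto b atTop (𝓝 0))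
    (h : ∀ n, e (n + 1) ≤ e n + b n * (n + 1)) :
    Tendsto (fun n => e n / ((n : ℝ) + 1) ^ 2) atTop (𝓝 0) := by
  have h1 : ∀ n : ℕ, e n ≤ e 0 + (n + 1) * ∑ j ∈ Finset.range n, |b j| := by
    intro n
    induction n with
    | zero => simp
    | succ n ih =>
      have hs : 0 ≤ ∑ j ∈ Finset.range n, |b j| := Finset.sum_nonneg fun _ _ => abs_nonneg _
      have h2 : b n * (n + 1) ≤ |b n| * (n + 2) :=
        (mul_le_mul_of_nonneg_right (le_abs_self _) (by positivity)).trans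
          (mul_le_mul_of_nonneg_left (by linarith) (abs_nonneg _))
      rw [Finset.sum_range_succ]
      push_cast
      linarith [h n]
  have h2 : Tendsto (fun n : ℕ => (n : ℝ)⁻¹ * ∑ j ∈ Finset.range n, |b j|) atTop (𝓝 0) := by
    have := hb.abs
    rw [abs_zero] at this
    exact this.cesaro
  have h3 : Tendsto (fun n : ℕ => e 0 * (1 / ((n : ℝ) + 1)) +
      (n : ℝ)⁻¹ * ∑ j ∈ Finset.range n, |b j|) atTop (𝓝 0) := by
    simpa using (tendsto_one_div_add_atTop_nhds_zero_nat.const_mul (e 0)).add h2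
  refine tendsto_of_tendsto_of_tendsto_of_le_of_le' tendsto_const_nhds h3
    (Eventually.of_forall fun n => div_nonneg (he n) (by positivity)) ?_
  filter_upwards [eventually_ge_atTop 1] with n hn
  have hn' : (1 : ℝ) ≤ n := by exact_mod_cast hn
  have hs : 0 ≤ ∑ j ∈ Finset.range n, |b j| := Finset.sum_nonneg fun _ _ => abs_nonneg _
  calc e n / ((n : ℝ) + 1) ^ 2
      ≤ (e 0 + (n + 1) * ∑ j ∈ Finset.range n, |b j|) / ((n : ℝ) + 1) ^ 2 := by
        gcongr
        exact h1 n
    _ = e 0 * (1 / ((n : ℝ) + 1)) * (1 / ((n : ℝ) + 1)) +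
        ((n : ℝ) + 1)⁻¹ * ∑ j ∈ Finset.range n, |b j| := by
        field_simp
    _ ≤ e 0 * (1 / ((n : ℝ) + 1)) + (n : ℝ)⁻¹ * ∑ j ∈ Finset.range n, |b j| := by
        refine add_le_add ?_ ?_
        · refine mul_le_of_le_one_right (mul_nonneg (he 0) (by positivity)) ?_
          rw [div_le_one (by positivity)]
          linarith
        · gcongr
          linarith


/-! ### Growing trees -/

/-- The sum of `w (D x) * g (t.grow x)` over the vertices `x` of the tree `t`. -/
def UTree.growSum (w : ℕ → ℝ) : (UTree → ℝ) →ₗ[ℝ] (UTree → ℝ) where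
  toFun g T := ∑ x, w (T.rep.outDegree x) * g (T.rep.grow x).unlabel
  map_add' f g := by
    funext T
    simp only [Pi.add_apply, mul_add, Finset.sum_add_distrib]
  map_smul' c g := by
    funext T
    simp only [Pi.smul_apply, smul_eq_mul, RingHom.id_apply, Finset.mul_sum]
    exact Finset.sum_congr rfl fun x _ => by ring

theorem UTree.growSum_apply (w : ℕ → ℝ) (g : UTree → ℝ) (T : UTree) :
    UTree.growSum w g T = ∑ x, w (T.rep.outDegree x) * g (T.rep.grow x).unlabel := rfl

namespace RTree

variable {V W : Type*}

theorem growSum_unlabel [Fintype V] (w : ℕ → ℝ) (g : UTree → ℝ) (t : RTree V) :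
    UTree.growSum w g t.unlabel = ∑ x, w (t.outDegree x) * g (t.grow x).unlabel := by
  obtain ⟨e, he⟩ := isomorphic_iff.mp (rep_unlabel_isomorphic t)
  rw [UTree.growSum_apply]
  refine Fintype.sum_equiv e _ _ fun x => ?_
  rw [outDegree_of_par e he, unlabel_eq_iff.mpr (grow_isomorphic e he x)]

theorem sum_weight [Fintype V] (t : RTree V) (a b : ℝ) :
    ∑ v, (a * t.outDegree v + b) = (a + b) * Fintype.card V - a := by
  rw [Finset.sum_add_distrib, ← Finset.mul_sum, sum_outDegree]
  simp only [Finset.sum_const, Finset.card_univ, nsmul_eq_mul]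
  ring

/-- The unnormalized conditional expectation after one growth step. For affine weights the total
weight of a subtree depends only on its size, so the drift is again a fringe sum. -/
theorem sum_fringeSum_attach {m : ℕ} (t : RTree (Fin m)) (a b : ℝ) (g : UTree → ℝ) :
    ∑ v, (a * t.outDegree v + b) * (t.attach v).fringeSum g =
      ((a + b) * m - a) * (g single.unlabel + t.fringeSum g) +
        ∑ u, (UTree.growSum (fun d => a * d + b) g (t.fringe u) -
          ((a + b) * (t.fringe u).size - a) * g (t.fringe u)) := by
  classical
  have hw := t.sum_weight a b
  rw [Fintype.card_fin] at hw
  rw [← hw, Finset.sum_mul]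
  simp only [fringeSum_attach, mul_add, Finset.sum_add_distrib, Finset.mul_sum]
  congr 1
  rw [Finset.sum_comm]
  refine Finset.sum_congr rfl fun u _ => ?_
  have h1 : UTree.growSum (fun d => a * d + b) g (t.fringe u) =
      ∑ x : {x // t.Below u x}, (a * t.outDegree x.1 + b) * g ((t.sub u).grow x).unlabel := by
    rw [← unlabel_sub, growSum_unlabel]
    exact Finset.sum_congr rfl fun x _ => by rw [outDegree_sub]
  have h2 : (a + b) * (t.fringe u).size - a =
      ∑ x : {x // t.Below u x}, (a * t.outDegree x.1 + b) := by
    rw [← unlabel_sub, size_unlabel, Nat.card_eq_fintype_card, ← sum_weight]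
    exact Finset.sum_congr rfl fun x _ => by rw [outDegree_sub]
  rw [h1, h2, Finset.sum_mul, ← Finset.sum_sub_distrib]
  rw [← Finset.sum_filter_of_ne (p := fun v => t.Below u v), Finset.sum_subtype
    (p := fun v => t.Below u v) _ (by simp)]
  · refine Finset.sum_congr rfl fun x _ => ?_
    rw [dif_pos x.2]
    ring
  · intro v _ hv
    by_contra h
    exact hv (by rw [dif_neg h, mul_zero])

theorem _root_.RandomTreeSpectra.abs_sum_le_of_unique {ι : Type*} [Fintype ι] {f : ι → ℝ} {C : ℝ}
    (hC : 0 ≤ C) (hf : ∀ i, |f i| ≤ C) (h : ∀ i j, f i ≠ 0 → f j ≠ 0 → i = j) :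
    |∑ i, f i| ≤ C := by
  by_cases h0 : ∃ i, f i ≠ 0
  · obtain ⟨i, hi⟩ := h0
    rw [Finset.sum_eq_single i]
    · exact hf i
    · intro j _ hj
      by_contra h'
      exact hj (h j i h' hi)
    · simp
  · push Not at h0
    simpa [h0] using hC

/-- Along the path from `v` to the root the sizes are distinct, so at most one fringe subtree of
size `k` is lost and at most one is gained there. The new leaf accounts for the third `C`. -/
theorem abs_fringeSum_attach_sub_le {m : ℕ} (t : RTree (Fin m)) (v : Fin m) {g : UTree → ℝ}
    {k : ℕ} {C : ℝ} (hg : ∀ s, s.size ≠ k → g s = 0) (hC : ∀ s, |g s| ≤ C) :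
    |(t.attach v).fringeSum g - t.fringeSum g| ≤ 3 * C := by
  classical
  have hC0 : 0 ≤ C := (abs_nonneg _).trans (hC single.unlabel)
  have h1 : |∑ u, if h : t.Below u v then g ((t.sub u).grow ⟨v, h⟩).unlabel else 0| ≤ C := by
    refine abs_sum_le_of_unique hC0 (fun u => ?_) fun u u' hu hu' => ?_
    · split_ifs
      · exact hC _
      · simpa using hC0
    · by_cases hb : t.Below u v
      · by_cases hb' : t.Below u' v
        · rw [dif_pos hb] at hu
          rw [dif_pos hb'] at hu'
          have h1 := not_imp_comm.mp (hg _) hu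
          have h2 := not_imp_comm.mp (hg _) hu'
          rw [size_grow, unlabel_sub] at h1 h2
          exact eq_of_below_of_card hb hb' (by omega)
        · exact absurd (dif_neg hb') hu'
      · exact absurd (dif_neg hb) hu
  have h2 : |∑ u, if t.Below u v then g (t.fringe u) else 0| ≤ C := by
    refine abs_sum_le_of_unique hC0 (fun u => ?_) fun u u' hu hu' => ?_
    · split_ifs
      · exact hC _
      · simpa using hC0
    · by_cases hb : t.Below u v
      · by_cases hb' : t.Below u' v
        · rw [if_pos hb] at hu
          rw [if_pos hb'] at hu'
          have h1 := not_imp_comm.mp (hg _) hu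
          have h2 := not_imp_comm.mp (hg _) hu'
          exact eq_of_below_of_card hb hb' (by omega)
        · exact absurd (if_neg hb') hu'
      · exact absurd (if_neg hb) hu
  have h3 : (t.attach v).fringeSum g - t.fringeSum g = g single.unlabel +
      (∑ u, if h : t.Below u v then g ((t.sub u).grow ⟨v, h⟩).unlabel else 0) -
      ∑ u, if t.Below u v then g (t.fringe u) else 0 := by
    rw [fringeSum_attach, add_sub_assoc (g single.unlabel), ← Finset.sum_sub_distrib]
    have : ∀ u, (if h : t.Below u v then g ((t.sub u).grow ⟨v, h⟩).unlabel - g (t.fringe u)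
        else 0) = (if h : t.Below u v then g ((t.sub u).grow ⟨v, h⟩).unlabel else 0) -
        if t.Below u v then g (t.fringe u) else 0 := by
      intro u
      split_ifs <;> simp
    simp only [this]
    ring
  rw [h3]
  have h4 := abs_le.mp (hC single.unlabel)
  have h1 := abs_le.mp h1
  have h2 := abs_le.mp h2
  rw [abs_le]
  constructor <;> linarith

theorem abs_fringeSum_le [Fintype V] (t : RTree V) {g : UTree → ℝ} {C : ℝ}
    (hC : ∀ s, |g s| ≤ C) : |t.fringeSum g| ≤ Fintype.card V * C := by
  refine (Finset.abs_sum_le_sum_abs _ _).trans ((Finset.sum_le_sum fun v _ => hC _).trans ?_)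
  simp

end RTree

/-! ### Limiting fringe proportions in growing trees. -/

open RTree

/-- The limiting proportion of fringe subtrees: a linear functional on the functions that are
supported by trees of a given size. -/
def growthLimit (a b : ℝ) : ℕ → ((UTree → ℝ) →ₗ[ℝ] ℝ)
  | 0 => 0
  -- This balances the drift when fringe sums grow linearly. Total weight grows like `(a + b) * n`;
  -- new leaves contribute `(a + b) * g single`, growth from size `k` contributes the recursive
  -- term, and trees of size `k + 1` are destroyed at rate `(a + b) * (k + 1) - a`.
  | k + 1 => ((a + b) * (k + 2) - a)⁻¹ • ((a + b) • LinearMap.proj single.unlabel +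
      growthLimit a b k ∘ₗ UTree.growSum fun d => a * d + b)

section growth

variable {a b : ℝ}

theorem growSum_of_size {w : ℕ → ℝ} {g : UTree → ℝ} {k : ℕ} (hg : ∀ s, s.size ≠ k + 1 → g s = 0) :
    ∀ s, s.size ≠ k → UTree.growSum w g s = 0 := by
  intro s hs
  rw [UTree.growSum_apply]
  refine Finset.sum_eq_zero fun x _ => ?_
  rw [hg _ (by rw [size_grow, unlabel_rep]; omega), mul_zero]

theorem exists_bound_of_size {g : UTree → ℝ} {k : ℕ} (hg : ∀ s, s.size ≠ k → g s = 0) :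
    ∃ C, ∀ s, |g s| ≤ C := by
  refine ⟨∑ s : {s : UTree // s.size = k}, |g s|, fun s => ?_⟩
  by_cases hs : s.size = k
  · exact Finset.single_le_sum (f := fun s : {s : UTree // s.size = k} => |g s|)
      (fun _ _ => abs_nonneg _) (Finset.mem_univ (⟨s, hs⟩ : {s : UTree // s.size = k}))
  · rw [hg s hs, abs_zero]
    exact Finset.sum_nonneg fun _ _ => abs_nonneg _

/-- Expanding the square about the present error `Y` leaves `Y ^ 2`, a cross term with the drift,
and a bounded term from the increments. In the drift, `hpq` cancels everything of order `n`; what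
remains is `-W * Y` plus the error `Z` at size `k` plus a constant. -/
theorem sum_sq_fringeSum_attach_le (ha : 0 ≤ a) (hb : 0 < b) {g : UTree → ℝ} {k n : ℕ} {C p q : ℝ}
    (hg : ∀ s, s.size ≠ k + 1 → g s = 0) (hC : ∀ s, |g s| ≤ C)
    (hpq : ((a + b) * (k + 2) - a) * p = (a + b) * g single.unlabel + q)
    (t : RTree (Fin (n + 1))) :
    (∑ v, (a * t.outDegree v + b) * ((t.attach v).fringeSum g - (n + 2) * p) ^ 2) /
        ((a + b) * (n + 1) - a) ≤
      (t.fringeSum g - (n + 1) * p) ^ 2 + (2 * (C + |p|) / b *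
        |t.fringeSum (UTree.growSum (fun d => a * d + b) g) - (n + 1) * q| +
        (2 * (C + |p|) / b * |(p - g single.unlabel) * a| + (3 * C + |p|) ^ 2)) := by
  have hn : (0 : ℝ) ≤ n := n.cast_nonneg
  have hC0 : 0 ≤ C := (abs_nonneg _).trans (hC single.unlabel)
  set Y := t.fringeSum g - (n + 1) * p with hY
  set Z := t.fringeSum (UTree.growSum (fun d => a * d + b) g) - (n + 1) * q with hZ
  set D := (a + b) * ((n : ℝ) + 1) - a with hD
  set W := (a + b) * ((k : ℝ) + 1) - a with hW
  have hD0 : b * (n + 1) ≤ D := by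
    have := mul_nonneg ha hn
    rw [hD]; linarith
  have hDpos : 0 < D := lt_of_lt_of_le (by positivity) hD0
  have hW0 : 0 ≤ W := by
    have := mul_nonneg ha (k.cast_nonneg : (0 : ℝ) ≤ k)
    have := mul_nonneg hb.le (k.cast_nonneg : (0 : ℝ) ≤ k)
    rw [hW]; linarith
  have hsw : ∑ v, (a * t.outDegree v + b) = D := by
    rw [sum_weight, Fintype.card_fin]; push_cast; rfl
  have hw0 : ∀ v, 0 ≤ a * t.outDegree v + b := fun v => by positivity
  have hY0 : |Y| ≤ (n + 1) * (C + |p|) := by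
    have h1 := t.abs_fringeSum_le hC
    rw [Fintype.card_fin] at h1
    push_cast at h1
    have h2 : |((n : ℝ) + 1) * p| = (n + 1) * |p| := by
      rw [abs_mul, abs_of_nonneg (by positivity)]
    calc |Y| ≤ |t.fringeSum g| + |((n : ℝ) + 1) * p| := abs_sub _ _
      _ ≤ _ := by rw [h2]; linarith
  have hinc : ∀ v, |(t.attach v).fringeSum g - (n + 2) * p - Y| ≤ 3 * C + |p| := by
    intro v
    have : (t.attach v).fringeSum g - (n + 2) * p - Y =
        ((t.attach v).fringeSum g - t.fringeSum g) - p := by rw [hY]; ring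
    rw [this]
    exact (abs_sub _ _).trans (add_le_add_left (t.abs_fringeSum_attach_sub_le v hg hC) _)
  have hdrift : ∑ v, (a * t.outDegree v + b) * ((t.attach v).fringeSum g - (n + 2) * p - Y) =
      -W * Y + Z + (p - g single.unlabel) * a := by
    have h1 := t.sum_fringeSum_attach a b g
    have h2 : ∑ u, (UTree.growSum (fun d => a * d + b) g (t.fringe u) -
          ((a + b) * (t.fringe u).size - a) * g (t.fringe u)) =
        t.fringeSum (UTree.growSum (fun d => a * d + b) g) - W * t.fringeSum g := by
      rw [Finset.sum_sub_distrib]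
      congr 1
      rw [fringeSum, Finset.mul_sum]
      refine Finset.sum_congr rfl fun u _ => ?_
      by_cases hu : (t.fringe u).size = k + 1
      · rw [hu, hW]; push_cast; ring
      · rw [hg _ hu]; ring
    have h3 : ∑ v, (a * t.outDegree v + b) * ((t.attach v).fringeSum g - (n + 2) * p - Y) =
        ∑ v, (a * t.outDegree v + b) * (t.attach v).fringeSum g -
          D * ((n + 2) * p + Y) := by
      rw [← hsw, Finset.sum_mul, ← Finset.sum_sub_distrib]
      exact Finset.sum_congr rfl fun v _ => by ring
    rw [h3, h1, h2, hY, hZ, hW, hD]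
    push_cast
    have hq : q = ((a + b) * (k + 2) - a) * p - (a + b) * g single.unlabel := by linarith
    rw [hq]
    ring
  have hsum : ∑ v, (a * t.outDegree v + b) * ((t.attach v).fringeSum g - (n + 2) * p) ^ 2 ≤
      D * Y ^ 2 + 2 * Y * (-W * Y + Z + (p - g single.unlabel) * a) + D * (3 * C + |p|) ^ 2 := by
    rw [← hdrift, ← hsw, Finset.mul_sum, Finset.sum_mul, Finset.sum_mul,
      ← Finset.sum_add_distrib, ← Finset.sum_add_distrib]
    refine Finset.sum_le_sum fun v _ => ?_
    have h1 : ((t.attach v).fringeSum g - (n + 2) * p - Y) ^ 2 ≤ (3 * C + |p|) ^ 2 := by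
      rw [← sq_abs]
      exact pow_le_pow_left₀ (abs_nonneg _) (hinc v) 2
    have h2 := mul_le_mul_of_nonneg_left h1 (hw0 v)
    nlinarith [h2]
  -- The restoring term `-W * Y` contributes a nonpositive amount and is dropped. Both `|Y|` and the
  -- normalization `D` are of order `n`, so their quotient is bounded.
  have hcross : 2 * Y * (-W * Y + Z + (p - g single.unlabel) * a) ≤
      D * (2 * (C + |p|) / b * |Z| + 2 * (C + |p|) / b * |(p - g single.unlabel) * a|) := by
    set c := (p - g single.unlabel) * a
    have h1 : 2 * Y * (-W * Y + Z + c) ≤ 2 * Y * (Z + c) := by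
      have : 0 ≤ W * Y ^ 2 := by positivity
      linarith
    have h2 : Y * (Z + c) ≤ |Y| * (|Z| + |c|) :=
      (le_abs_self _).trans (by
        rw [abs_mul]; exact mul_le_mul_of_nonneg_left (abs_add_le _ _) (abs_nonneg _))
    have h3 : |Y| * (|Z| + |c|) ≤ (n + 1) * (C + |p|) * (|Z| + |c|) :=
      mul_le_mul_of_nonneg_right hY0 (by positivity)
    have h4 : b * (n + 1) * ((C + |p|) / b * (|Z| + |c|)) ≤ D * ((C + |p|) / b * (|Z| + |c|)) :=
      mul_le_mul_of_nonneg_right hD0 (by positivity)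
    have h5 : b * (n + 1) * ((C + |p|) / b * (|Z| + |c|)) = (n + 1) * (C + |p|) * (|Z| + |c|) := by
      field_simp
    have h6 : D * (2 * (C + |p|) / b * |Z| + 2 * (C + |p|) / b * |c|) =
        2 * (D * ((C + |p|) / b * (|Z| + |c|))) := by ring
    rw [h6]
    linarith
  rw [div_le_iff₀ hDpos]
  linarith

theorem expect_growingTree_succ (w : ℕ → ℝ) (hw : ∀ d, 0 < w d) (n : ℕ)
    (φ : RTree (Fin (n + 2)) → ℝ) : expect (growingTree w hw (n + 1)) φ =
      expect (growingTree w hw n) fun t =>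
        (∑ v, w (t.outDegree v) * φ (t.attach v)) / ∑ v, w (t.outDegree v) := by
  rw [growingTree, expect_bind]
  refine congrArg (expect _) (funext fun t => ?_)
  rw [expect_map, attachmentVertex, expect_normalize _ fun v => (hw _).le]
  simp only [ncard_children]

/-- Induction on the size: the mean-square error at size `k` is `o(n ^ 2)`, so the mean absolute
error is `o(n)`, and this bounds the one-step growth of the mean-square error at size `k + 1`. -/
theorem tendsto_expect_growingTree (ha : 0 ≤ a) (hb : 0 < b) (hw : ∀ d : ℕ, 0 < a * d + b)
    (k : ℕ) : ∀ g : UTree → ℝ, (∀ s, s.size ≠ k → g s = 0) →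
      Tendsto (fun n : ℕ => (expect (growingTree (fun d => a * d + b) hw n) fun t =>
        (t.fringeSum g - (n + 1) * growthLimit a b k g) ^ 2) / ((n : ℝ) + 1) ^ 2)
        atTop (𝓝 0) := by
  induction k with
  | zero =>
    intro g hg
    have : g = 0 := funext fun s => hg s s.size_pos.ne'
    subst this
    simp [fringeSum, growthLimit, expect]
  | succ k ih =>
    intro g hg
    obtain ⟨C, hC⟩ := exists_bound_of_size hg
    have hk : (0 : ℝ) ≤ k := k.cast_nonneg
    have hden : (a + b) * ((k : ℝ) + 2) - a ≠ 0 := by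
      have := mul_nonneg ha hk
      have := mul_nonneg hb.le hk
      have : 0 < (a + b) * ((k : ℝ) + 2) - a := by linarith
      exact this.ne'
    set p := growthLimit a b (k + 1) g with hp
    set q := growthLimit a b k (UTree.growSum (fun d => a * d + b) g) with hq
    have hpq : ((a + b) * (k + 2) - a) * p = (a + b) * g single.unlabel + q := by
      rw [hp, growthLimit, LinearMap.smul_apply, smul_eq_mul, mul_inv_cancel_left₀ hden]
      rfl
    have hz := ih _ (growSum_of_size (w := fun d => a * d + b) hg)
    rw [← hq] at hz
    set C1 := 2 * (C + |p|) / b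
    set C2 := 2 * (C + |p|) / b * |(p - g single.unlabel) * a| + (3 * C + |p|) ^ 2
    set z : ℕ → ℝ := fun n => expect (growingTree (fun d => a * d + b) hw n) fun t =>
      |t.fringeSum (UTree.growSum (fun d => a * d + b) g) - (n + 1) * q| with hzdef
    have hz' : Tendsto (fun n : ℕ => z n / ((n : ℝ) + 1)) atTop (𝓝 0) := by
      have hz2 := hz.sqrt
      rw [Real.sqrt_zero] at hz2
      refine tendsto_of_tendsto_of_tendsto_of_le_of_le tendsto_const_nhds hz2
        (fun n => div_nonneg (expect_nonneg _ fun _ => abs_nonneg _) (by positivity)) fun n => ?_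
      refine Real.le_sqrt_of_sq_le ?_
      rw [div_pow]
      gcongr
      exact sq_expect_abs_le _ _
    refine tendsto_div_sq_of_le_add (b := fun n => C1 * (z n / ((n : ℝ) + 1)) +
      C2 * (1 / ((n : ℝ) + 1))) (fun n => expect_nonneg _ fun _ => sq_nonneg _) ?_ fun n => ?_
    · simpa using (hz'.const_mul C1).add (tendsto_one_div_add_atTop_nhds_zero_nat.const_mul C2)
    · have hn : (n : ℝ) + 1 ≠ 0 := by positivity
      have h1 : (C1 * (z n / ((n : ℝ) + 1)) + C2 * (1 / ((n : ℝ) + 1))) * (n + 1) =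
          C1 * z n + C2 := by field_simp
      rw [h1, expect_growingTree_succ, hzdef, ← expect_const_mul,
        ← expect_const (growingTree (fun d => a * d + b) hw n) C2, ← expect_add, ← expect_add]
      refine expect_mono _ fun t => ?_
      have h2 := sum_sq_fringeSum_attach_le ha hb hg hC hpq t
      have h3 : ∑ v, (a * t.outDegree v + b) = (a + b) * ((n : ℝ) + 1) - a := by
        rw [sum_weight, Fintype.card_fin]; push_cast; rfl
      have h4 : ((n + 1 : ℕ) : ℝ) + 1 = n + 2 := by push_cast; ring
      rw [h3, h4]
      exact h2

theorem growthLimit_nonneg (ha : 0 ≤ a) (hb : 0 < b) (k : ℕ) :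
    ∀ g : UTree → ℝ, (∀ s, 0 ≤ g s) → 0 ≤ growthLimit a b k g := by
  induction k with
  | zero => exact fun g _ => le_refl _
  | succ k ih =>
    intro g hg
    have hk : (0 : ℝ) ≤ k := k.cast_nonneg
    have hden : 0 ≤ (a + b) * ((k : ℝ) + 2) - a := by
      have := mul_nonneg ha hk
      have := mul_nonneg hb.le hk
      linarith
    refine mul_nonneg (inv_nonneg.mpr hden) (add_nonneg ?_ (ih _ fun s => ?_))
    · exact mul_nonneg (by positivity) (hg _)
    · rw [UTree.growSum_apply]
      exact Finset.sum_nonneg fun x _ => mul_nonneg (by positivity) (hg _)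

/-- Every tree with more than one vertex arises from a smaller one by adding a leaf, so positivity
propagates through the recursion. -/
theorem growthLimit_pos (ha : 0 ≤ a) (hb : 0 < b) (k : ℕ) :
    ∀ g : UTree → ℝ, (∀ s, 0 ≤ g s) → ∀ s : UTree, s.size = k → 0 < g s →
      0 < growthLimit a b k g := by
  induction k with
  | zero => exact fun g _ s hs => absurd hs s.size_pos.ne'
  | succ k ih =>
    intro g hg s hs hgs
    have hk : (0 : ℝ) ≤ k := k.cast_nonneg
    have hden : 0 < (a + b) * ((k : ℝ) + 2) - a := by
      have := mul_nonneg ha hk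
      have := mul_nonneg hb.le hk
      linarith
    have hA : ∀ s, 0 ≤ UTree.growSum (fun d => a * d + b) g s := fun s => by
      rw [UTree.growSum_apply]
      exact Finset.sum_nonneg fun x _ => mul_nonneg (by positivity) (hg _)
    refine mul_pos (inv_pos.mpr hden) ?_
    obtain rfl | hk0 := Nat.eq_zero_or_pos k
    · refine add_pos_of_pos_of_nonneg (mul_pos (by positivity) ?_)
        (show 0 ≤ growthLimit a b 0 (UTree.growSum (fun d => a * d + b) g) from
          growthLimit_nonneg ha hb 0 _ hA)
      have h1 : s = single.unlabel := by
        rw [← unlabel_rep s]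
        exact unlabel_eq_single _ (by rw [Nat.card_fin, hs])
      change 0 < g single.unlabel
      rwa [← h1]
    · refine add_pos_of_nonneg_of_pos (mul_nonneg (by positivity) (hg _)) ?_
      obtain ⟨v, s', x, hx⟩ := s.rep.exists_grow (by rw [Nat.card_fin]; omega)
      rw [unlabel_rep] at hx
      classical
      refine ih _ hA s'.unlabel ?_ ?_
      · rw [hx, size_grow] at hs
        omega
      · rw [growSum_unlabel]
        refine lt_of_lt_of_le ?_ (Finset.single_le_sum (f := fun x =>
          (a * (s'.outDegree x : ℝ) + b) * g (s'.grow x).unlabel) (fun x _ =>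
          mul_nonneg (by positivity) (hg _)) (Finset.mem_univ x))
        rw [hx] at hgs
        positivity

/-- The limiting proportion of fringe subtrees with `k + 1` vertices. -/
theorem growthLimit_size (ha : 0 ≤ a) (hb : 0 < b) (k : ℕ) :
    growthLimit a b (k + 1) (fun s => if s.size = k + 1 then 1 else 0) =
      b * (1 / ((a + b) * (k + 1) - a) - 1 / ((a + b) * (k + 2) - a)) := by
  have hpos : ∀ j : ℕ, 0 < (a + b) * ((j : ℝ) + 1) - a := fun j => by
    have := mul_nonneg ha (j.cast_nonneg : (0 : ℝ) ≤ j)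
    have := mul_nonneg hb.le (j.cast_nonneg : (0 : ℝ) ≤ j)
    linarith
  -- The weights of a tree add up to a function of its size, so the recursion closes on size
  -- indicators.
  have hA : ∀ k : ℕ, UTree.growSum (fun d => a * d + b)
      (fun s => if s.size = k + 1 then 1 else 0) =
      ((a + b) * k - a) • fun s => if s.size = k then 1 else 0 := by
    intro k
    funext s
    rw [UTree.growSum_apply, Pi.smul_apply, smul_eq_mul]
    simp only [size_grow, unlabel_rep, Nat.add_right_cancel_iff, ← Finset.sum_mul]
    rw [sum_weight, Fintype.card_fin]
    split_ifs with h
    · rw [h]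
    · simp
  have hsingle : single.unlabel.size = 1 := by rw [size_unlabel, Nat.card_fin]
  induction k with
  | zero =>
    rw [growthLimit, LinearMap.smul_apply, LinearMap.add_apply, LinearMap.comp_apply, hA]
    have h1 := hpos 1
    push_cast at h1
    simp only [growthLimit, LinearMap.zero_apply, LinearMap.smul_apply, LinearMap.proj_apply,
      hsingle, smul_eq_mul]
    push_cast
    have h2 : (a + b) * (0 + 2) - a ≠ 0 := by
      have : 0 < (a + b) * (0 + 2) - a := by linarith
      exact this.ne'
    have h3 : (a + b) * (0 + 1) - a = b := by ring
    rw [h3]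
    field_simp
    simp
    ring
  | succ k ih =>
    rw [growthLimit, LinearMap.smul_apply, LinearMap.add_apply, LinearMap.comp_apply, hA,
      map_smul, ih]
    have h1 := (hpos k).ne'
    have h2 := (hpos (k + 1)).ne'
    have h3 := (hpos (k + 2)).ne'
    push_cast at h1 h2 h3 ⊢
    rw [show (k : ℝ) + 1 + 1 = k + 2 by ring] at *
    rw [show (k : ℝ) + 2 + 1 = k + 3 by ring] at *
    rw [show (k : ℝ) + 1 + 2 = k + 3 by ring] at *
    simp only [LinearMap.smul_apply, LinearMap.proj_apply, hsingle, smul_eq_mul]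
    rw [if_neg (by omega)]
    field_simp
    ring

theorem hasDenseAtomsInLimit_growingTree (ha : 0 ≤ a) (hb : 0 < b)
    (hw : ∀ d : ℕ, 0 < a * d + b) :
    HasDenseAtomsInLimit (growingTree (fun d => a * d + b) hw) := by
  classical
  have hpos : ∀ j : ℕ, 0 < (a + b) * ((j : ℝ) + 1) - a := fun j => by
    have := mul_nonneg ha (j.cast_nonneg : (0 : ℝ) ≤ j)
    have := mul_nonneg hb.le (j.cast_nonneg : (0 : ℝ) ≤ j)
    linarith
  refine hasDenseAtomsInLimit_of_expect _
    (p := fun s => growthLimit a b s.size (Set.indicator {s} 1))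
    (P := fun k => growthLimit a b k (fun s => if s.size = k then 1 else 0)) (fun s => ?_)
    (fun k => ?_) ?_ fun s => ?_
  · exact growthLimit_pos ha hb _ _ (fun _ => Set.indicator_nonneg (fun _ _ => zero_le_one) _) s
      rfl (by simp)
  · have h1 : ∀ s : {s : UTree // s.size = k},
        growthLimit a b s.1.size (Set.indicator {s.1} 1) =
        growthLimit a b k (Set.indicator {s.1} 1) := fun s => by rw [s.2]
    simp only [h1]
    rw [← map_sum]
    congr 1
    funext s
    rw [Finset.sum_apply]
    split_ifs with h
    · rw [Finset.sum_eq_single ⟨s, h⟩]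
      · simp
      · intro b _ hb
        exact Set.indicator_of_notMem (fun h' => hb (Subtype.ext h'.symm)) _
      · simp
    · refine Finset.sum_eq_zero fun b _ => Set.indicator_of_notMem (fun h' => h ?_) _
      rw [h']
      exact b.2
  · rw [hasSum_iff_tendsto_nat_of_nonneg fun k => growthLimit_nonneg ha hb _ _ fun s => by
      split_ifs <;> norm_num]
    rw [← tendsto_add_atTop_iff_nat 1]
    -- The masses by size telescope; the mass not yet counted tends to zero.
    have h1 : ∀ n : ℕ, ∑ k ∈ Finset.range (n + 1),
        growthLimit a b k (fun s => if s.size = k then 1 else 0) =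
        1 - b / ((a + b) * (n + 1) - a) := by
      intro n
      induction n with
      | zero =>
        simp only [zero_add, Finset.sum_range_one, growthLimit, LinearMap.zero_apply]
        push_cast
        rw [show (a + b) * (0 + 1) - a = b by ring, div_self hb.ne', sub_self]
      | succ n ih =>
        rw [Finset.sum_range_succ, ih, growthLimit_size ha hb]
        push_cast
        rw [show (n : ℝ) + 1 + 1 = n + 2 by ring]
        ring
    simp only [h1]
    have h2 : Tendsto (fun n : ℕ => b / ((a + b) * ((n : ℝ) + 1) - a)) atTop (𝓝 0) := by
      refine Tendsto.div_atTop tendsto_const_nhds ?_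
      refine tendsto_atTop_add_const_right _ _ (Tendsto.const_mul_atTop (by positivity) ?_)
      exact tendsto_atTop_add_const_right _ _ tendsto_natCast_atTop_atTop
    simpa using h2.const_sub 1
  · refine tendsto_expect_growingTree ha hb hw _ _ fun s' hs' => ?_
    exact Set.indicator_of_notMem (fun h => hs' (by rw [h])) _

end growth

theorem growingTree_congr {w w' : ℕ → ℝ} (h : w = w') (hw : ∀ d, 0 < w d) (hw' : ∀ d, 0 < w' d) :
    growingTree w hw = growingTree w' hw' := by
  subst h
  rfl

theorem hasDenseAtomsInLimit_recursiveTree : HasDenseAtomsInLimit recursiveTree := by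
  have h := hasDenseAtomsInLimit_growingTree (a := 0) (b := 1) le_rfl one_pos (by simp)
  rwa [growingTree_congr (by funext d; ring) _ fun _ => one_pos] at h

theorem hasDenseAtomsInLimit_preferentialTree (a : ℝ) (ha : -1 < a) :
    HasDenseAtomsInLimit (preferentialTree a ha) := by
  have hd : (fun d : ℕ => (1 : ℝ) * d + (1 + a)) = fun d : ℕ => (d : ℝ) + 1 + a := by
    funext d
    ring
  have h := hasDenseAtomsInLimit_growingTree (a := 1) (b := 1 + a) zero_le_one (by linarith)
    fun d => (prefWeight_pos ha d).trans_eq (congrFun hd d).symm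
  rwa [growingTree_congr hd _ (prefWeight_pos ha)] at h


/-! ### The tree function -/

/-- The coefficients `k ^ (k - 1)` of the tree function, with value `0` at `k = 0`. -/
def treeCoeff (k : ℕ) : ℝ := (k : ℝ) ^ k / k

theorem treeCoeff_zero : treeCoeff 0 = 0 := by simp [treeCoeff]

theorem treeCoeff_succ (k : ℕ) : treeCoeff (k + 1) = ((k : ℝ) + 1) ^ k := by
  rw [treeCoeff, pow_succ]
  push_cast
  field_simp

theorem treeCoeff_nonneg (k : ℕ) : 0 ≤ treeCoeff k := by
  rw [treeCoeff]
  positivity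

/-- For `M ≥ 2` the powers of `k` combine to `k ^ (M - 1)`, and the sum is the `M`-th finite
difference at `0` of a polynomial of degree less than `M`. -/
theorem sum_choose_mul_neg_one_pow (M : ℕ) :
    ∑ k ∈ Finset.range (M + 1), (M.choose k : ℝ) * (treeCoeff k * (-k) ^ (M - k)) =
      if M = 1 then 1 else 0 := by
  match M with
  | 0 => simp [treeCoeff_zero]
  | 1 => simp [Finset.sum_range_succ, treeCoeff]
  | N + 2 =>
    rw [if_neg (by omega)]
    have h := congrFun (fwdDiff_iter_pow_eq_zero_of_lt (R := ℝ) (j := N + 1) (n := N + 2)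
      (by omega)) 0
    rw [fwdDiff_iter_eq_sum_shift] at h
    rw [Pi.zero_apply] at h
    rw [← h]
    refine Finset.sum_congr rfl fun k hk => ?_
    have hk' : k ≤ N + 2 := by
      have := Finset.mem_range.mp hk
      omega
    rw [zsmul_eq_mul]
    push_cast
    rw [zero_add, nsmul_eq_mul, mul_one]
    match k, hk' with
    | 0, _ => simp [treeCoeff_zero]
    | k + 1, hk' =>
      rw [treeCoeff_succ, neg_pow]
      push_cast
      have : ((k : ℝ) + 1) ^ (N + 1) = (k + 1) ^ k * (k + 1) ^ (N + 1 - k) := by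
        rw [← pow_add]
        congr 1
        omega
      rw [this]
      ring

/-- A limiting case of Abel's binomial identity. -/
theorem sum_choose_mul_treeCoeff (n : ℕ) (y : ℝ) :
    ∑ k ∈ Finset.range (n + 1), (n.choose k : ℝ) * (treeCoeff k * (y - k) ^ (n - k)) =
      n * y ^ (n - 1) := by
  have h1 : ∀ k ∈ Finset.range (n + 1),
      (n.choose k : ℝ) * (treeCoeff k * (y - k) ^ (n - k)) =
      ∑ j ∈ Finset.range (n + 1), if k + j ≤ n then (n.choose j : ℝ) * y ^ j *
        (((n - j).choose k : ℝ) * (treeCoeff k * (-k) ^ (n - j - k))) else 0 := by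
    intro k hk
    have hk' : k ≤ n := by
      have := Finset.mem_range.mp hk
      omega
    -- Both sides are expanded in powers of `y`. After the sums are exchanged, the coefficient of `y
    -- ^ j` is the alternating sum above with `M = n - j`, so only `j = n - 1` survives.
    rw [sub_eq_add_neg, add_pow, Finset.mul_sum, Finset.mul_sum,
      ← Finset.sum_filter]
    have hf : (Finset.range (n + 1)).filter (fun j => k + j ≤ n) = Finset.range (n - k + 1) := by
      ext j
      simp only [Finset.mem_filter, Finset.mem_range]
      omega
    rw [hf]
    refine Finset.sum_congr rfl fun j hj => ?_
    have hj' : j ≤ n - k := by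
      have := Finset.mem_range.mp hj
      omega
    have hc : (n.choose k : ℝ) * ((n - k).choose j : ℝ) =
        (n.choose j : ℝ) * ((n - j).choose k : ℝ) := by
      have e1 := Nat.choose_mul (n := n) (k := k + j) (s := k) (by omega)
      have e2 := Nat.choose_mul (n := n) (k := k + j) (s := j) (by omega)
      rw [Nat.add_sub_cancel_left] at e1
      rw [Nat.add_sub_cancel_right] at e2
      have e3 : (k + j).choose k = (k + j).choose j := Nat.choose_symm_of_eq_add rfl
      rw [e3, e2] at e1
      exact_mod_cast e1.symm
    rw [show n - k - j = n - j - k by omega]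
    calc _ = ((n.choose k : ℝ) * ((n - k).choose j : ℝ)) *
          (treeCoeff k * (y ^ j * (-(k : ℝ)) ^ (n - j - k))) := by ring
      _ = _ := by rw [hc]; ring
  rw [Finset.sum_congr rfl h1, Finset.sum_comm]
  have h2 : ∀ j ∈ Finset.range (n + 1), (∑ k ∈ Finset.range (n + 1),
      if k + j ≤ n then (n.choose j : ℝ) * y ^ j *
        (((n - j).choose k : ℝ) * (treeCoeff k * (-k) ^ (n - j - k))) else 0) =
      (n.choose j : ℝ) * y ^ j * if n - j = 1 then 1 else 0 := by
    intro j hj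
    have hj' := Finset.mem_range.mp hj
    rw [← sum_choose_mul_neg_one_pow, Finset.mul_sum, ← Finset.sum_filter]
    have hf : (Finset.range (n + 1)).filter (fun k => k + j ≤ n) = Finset.range (n - j + 1) := by
      ext k
      simp only [Finset.mem_filter, Finset.mem_range]
      omega
    rw [hf]
  rw [Finset.sum_congr rfl h2]
  match n with
  | 0 => simp
  | n + 1 =>
    rw [Finset.sum_eq_single n]
    · simp
    · intro j _ hj
      rw [if_neg (by omega), mul_zero]
    · simp

theorem sum_choose_mul_treeCoeff_self {n : ℕ} (hn : n ≠ 0) :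
    ∑ k ∈ Finset.range (n + 1), (n.choose k : ℝ) * (treeCoeff k * ((n - k : ℕ) : ℝ) ^ (n - k)) =
      (n : ℝ) ^ n := by
  obtain ⟨m, rfl⟩ := Nat.exists_eq_succ_of_ne_zero hn
  have h := sum_choose_mul_treeCoeff (m + 1) ((m + 1 : ℕ) : ℝ)
  rw [Nat.add_sub_cancel, ← pow_succ'] at h
  rw [← h]
  refine Finset.sum_congr rfl fun k hk => ?_
  rw [Nat.cast_sub (by have := Finset.mem_range.mp hk; omega)]

/-! ### Total mass of the Borel distribution, by a renewal argument. -/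

/-- The sequence `n ↦ n ^ n * exp (-n) / n!`. -/
def renewalMass (n : ℕ) : ℝ := (n / Real.exp 1) ^ n / n.factorial

/-- The weights `k ↦ k ^ (k - 1) * exp (-k) / k!` of the Borel distribution. -/
def borelMass (k : ℕ) : ℝ := treeCoeff k * ((Real.exp 1)⁻¹ ^ k / k.factorial)

theorem borelMass_nonneg (k : ℕ) : 0 ≤ borelMass k :=
  mul_nonneg (treeCoeff_nonneg k) (by positivity)

theorem renewalMass_pos (n : ℕ) : 0 < renewalMass n := by
  rcases Nat.eq_zero_or_pos n with rfl | hn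
  · simp [renewalMass]
  · have : (0 : ℝ) < n := by exact_mod_cast hn
    rw [renewalMass]
    positivity

/-- Abel's identity at `y = n`, divided by `exp n * n!`: a renewal equation with step weights
`borelMass`. -/
theorem renewalMass_eq_sum {n : ℕ} (hn : n ≠ 0) :
    renewalMass n = ∑ k ∈ Finset.range (n + 1), borelMass k * renewalMass (n - k) := by
  have h : renewalMass n = (n : ℝ) ^ n * ((Real.exp 1)⁻¹ ^ n / n.factorial) := by
    rw [renewalMass, div_eq_mul_inv _ (Real.exp 1), mul_pow, mul_div_assoc]
  rw [h, ← sum_choose_mul_treeCoeff_self hn, Finset.sum_mul]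
  refine Finset.sum_congr rfl fun k hk => ?_
  have hk' : k ≤ n := by
    have := Finset.mem_range.mp hk
    omega
  have h2 : (Real.exp 1)⁻¹ ^ n = (Real.exp 1)⁻¹ ^ k * (Real.exp 1)⁻¹ ^ (n - k) := by
    rw [← pow_add, Nat.add_sub_cancel' hk']
  rw [borelMass, renewalMass, Nat.cast_choose ℝ hk', h2, div_eq_mul_inv _ (Real.exp 1), mul_pow]
  have h3 : (n.factorial : ℝ) ≠ 0 := by positivity
  field_simp

/-- By Stirling the terms have order `1 / √n`. Monotonicity of the Stirling sequence and the crude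
bound `√(2 * m) ≤ 2 * m` already give comparison with the harmonic series. -/
theorem not_summable_renewalMass : ¬ Summable renewalMass := by
  intro h
  have h1 : Summable fun n : ℕ => 1 / ((n + 1 : ℕ) : ℝ) := by
    refine Summable.of_nonneg_of_le (fun n => by positivity) (fun n => ?_)
      (((summable_nat_add_iff 1).mpr h).mul_left (2 * Stirling.stirlingSeq 1))
    have hs : Stirling.stirlingSeq (n + 1) ≤ Stirling.stirlingSeq 1 :=
      Stirling.stirlingSeq'_antitone (Nat.zero_le n)
    have h1 : 0 < Stirling.stirlingSeq 1 := Stirling.stirlingSeq'_pos 0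
    rw [Stirling.stirlingSeq] at hs
    set m : ℝ := ((n + 1 : ℕ) : ℝ) with hm
    have hm1 : 1 ≤ m := by rw [hm]; push_cast; linarith [(n.cast_nonneg : (0 : ℝ) ≤ n)]
    have hsq : √(2 * m) ≤ 2 * m := by
      rw [Real.sqrt_le_left (by linarith)]
      nlinarith
    have hq := renewalMass_pos (n + 1)
    have hE : (n + 1).factorial / (√(2 * m) * (m / Real.exp 1) ^ (n + 1)) =
        1 / (√(2 * m) * renewalMass (n + 1)) := by
      rw [renewalMass, ← hm]
      field_simp
    rw [hE, div_le_iff₀ (mul_pos (Real.sqrt_pos.mpr (by linarith)) hq)] at hs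
    rw [div_le_iff₀ (by linarith)]
    calc 1 ≤ Stirling.stirlingSeq 1 * (√(2 * m) * renewalMass (n + 1)) := hs
      _ ≤ Stirling.stirlingSeq 1 * (2 * m * renewalMass (n + 1)) := by gcongr
      _ = _ := by ring
  exact Real.not_summable_one_div_natCast ((summable_nat_add_iff 1).mp h1)

/-- The Poisson limit theorem for binomial probabilities with success probability `k / n`, divided
by `k ^ k`. -/
theorem tendsto_choose_mul_pow_div (k : ℕ) (hk : k ≠ 0) :
    Tendsto (fun n : ℕ => (n.choose k : ℝ) * ((n - k : ℕ) : ℝ) ^ (n - k) / (n : ℝ) ^ n) atTop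
      (𝓝 ((Real.exp 1)⁻¹ ^ k / k.factorial)) := by
  have hk0 : (k : ℝ) ^ k ≠ 0 := by positivity
  have h := (ProbabilityTheory.tendsto_choose_mul_pow_of_tendsto_mul_atTop (r := (k : ℝ))
    (p := fun n : ℕ => (k : ℝ) / n) k (by
      refine tendsto_const_nhds.congr' ?_
      filter_upwards [eventually_gt_atTop 0] with n hn
      have : (n : ℝ) ≠ 0 := by positivity
      field_simp)).div_const ((k : ℝ) ^ k)
  have hlim : Real.exp (-k) * (k : ℝ) ^ k / k.factorial / (k : ℝ) ^ k =
      (Real.exp 1)⁻¹ ^ k / k.factorial := by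
    rw [← Real.exp_neg, ← Real.exp_nat_mul]
    field_simp
  rw [← hlim]
  refine h.congr' ?_
  filter_upwards [eventually_ge_atTop (k + 1)] with n hn
  have hn0 : (n : ℝ) ≠ 0 := by
    have : 0 < n := by omega
    positivity
  have hsub : ((n - k : ℕ) : ℝ) = n * (1 - k / n) := by
    rw [Nat.cast_sub (by omega)]
    field_simp
  have hnn : (n : ℝ) ^ n = n ^ k * n ^ (n - k) := by
    rw [← pow_add, Nat.add_sub_cancel' (by omega)]
  rw [hsub, mul_pow, hnn, div_pow]
  field_simp

/-- Abel's identity at `y = n`, divided by `n ^ n`, exhibits nonnegative terms with sum one that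
converge termwise to `borelMass`; truncation to finitely many of them gives the inequality. -/
theorem sum_borelMass_le_one (K : ℕ) : ∑ k ∈ Finset.range K, borelMass k ≤ 1 := by
  have h1 : Tendsto (fun n : ℕ => ∑ k ∈ Finset.range K, treeCoeff k *
      ((n.choose k : ℝ) * ((n - k : ℕ) : ℝ) ^ (n - k) / (n : ℝ) ^ n)) atTop
      (𝓝 (∑ k ∈ Finset.range K, borelMass k)) := by
    refine tendsto_finsetSum _ fun k _ => ?_
    rcases eq_or_ne k 0 with rfl | hk
    · simp [borelMass, treeCoeff_zero]
    · exact (tendsto_choose_mul_pow_div k hk).const_mul _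
  refine le_of_tendsto h1 ?_
  filter_upwards [eventually_gt_atTop K] with n hn
  have hn0 : (n : ℝ) ^ n ≠ 0 := by
    have : 0 < n := by omega
    positivity
  calc _ ≤ ∑ k ∈ Finset.range (n + 1), treeCoeff k *
      ((n.choose k : ℝ) * ((n - k : ℕ) : ℝ) ^ (n - k) / (n : ℝ) ^ n) := by
        refine Finset.sum_le_sum_of_subset_of_nonneg (Finset.range_subset_range.mpr (by omega))
          fun k _ _ => mul_nonneg (treeCoeff_nonneg k) (by positivity)
    _ = (∑ k ∈ Finset.range (n + 1), (n.choose k : ℝ) *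
        (treeCoeff k * ((n - k : ℕ) : ℝ) ^ (n - k))) / (n : ℝ) ^ n := by
        rw [Finset.sum_div]
        exact Finset.sum_congr rfl fun k _ => by ring
    _ = 1 := by rw [sum_choose_mul_treeCoeff_self (by omega), div_self hn0]

/-- The Borel distribution with parameter `1` is a probability distribution. -/
theorem hasSum_borelMass : HasSum borelMass 1 := by
  have hs : Summable borelMass :=
    summable_of_sum_range_le borelMass_nonneg sum_borelMass_le_one
  have hle : ∑' k, borelMass k ≤ 1 :=
    hs.tsum_le_of_sum_range_le sum_borelMass_le_one
  rcases hle.eq_or_lt with h | h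
  · exact h ▸ hs.hasSum
  -- If the total mass `s` were below one, summing the renewal equation would give `S ≤ 1 + s * S`
  -- for the partial sums of `renewalMass`, hence a bound on a divergent series.
  · exfalso
    set s := ∑' k, borelMass k
    refine not_summable_renewalMass (summable_of_sum_range_le (c := 1 / (1 - s))
      (fun n => (renewalMass_pos n).le) fun N => ?_)
    rw [le_div_iff₀ (by linarith)]
    set S := ∑ n ∈ Finset.range N, renewalMass n with hS
    have hS0 : 0 ≤ S := Finset.sum_nonneg fun n _ => (renewalMass_pos n).le
    have h1 : S ≤ 1 + ∑ n ∈ Finset.range N, ∑ k ∈ Finset.range (n + 1),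
        borelMass k * renewalMass (n - k) := by
      have h2 : ∀ n, renewalMass n ≤ (if n = 0 then 1 else 0) +
          ∑ k ∈ Finset.range (n + 1), borelMass k * renewalMass (n - k) := by
        intro n
        split_ifs with hn
        · subst hn
          simp [renewalMass, borelMass, treeCoeff_zero]
        · rw [zero_add]
          exact (renewalMass_eq_sum hn).le
      refine (Finset.sum_le_sum fun n _ => h2 n).trans ?_
      rw [Finset.sum_add_distrib]
      gcongr
      rw [Finset.sum_ite_eq']
      split_ifs <;> norm_num
    have h2 : ∑ n ∈ Finset.range N, ∑ k ∈ Finset.range (n + 1),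
        borelMass k * renewalMass (n - k) ≤ s * S := by
      rw [Finset.sum_range_diag_flip N fun k j => borelMass k * renewalMass j]
      calc _ ≤ ∑ k ∈ Finset.range N, borelMass k * S := by
            refine Finset.sum_le_sum fun k _ => ?_
            rw [← Finset.mul_sum]
            refine mul_le_mul_of_nonneg_left ?_ (borelMass_nonneg k)
            exact Finset.sum_le_sum_of_subset_of_nonneg
              (Finset.range_subset_range.mpr (by omega)) fun n _ _ => (renewalMass_pos n).le
        _ = (∑ k ∈ Finset.range N, borelMass k) * S := by rw [Finset.sum_mul]
        _ ≤ s * S := by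
            refine mul_le_mul_of_nonneg_right ?_ hS0
            exact hs.sum_le_tsum _ fun k _ => borelMass_nonneg k
    linarith


/-! ### Grafting a tree onto a vertex of another tree -/

namespace RTree

variable {V W : Type*}

section graft

variable {S : Set V} (A : RTree S) (B : RTree ↥Sᶜ) (x : ↥Sᶜ)

open scoped Classical in
/-- The parent function of the tree that arises when an edge is added between the root of a tree
`A` on `S` and a vertex `x` of a tree `B` on the complement of `S`. -/
def graftPar (w : V) : V :=
  if h : w ∈ S then if (⟨w, h⟩ : S) = A.root then x else A.par ⟨w, h⟩ else B.par ⟨w, h⟩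

theorem graftPar_root : graftPar A B x A.root = x := by
  rw [graftPar, dif_pos A.root.2, if_pos rfl]

theorem graftPar_of_mem (w : S) (h : w ≠ A.root) : graftPar A B x w = A.par w := by
  rw [graftPar, dif_pos w.2, if_neg h]

theorem graftPar_of_notMem (w : ↥Sᶜ) : graftPar A B x w = B.par w := by
  rw [graftPar, dif_neg w.2]

variable [Finite V]

open scoped Classical in
/-- The tree that arises when an edge is added between the root of a tree `A` on `S` and a vertex
`x` of a tree `B` on the complement of `S`. -/
def graft : RTree V :=
  ofParent B.root (graftPar A B x)
    (fun w => if h : w ∈ S then B.height x + 1 + A.height ⟨w, h⟩ else B.height ⟨w, h⟩) (by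
      intro w hw
      by_cases h : w ∈ S
      · rw [dif_pos h]
        by_cases hr : (⟨w, h⟩ : S) = A.root
        · rw [graftPar, dif_pos h, if_pos hr, dif_neg x.2]
          change B.height x < _
          omega
        · rw [graftPar, dif_pos h, if_neg hr, dif_pos (A.par ⟨w, h⟩).2]
          have := A.height_par hr
          change B.height x + 1 + A.height (A.par ⟨w, h⟩) < _
          omega
      · rw [dif_neg h, graftPar, dif_neg h, dif_neg (B.par ⟨w, h⟩).2]
        have := B.height_par (v := ⟨w, h⟩) fun hr => hw (congrArg Subtype.val hr)
        change B.height (B.par ⟨w, h⟩) < _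
        omega)

theorem par_graft : (graft A B x).par = graftPar A B x := by
  refine par_ofParent _ _ _ _ ?_
  rw [graftPar_of_notMem, par_root]

theorem below_graft_root (w : V) : (graft A B x).Below A.root w ↔ w ∈ S := by
  constructor
  · rintro ⟨k, hk⟩
    by_contra hw
    have : ∀ k, (graft A B x).par^[k] w ∉ S := by
      intro k
      induction k with
      | zero => exact hw
      | succ k ih =>
        have h := graftPar_of_notMem A B x ⟨_, ih⟩
        rw [← par_graft] at h
        rw [Function.iterate_succ_apply', h]
        exact (B.par _).2
    exact this k (hk ▸ A.root.2)
  · intro hw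
    suffices h : ∀ n, ∀ w : S, A.height w = n → (graft A B x).Below A.root w from h _ ⟨w, hw⟩ rfl
    intro n
    induction n with
    | zero =>
      intro w hn
      by_cases hr : w = A.root
      · rw [hr]
        exact Below.refl _ _
      · have := A.height_par hr
        omega
    | succ n ih =>
      intro w hn
      by_cases hr : w = A.root
      · rw [hr]
        exact Below.refl _ _
      · have h1 := A.height_par hr
        have h2 := (graft A B x).below_par w
        rw [par_graft, graftPar_of_mem A B x w hr] at h2
        exact (ih (A.par w) (by omega)).trans h2

theorem fringe_graft_root : (graft A B x).fringe A.root = A.unlabel := by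
  classical
  rw [← unlabel_sub, unlabel_eq_iff]
  refine Isomorphic.symm (isomorphic_iff.mpr
    ⟨Equiv.subtypeEquivRight fun w => (below_graft_root A B x w).symm, fun w => ?_⟩)
  apply Subtype.ext
  rw [par_sub]
  by_cases hw : w = A.root
  · subst hw
    refine Eq.trans ?_ (if_pos rfl).symm
    rw [par_root]
    rfl
  · refine Eq.trans ?_ (if_neg fun h => hw (Subtype.ext h)).symm
    rw [par_graft]
    exact (graftPar_of_mem A B x w hw).symm

theorem fringe_graft_of_notMem (u : ↥Sᶜ) (hu : ¬ (graft A B x).Below u A.root) :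
    (graft A B x).fringe u = B.fringe u := by
  refine fringe_map Subtype.val Subtype.val_injective (fun w => ?_) u fun z hz => ?_
  · rw [par_graft, graftPar_of_notMem]
  · rw [Subtype.range_val]
    intro hzS
    rcases Below.total hz ((below_graft_root A B x z).mpr hzS) with h | h
    · exact hu h
    · exact u.2 ((below_graft_root A B x u).mp h)

/-- Only size `k` counts, and `A` has size `k`. Other vertices of `A` have smaller fringe subtrees,
the ancestors of its root have larger ones, and every remaining vertex keeps its fringe subtree in
`B`. -/
theorem fringeSum_graft_le [Fintype V] [Fintype ↥Sᶜ] {g : UTree → ℝ} {k : ℕ} (h0 : ∀ s, 0 ≤ g s)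
    (h1 : ∀ s, g s ≤ 1) (hg : ∀ s, s.size ≠ k → g s = 0) (hA : A.unlabel.size = k) :
    (graft A B x).fringeSum g ≤ 1 + B.fringeSum g := by
  classical
  have hle : ∀ u, g ((graft A B x).fringe u) ≤ (if u = A.root then 1 else 0) +
      if h : u ∈ Sᶜ then g (B.fringe ⟨u, h⟩) else 0 := by
    intro u
    by_cases hu : u ∈ S
    · rw [dif_neg (show u ∉ Sᶜ from not_not.mpr hu), add_zero]
      split_ifs with hr
      · exact h1 _
      · refine (hg _ fun hs => hr ?_).le
        refine eq_of_below_of_card (Below.refl (graft A B x) u)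
          ((below_graft_root A B x u).mpr hu) ?_
        rw [hs, fringe_graft_root, hA]
    · rw [dif_pos (show u ∈ Sᶜ from hu)]
      by_cases hb : (graft A B x).Below u A.root
      · rw [hg ((graft A B x).fringe u) fun hs => hu ?_]
        · have := h0 (B.fringe ⟨u, hu⟩)
          split_ifs <;> linarith
        · have : u = A.root := by
            refine eq_of_below_of_card hb (Below.refl (graft A B x) _) ?_
            rw [hs, fringe_graft_root, hA]
          rw [this]
          exact A.root.2
      · rw [fringe_graft_of_notMem A B x ⟨u, hu⟩ hb]
        split_ifs <;> linarith
  refine (Finset.sum_le_sum fun u _ => hle u).trans ?_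
  rw [Finset.sum_add_distrib, Finset.sum_ite_eq' Finset.univ, if_pos (Finset.mem_univ _)]
  refine (add_le_add_iff_left 1).mpr (le_of_eq ?_)
  rw [← Finset.sum_filter_of_ne (p := fun u => u ∈ Sᶜ), Finset.sum_subtype
    (p := fun u => u ∈ Sᶜ) _ (by simp), fringeSum]
  · exact Finset.sum_congr rfl fun u _ => dif_pos u.2
  · intro u _ hu
    by_contra h
    exact hu (dif_neg h)

end graft

/-- The data that is used to graft one tree onto another one. -/
abbrev GraftData (V : Type*) : Type _ := Σ S : Set V, RTree S × RTree ↥Sᶜ × ↥Sᶜ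

/-- The inverse cuts the edge above a vertex `v` other than the root: `S` consists of the vertices
below `v`, `B` is what remains, and `x` is the parent of `v`. -/
theorem graft_bijective [Finite V] : Function.Bijective fun d : GraftData V =>
    (⟨(graft d.2.1 d.2.2.1 d.2.2.2, d.2.1.root), fun h =>
      d.2.2.1.root.2 ((show (d.2.1.root : V) = d.2.2.1.root from h) ▸ d.2.1.root.2)⟩ : {p : RTree V × V // p.2 ≠ p.1.root}) := by
  constructor
  · rintro ⟨S, A, B, x⟩ ⟨S', A', B', x'⟩ h
    have h' := Prod.mk.inj (Subtype.mk.inj h)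
    obtain ⟨hT, hr⟩ := h'
    have hS : S = S' := by
      ext w
      rw [← below_graft_root A B x, ← below_graft_root A' B' x']
      simp only at hT hr
      rw [hT, hr]
    subst hS
    simp only at hT hr
    have hr' : A.root = A'.root := Subtype.ext hr
    have hpar : graftPar A B x = graftPar A' B' x' := by
      rw [← par_graft, ← par_graft, hT]
    have hA : A = A' := by
      refine ext_par (funext fun w => ?_)
      by_cases hw : w = A.root
      · rw [hw, par_root, hr', par_root]
      · apply Subtype.ext
        rw [← graftPar_of_mem A B x w hw, ← graftPar_of_mem A' B' x' w (hr' ▸ hw), hpar]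
    have hB : B = B' := by
      refine ext_par (funext fun w => Subtype.ext ?_)
      rw [← graftPar_of_notMem A B x w, ← graftPar_of_notMem A' B' x' w, hpar]
    have hx : x = x' := by
      apply Subtype.ext
      rw [← graftPar_root A B x, ← graftPar_root A' B' x', hpar, hr]
    rw [hA, hB, hx]
  · rintro ⟨⟨T, v⟩, hv⟩
    classical
    simp only at hv
    let S : Set V := {w | T.Below v w}
    have hroot : T.root ∉ S := fun h => hv (below_root_iff.mp h)
    have hpar : ∀ w, w ∉ S → T.par w ∉ S := fun w hw h => hw (h.trans (T.below_par w))
    let B : RTree ↥Sᶜ := ofParent ⟨T.root, hroot⟩ (fun w => ⟨T.par w, hpar w w.2⟩)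
      (fun w => T.height w) (by
        intro w hw
        have := T.height_par (v := w.1) fun h => hw (Subtype.ext h)
        dsimp only
        omega)
    have hB : B.par = fun w : ↥Sᶜ => ⟨T.par w, hpar w w.2⟩ :=
      par_ofParent _ _ _ _ (Subtype.ext T.par_root)
    have hx : T.par v ∉ S := by
      intro h
      have h1 := height_le_of_below h
      have h2 := T.height_par hv
      omega
    let A : RTree S := T.sub v
    have hAr : A.root = ⟨v, Below.refl T v⟩ := T.sub_root v
    refine ⟨⟨S, A, B, ⟨T.par v, hx⟩⟩, Subtype.ext (Prod.ext ?_ ?_)⟩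
    · refine ext_par ?_
      rw [par_graft]
      funext w
      by_cases hw : w ∈ S
      · by_cases hwv : w = v
        · subst hwv
          have := graftPar_root A B ⟨T.par w, hx⟩
          rw [hAr] at this
          exact this
        · refine (graftPar_of_mem A B _ ⟨w, hw⟩ ?_).trans ?_
          · rw [hAr]
            exact fun h => hwv (congrArg Subtype.val h)
          · refine (T.par_sub v ⟨w, hw⟩).trans (if_neg hwv)
      · refine (graftPar_of_notMem A B _ ⟨w, hw⟩).trans ?_
        rw [hB]
    · exact congrArg Subtype.val hAr

instance (S : Set V) [Finite V] : Fintype S := Fintype.ofFinite _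

theorem sum_sum_eq_sum_graft [Fintype V] [DecidableEq V] (F : RTree V → V → ℝ) :
    ∑ T : RTree V, ∑ v, (if v ≠ T.root then F T v else 0) =
      ∑ S : Set V, ∑ A : RTree S, ∑ B : RTree ↥Sᶜ, ∑ x : ↥Sᶜ, F (graft A B x) A.root := by
  classical
  rw [← Fintype.sum_prod_type (f := fun p : RTree V × V => if p.2 ≠ p.1.root then F p.1 p.2 else 0),
    ← Finset.sum_filter, Finset.sum_subtype (p := fun p : RTree V × V => p.2 ≠ p.1.root) _ (by simp)]
  rw [← (Equiv.ofBijective _ graft_bijective).sum_comp, Fintype.sum_sigma]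
  refine Finset.sum_congr rfl fun S _ => ?_
  rw [Fintype.sum_prod_type]
  refine Finset.sum_congr rfl fun A _ => ?_
  rw [Fintype.sum_prod_type]
  rfl

end RTree


/-! ### Counting labeled rooted trees -/

open RTree

/-- The sum of `φ` over the labeled rooted trees with `n` vertices. -/
def treeSum (n : ℕ) (φ : UTree → ℝ) : ℝ := ∑ t : RTree (Fin n), φ t.unlabel

theorem sum_unlabel {V : Type*} [Finite V] (φ : UTree → ℝ) :
    ∑ t : RTree V, φ t.unlabel = treeSum (Nat.card V) φ := by
  have e := Finite.equivFin V
  refine Fintype.sum_bijective (RTree.relabel e)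
    (Function.bijective_iff_has_inverse.mpr ⟨RTree.relabel e.symm, fun t => ?_, fun t => ?_⟩) _ _
    fun t => ?_
  · refine ext_par (funext fun v => ?_)
    simp [par_relabel]
  · refine ext_par (funext fun v => ?_)
    simp [par_relabel]
  · rw [unlabel_eq_iff.mpr (t.isomorphic_relabel e)]

theorem treeSum_of_size {n k : ℕ} (h : n ≠ k) {g : UTree → ℝ} (hg : ∀ s, s.size ≠ k → g s = 0) :
    treeSum n g = 0 :=
  Finset.sum_eq_zero fun t _ => hg _ (by rwa [size_unlabel, Nat.card_fin])

theorem sum_graft {n : ℕ} (g ψ : UTree → ℝ) :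
    ∑ S : Set (Fin n), ∑ A : RTree S, ∑ B : RTree ↥Sᶜ, ∑ _x : ↥Sᶜ, g A.unlabel * ψ B.unlabel =
      ∑ k ∈ Finset.range (n + 1),
        (n.choose k : ℝ) * (treeSum k g * (treeSum (n - k) ψ * (n - k : ℕ))) := by
  have h : ∀ S : Set (Fin n),
      ∑ A : RTree S, ∑ B : RTree ↥Sᶜ, ∑ _x : ↥Sᶜ, g A.unlabel * ψ B.unlabel =
      treeSum S.ncard g * (treeSum (n - S.ncard) ψ * (n - S.ncard : ℕ)) := by
    intro S
    have hc : Nat.card ↥Sᶜ = n - S.ncard := by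
      rw [Nat.card_coe_set_eq, Set.ncard_compl, Nat.card_fin]
    simp only [Finset.sum_const, Finset.card_univ, nsmul_eq_mul, ← Finset.mul_sum]
    rw [← Nat.card_eq_fintype_card, hc, ← Finset.sum_mul, sum_unlabel, sum_unlabel, hc,
      Nat.card_coe_set_eq]
    ring
  simp only [h]
  rw [← Fintype.finsetEquivSet.sum_comp]
  simp only [Fintype.finsetEquivSet_apply, Set.ncard_coe_finset]
  rw [← Finset.powerset_univ, Finset.sum_powerset_apply_card
    (fun k => treeSum k g * (treeSum (n - k) ψ * (n - k : ℕ)))]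
  simp only [Finset.card_univ, Fintype.card_fin, nsmul_eq_mul]

/-- Double counting of pairs of a labeled tree and a vertex other than its root, by cutting at that
vertex. -/
theorem treeSum_one_mul (n : ℕ) : treeSum n (fun _ => 1) * (n - 1) =
    ∑ k ∈ Finset.range (n + 1), (n.choose k : ℝ) *
      (treeSum k (fun _ => 1) * (treeSum (n - k) (fun _ => 1) * (n - k : ℕ))) := by
  rw [← sum_graft]
  simp only [mul_one]
  rw [← sum_sum_eq_sum_graft fun _ _ => (1 : ℝ), treeSum, Finset.sum_mul]
  refine Finset.sum_congr rfl fun T _ => ?_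
  rw [← Finset.sum_filter, Finset.sum_const, Finset.filter_ne', Finset.card_erase_of_mem
    (Finset.mem_univ _), Finset.card_univ, Fintype.card_fin, nsmul_eq_mul, mul_one, one_mul,
    Nat.cast_sub (by have := T.root.pos; omega), Nat.cast_one]

theorem treeSum_zero (φ : UTree → ℝ) : treeSum 0 φ = 0 :=
  Finset.sum_eq_zero fun t _ => t.root.elim0

/-- Cayley's formula for rooted trees. -/
theorem treeSum_one (n : ℕ) : treeSum n (fun _ => 1) = treeCoeff n := by
  induction n using Nat.strong_induction_on with
  | _ n ih =>
    match n, ih with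
    | 0, _ => rw [treeSum_zero, treeCoeff_zero]
    | 1, _ =>
      have : Fintype.card (RTree (Fin 1)) = 1 := Fintype.card_eq_one_iff.mpr
        ⟨single, fun t => ext_par (funext fun v => Subsingleton.elim _ _)⟩
      simp [treeSum, treeCoeff, this]
    | n + 2, ih =>
      have h1 := treeSum_one_mul (n + 2)
      have h2 := sum_choose_mul_treeCoeff_self (n := n + 2) (by omega)
      -- The extreme terms are split off. The last one vanishes in the counting recursion but equals
      -- `treeCoeff (n + 2)` in Abel's identity, where `0 ^ 0 = 1`; the middle terms agree by
      -- induction.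
      rw [Finset.sum_range_succ, Finset.sum_range_succ'] at h1
      rw [Finset.sum_range_succ, Finset.sum_range_succ'] at h2
      simp only [treeSum_zero, treeCoeff_zero, Nat.sub_self, Nat.choose_self, Nat.cast_zero,
        zero_mul, mul_zero, add_zero, pow_zero, mul_one, Nat.cast_one, one_mul] at h1 h2
      have h3 : ∀ k ∈ Finset.range (n + 1), ((n + 2).choose (k + 1) : ℝ) *
          (treeSum (k + 1) (fun _ => 1) * (treeSum (n + 2 - (k + 1)) (fun _ => 1) *
            (n + 2 - (k + 1) : ℕ))) = ((n + 2).choose (k + 1) : ℝ) *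
          (treeCoeff (k + 1) * ((n + 2 - (k + 1) : ℕ) : ℝ) ^ (n + 2 - (k + 1))) := by
        intro k hk
        have hk' := Finset.mem_range.mp hk
        have h0 : ((n + 2 - (k + 1) : ℕ) : ℝ) ≠ 0 := by
          have : n + 2 - (k + 1) ≠ 0 := by omega
          exact_mod_cast this
        rw [ih (k + 1) (by omega), ih (n + 2 - (k + 1)) (by omega), treeCoeff.eq_def (n + 2 - _),
          div_mul_cancel₀ _ h0]
      rw [Finset.sum_congr rfl h3] at h1
      have h4 : treeCoeff (n + 2) * ((n + 2 : ℕ) : ℝ) = ((n + 2 : ℕ) : ℝ) ^ (n + 2) := by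
        rw [treeCoeff, div_mul_cancel₀ _ (by positivity)]
      have h5 : (((n + 2 : ℕ) : ℝ) - 1) ≠ 0 := by
        push_cast
        have : (0 : ℝ) < n + 2 - 1 := by linarith [(n.cast_nonneg : (0 : ℝ) ≤ n)]
        exact this.ne'
      refine mul_right_cancel₀ h5 ?_
      linarith

theorem treeSum_one_mul_self {n : ℕ} (hn : n ≠ 0) :
    treeSum n (fun _ => 1) * n = (n : ℝ) ^ n := by
  rw [treeSum_one, treeCoeff, div_mul_cancel₀ _ (by exact_mod_cast hn)]

theorem fringeSum_rep_unlabel {V : Type*} [Fintype V] (t : RTree V) (g : UTree → ℝ) :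
    t.unlabel.rep.fringeSum g = t.fringeSum g := by
  obtain ⟨e, he⟩ := isomorphic_iff.mp t.rep_unlabel_isomorphic
  exact Fintype.sum_equiv e _ _ fun v => by rw [fringe_of_par e he]

/-! ### First and second moments of fringe counts in uniform labeled trees. -/

section uniform

variable {g : UTree → ℝ} {k n : ℕ}

theorem fringeSum_mul_eq_sum (hg : ∀ s, s.size ≠ k → g s = 0) (hn : k ≠ n)
    (T : RTree (Fin n)) (c : ℝ) :
    T.fringeSum g * c = ∑ v, if v ≠ T.root then g (T.fringe v) * c else 0 := by
  rw [fringeSum, Finset.sum_mul]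
  refine Finset.sum_congr rfl fun v _ => ?_
  split_ifs with hv
  · rfl
  · rw [not_not.mp hv, fringe_root, hg _ (by rw [size_unlabel, Nat.card_fin]; exact hn.symm),
      zero_mul]

/-- Cutting off a fringe subtree of size `k` leaves a rooted tree on `n - k` labels with a marked
vertex, and by Cayley there are `(n - k) ^ (n - k)` of these. -/
theorem sum_fringeSum (hg : ∀ s, s.size ≠ k → g s = 0) (hn : k < n) :
    ∑ T : RTree (Fin n), T.fringeSum g =
      treeSum k g * ((n.choose k : ℝ) * ((n - k : ℕ) : ℝ) ^ (n - k)) := by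
  have h1 : ∀ T : RTree (Fin n), T.fringeSum g =
      ∑ v, if v ≠ T.root then g (T.fringe v) * 1 else 0 := fun T => by
    rw [← fringeSum_mul_eq_sum hg hn.ne, mul_one]
  simp only [h1]
  rw [sum_sum_eq_sum_graft fun T v => g (T.fringe v) * 1]
  simp only [fringe_graft_root]
  rw [sum_graft g fun _ => 1, Finset.sum_eq_single k]
  · rw [treeSum_one_mul_self (by omega)]
    ring
  · intro j _ hj
    rw [treeSum_of_size hj hg]
    ring
  · intro h
    exact absurd (Finset.mem_range.mpr (by omega)) h

/-- One factor is opened by cutting off a fringe subtree; the other is then at most one plus the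
fringe sum of the remaining tree, to which the first moment formula on `n - k` labels applies. -/
theorem sum_fringeSum_sq_le (h0 : ∀ s, 0 ≤ g s) (h1 : ∀ s, g s ≤ 1)
    (hg : ∀ s, s.size ≠ k → g s = 0) (hn : 2 * k < n) :
    ∑ T : RTree (Fin n), T.fringeSum g ^ 2 ≤
      treeSum k g * ((n.choose k : ℝ) * ((n - k : ℕ) : ℝ) ^ (n - k) + (n.choose k : ℝ) *
        (n - k : ℕ) * (treeSum k g * (((n - k).choose k : ℝ) *
          ((n - k - k : ℕ) : ℝ) ^ (n - k - k)))) := by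
  have e1 : ∀ T : RTree (Fin n), T.fringeSum g ^ 2 =
      ∑ v, if v ≠ T.root then g (T.fringe v) * T.fringeSum g else 0 := fun T => by
    rw [← fringeSum_mul_eq_sum hg (by omega), sq]
  simp only [e1]
  rw [sum_sum_eq_sum_graft fun T v => g (T.fringe v) * T.fringeSum g]
  simp only [fringe_graft_root]
  have e2 : ∑ S : Set (Fin n), ∑ A : RTree S, ∑ B : RTree ↥Sᶜ, ∑ x : ↥Sᶜ,
      g A.unlabel * (graft A B x).fringeSum g ≤ ∑ S : Set (Fin n), ∑ A : RTree S,
      ∑ B : RTree ↥Sᶜ, ∑ x : ↥Sᶜ, g A.unlabel * (1 + B.unlabel.rep.fringeSum g) := by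
    refine Finset.sum_le_sum fun S _ => Finset.sum_le_sum fun A _ => Finset.sum_le_sum fun B _ =>
      Finset.sum_le_sum fun x _ => ?_
    rw [fringeSum_rep_unlabel]
    by_cases hA : A.unlabel.size = k
    · exact mul_le_mul_of_nonneg_left (fringeSum_graft_le A B x h0 h1 hg hA) (h0 _)
    · rw [hg _ hA, zero_mul, zero_mul]
  refine e2.trans (le_of_eq ?_)
  rw [sum_graft g fun s => 1 + s.rep.fringeSum g, Finset.sum_eq_single k]
  · have e3 : treeSum (n - k) (fun s => 1 + s.rep.fringeSum g) =
        treeSum (n - k) (fun _ => 1) + treeSum k g * (((n - k).choose k : ℝ) *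
          ((n - k - k : ℕ) : ℝ) ^ (n - k - k)) := by
      rw [← sum_fringeSum hg (by omega), treeSum, Finset.sum_add_distrib]
      simp only [fringeSum_rep_unlabel]
      rfl
    rw [e3, ← treeSum_one_mul_self (n := n - k) (by omega)]
    ring
  · intro j _ hj
    rw [treeSum_of_size hj hg]
    ring
  · intro h
    exact absurd (Finset.mem_range.mpr (by omega)) h

theorem expect_uniformTree (n : ℕ) (φ : RTree (Fin (n + 1)) → ℝ) :
    expect (uniformTree n) φ = (∑ T, φ T) / treeCoeff (n + 1) := by
  have hc : ∀ T, (uniformTree n T).toReal = (treeCoeff (n + 1))⁻¹ := by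
    intro T
    rw [← treeSum_one, treeSum, Finset.sum_const, nsmul_eq_mul, mul_one, Finset.card_univ,
      ← ENNReal.toReal_natCast, ← ENNReal.toReal_inv]
    exact congrArg ENNReal.toReal (PMF.uniformOfFintype_apply T)
  simp only [expect, hc]
  rw [← Finset.mul_sum, div_eq_inv_mul]

theorem tendsto_expect_uniformTree (h0 : ∀ s, 0 ≤ g s) (h1 : ∀ s, g s ≤ 1) (hk : k ≠ 0)
    (hg : ∀ s, s.size ≠ k → g s = 0) :
    Tendsto (fun n : ℕ => (expect (uniformTree n) fun t => (t.fringeSum g -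
      (n + 1) * (treeSum k g * ((Real.exp 1)⁻¹ ^ k / k.factorial))) ^ 2) / ((n : ℝ) + 1) ^ 2)
      atTop (𝓝 0) := by
  set a := treeSum k g
  have ha : 0 ≤ a := Finset.sum_nonneg fun _ _ => h0 _
  set c := (Real.exp 1)⁻¹ ^ k / k.factorial
  set H : ℕ → ℝ := fun n => (n.choose k : ℝ) * ((n - k : ℕ) : ℝ) ^ (n - k) / (n : ℝ) ^ n with hH
  have hHlim : Tendsto H atTop (𝓝 c) := tendsto_choose_mul_pow_div k hk
  have hH0 : ∀ n, 0 ≤ H n := fun n => by positivity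
  -- This is the upper bound for the normalized mean-square error. As `H` tends to `c`, its three
  -- parts tend to `(a * c) ^ 2`, `-2 * (a * c) ^ 2` and `(a * c) ^ 2`.
  have hlim : Tendsto (fun n : ℕ => a * (H (n + 1) * (1 / ((n : ℝ) + 1)) +
      H (n + 1) * (a * H (n + 1 - k))) - 2 * (a * c) * (a * H (n + 1)) + (a * c) ^ 2)
      atTop (𝓝 0) := by
    have t1 := (tendsto_add_atTop_iff_nat 1).mpr hHlim
    have t2 : Tendsto (fun n : ℕ => H (n + 1 - k)) atTop (𝓝 c) :=
      hHlim.comp ((tendsto_sub_atTop_nat k).comp (tendsto_add_atTop_nat 1))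
    have t3 := ((((t1.mul tendsto_one_div_add_atTop_nhds_zero_nat).add
      (t1.mul (t2.const_mul a))).const_mul a).sub ((t1.const_mul a).const_mul
        (2 * (a * c)))).add_const ((a * c) ^ 2)
    convert! t3 using 2
    ring
  refine tendsto_of_tendsto_of_tendsto_of_le_of_le' tendsto_const_nhds hlim
    (Eventually.of_forall fun n => div_nonneg (expect_nonneg _ fun _ => sq_nonneg _)
      (by positivity)) ?_
  filter_upwards [eventually_ge_atTop (2 * k)] with n hn
  have hN0 : (0 : ℝ) < (n : ℝ) + 1 := by positivity
  set N : ℝ := (n : ℝ) + 1 with hN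
  have hNc : ((n + 1 : ℕ) : ℝ) = N := by push_cast; rfl
  have hR : treeCoeff (n + 1) = N ^ (n + 1) / N := by rw [treeCoeff, hNc]
  have hpow : (0 : ℝ) < N ^ (n + 1) := by positivity
  have hR0 : 0 < treeCoeff (n + 1) := hR ▸ by positivity
  have hone : ∑ _T : RTree (Fin (n + 1)), (1 : ℝ) = treeCoeff (n + 1) := treeSum_one (n + 1)
  have hX := sum_fringeSum (n := n + 1) hg (by omega)
  have hX2 := sum_fringeSum_sq_le (n := n + 1) h0 h1 hg (by omega)
  have hHn : (n + 1).choose k * ((n + 1 - k : ℕ) : ℝ) ^ (n + 1 - k) = H (n + 1) * N ^ (n + 1) := by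
    rw [hH]
    simp only [hNc]
    rw [div_mul_cancel₀ _ hpow.ne']
  have hHk : (n + 1 - k).choose k * ((n + 1 - k - k : ℕ) : ℝ) ^ (n + 1 - k - k) =
      H (n + 1 - k) * ((n + 1 - k : ℕ) : ℝ) ^ (n + 1 - k) := by
    rw [hH]
    simp only
    rw [div_mul_cancel₀]
    have : n + 1 - k ≠ 0 := by omega
    positivity
  have hX2' : ∑ T : RTree (Fin (n + 1)), T.fringeSum g ^ 2 ≤
      a * (H (n + 1) * N ^ (n + 1) + (n + 1 - k : ℕ) * (a * H (n + 1 - k)) *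
        (H (n + 1) * N ^ (n + 1))) := by
    refine hX2.trans (le_of_eq ?_)
    rw [hHk, ← hHn]
    ring
  rw [hHn] at hX
  have hsub : ((n + 1 - k : ℕ) : ℝ) ≤ N := by
    rw [← hNc]
    exact_mod_cast Nat.sub_le _ _
  have hexp : ∑ T : RTree (Fin (n + 1)), (T.fringeSum g - N * (a * c)) ^ 2 =
      ∑ T : RTree (Fin (n + 1)), T.fringeSum g ^ 2 -
        2 * (N * (a * c)) * (a * (H (n + 1) * N ^ (n + 1))) +
        (N * (a * c)) ^ 2 * (N ^ (n + 1) / N) := by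
    rw [← hX, ← hR, ← hone, Finset.mul_sum, Finset.mul_sum, ← Finset.sum_sub_distrib,
      ← Finset.sum_add_distrib]
    exact Finset.sum_congr rfl fun T _ => by ring
  rw [expect_uniformTree, hexp, hR, div_div, div_le_iff₀ (by positivity)]
  have hb : ((n + 1 - k : ℕ) : ℝ) * (a * H (n + 1 - k)) * (H (n + 1) * N ^ (n + 1)) ≤
      N * (a * H (n + 1 - k)) * (H (n + 1) * N ^ (n + 1)) := by
    have := hH0 (n + 1)
    have := hH0 (n + 1 - k)
    gcongr
  have hb' := mul_le_mul_of_nonneg_left hb ha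
  have hfin : (a * (H (n + 1) * (1 / N) + H (n + 1) * (a * H (n + 1 - k))) -
      2 * (a * c) * (a * H (n + 1)) + (a * c) ^ 2) * (N ^ (n + 1) / N * N ^ 2) =
      a * (H (n + 1) * N ^ (n + 1)) + a * (N * (a * H (n + 1 - k)) * (H (n + 1) * N ^ (n + 1))) -
        2 * (N * (a * c)) * (a * (H (n + 1) * N ^ (n + 1))) +
        (N * (a * c)) ^ 2 * (N ^ (n + 1) / N) := by
    field_simp
  rw [hfin]
  linarith

end uniform

/-- The limit law weights a tree with `k` vertices by its number of labelings times `exp (-k) / k!`,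
which is the law of the Galton–Watson tree with Poisson offspring of mean one. By Cayley its total
size has the Borel distribution. -/
theorem hasDenseAtomsInLimit_uniformTree : HasDenseAtomsInLimit uniformTree := by
  classical
  refine hasDenseAtomsInLimit_of_expect _
    (p := fun s => treeSum s.size (Set.indicator {s} 1) *
      ((Real.exp 1)⁻¹ ^ s.size / s.size.factorial))
    (P := borelMass) (fun s => ?_) (fun k => ?_) hasSum_borelMass fun s => ?_
  · refine mul_pos ?_ (by positivity)
    obtain ⟨t, ht⟩ := exists_unlabel_eq (rfl : s.size = s.size)
    refine lt_of_lt_of_le ?_ (Finset.single_le_sum (f := fun t : RTree (Fin s.size) =>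
      Set.indicator {s} (1 : UTree → ℝ) t.unlabel)
      (fun _ _ => Set.indicator_nonneg (fun _ _ => zero_le_one) _) (Finset.mem_univ t))
    simp [ht]
  · have h1 : ∀ s : {s : UTree // s.size = k}, treeSum s.1.size (Set.indicator {s.1} 1) *
        ((Real.exp 1)⁻¹ ^ s.1.size / s.1.size.factorial) =
        treeSum k (Set.indicator {s.1} 1) * ((Real.exp 1)⁻¹ ^ k / k.factorial) := fun s => by
      rw [s.2]
    simp only [h1]
    rw [← Finset.sum_mul, borelMass, ← treeSum_one]
    congr 1
    simp only [treeSum]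
    rw [Finset.sum_comm]
    refine Finset.sum_congr rfl fun t _ => ?_
    rw [Finset.sum_eq_single ⟨t.unlabel, by rw [size_unlabel, Nat.card_fin]⟩]
    · simp
    · intro s _ hs
      exact Set.indicator_of_notMem (fun h => hs (Subtype.ext h.symm)) _
    · simp
  · refine tendsto_expect_uniformTree
      (fun _ => Set.indicator_nonneg (fun _ _ => zero_le_one) _)
      (fun _ => Set.indicator_le_self' (fun _ _ => zero_le_one) _) s.size_pos.ne'
      fun s' hs' => ?_
    exact Set.indicator_of_notMem (fun h => hs' (by rw [h])) _

end

end RandomTreeSpectra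

open RandomTreeSpectra MeasureTheory in
theorem theorem4p4 :
    (∀ (Ω : ℕ → Type*) [∀ n, MeasurableSpace (Ω n)] (P : ∀ n, Measure (Ω n))
        [∀ n, IsProbabilityMeasure (P n)] (T : ∀ n, Ω n → UTree) (_ : ∀ n, Measurable (T n))
        (Ω' : Type*) [MeasurableSpace Ω'] (Q : Measure Ω') [IsProbabilityMeasure Q]
        (S : Ω' → ℕ → UTree) (hS : Measurable S),
      FringeConverges P T Q S hS →
      ∃ (F : ProbabilityMeasure ℝ) (c : ℝ → ℝ),
        TendstoInProb P (fun n ω => (T n ω).spectralDist) F ∧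
        (∀ γ : ℝ,
          TendstoInProb P (fun n ω => ((T n ω).spectralDist : Measure ℝ).real {γ}) (c γ) ∧
          c γ ≤ (F : Measure ℝ).real {γ}) ∧
        ∀ (u : Multiset UTree) (γ : ℝ) (L : ℕ), forestMultiplicity u γ = L → 1 < L →
          0 < Q.real {ω | (S ω 0).deleteRoot = u} →
          0 < c γ ∧ 0 < (F : Measure ℝ).real {γ} ∧
          ((L : ℝ) - 1) * Q.real {ω | (S ω 0).deleteRoot = u} ≤ (F : Measure ℝ).real {γ}) ∧
    HasDenseAtomsInLimit recursiveTree ∧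
    (∀ (a : ℝ) (ha : -1 < a), HasDenseAtomsInLimit (preferentialTree a ha)) ∧
    HasDenseAtomsInLimit uniformTree := by
  refine ⟨fun Ω _ P _ T hT Ω' _ Q _ S hS h => ?_, hasDenseAtomsInLimit_recursiveTree,
    hasDenseAtomsInLimit_preferentialTree, hasDenseAtomsInLimit_uniformTree⟩
  exact exists_limit_of_fringeConverges P T Q S hS hT h
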